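/- Let $m>0$, $p>1$, $\omega,\beta\in\mathbb R$ with $|\beta|<2\sqrt{m^2-\omega^2}$ (in particular $m^2>\omega^2$), and let $$\varphi_\beta(x)=\Big[\tfrac{(p+1)(m^2-\omega^2)}{2}\,\mathrm{sech}^2\Big(\tfrac{(p-1)\sqrt{m^2-\omega^2}}{2}|x|+\tanh^{-1}\Big(-\tfrac{\beta}{2\sqrt{m^2-\omega^2}}\Big)\Big)\Big]^{\frac1{p-1}},\qquad x\in\mathbb R.$$ Let $D_\beta$ be the set of complex-valued $u\in H^1(\mathbb R)\cap H^2(\mathbb R\setminus\{0\})$ with $u'(0^+)-u'(0^-)=\beta u(0)$. Below, $u''$ denotes for $u\in D_\beta$ the second derivative on $\mathbb R\setminus\{0\}$. On the complex Hilbert space $L^2_{\mathbb C}=L^2(\mathbb R,\mathbb C)$ define $L_\beta^\pm$, both with domain $D_\beta$, by $$L_\beta^+u=-u''+(m^2-\omega^2)u-p\varphi_\beta^{p-1}u,\qquad L_\beta^-u=-u''+(m^2-\omega^2)u-\varphi_\beta^{p-1}u .$$ Let $L^2=L^2(\mathbb R,\mathbb C)$, regarded as a real Hilbert space with $\langle u,w\rangle=\mathrm{Re}\int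 u\bar w$. On $L^2\times L^2$ let $\mathcal L_\beta$ be the $\mathbb R$-linear operator with domain $D_\beta\times L^2$, $$\mathcal L_\beta(u,v)=\big(-u''+m^2u-\varphi_\beta^{p-1}u-(p-1)\varphi_\beta^{p-1}\mathrm{Re}(u)+i\omega v,\ v-i\omega u\big).$$ Let $\mathcal H=H^1(\mathbb R)\times L^2(\mathbb R)$ be the real Hilbert space of pairs of complex-valued functions with inner product $\langle(u,v),(w,z)\rangle_{\mathcal H}=\langle u',w'\rangle+\langle u,w\rangle+\langle v,z\rangle$, and let $\tilde L_\beta''$ be the bounded operator on $\mathcal H$ determined by $$\langle\tilde L_\beta''(u,v),(w,z)\rangle_{\mathcal H}=\langle u',w'\rangle+\langle m^2u-\varphi_\beta^{p-1}u-(p-1)\varphi_\beta^{p-1}\mathrm{Re}(u)+i\omega v,\,w\rangle+\beta\,\mathrm{Re}(u(0)\overline{w(0)})+\langle v-i\omega u,z\rangle .$$ For an operator $A$, $\sigma(A)$ is its spectrum (the real spectrum if $A$ is only $\mathbb R$-linear), $\sigma_{\mathrm{ess}}(A)$ is $\sigma(A)$ without its isolated points that are eigenvalues of finite multiplicity, and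 $n(A)$ is the number of negative eigenvalues of $A$ counted with multiplicities. For $\lambda\in\mathbb R\setminus\{1\}$ put $\Lambda(\lambda)=\lambda+\dfrac{\lambda\omega^2}{1-\lambda}$. **Proposition.** The operators $L_\beta^+$ and $L_\beta^-$ are selfadjoint and bounded from below on $L^2_{\mathbb C}$. Moreover, for every $\lambda\in\mathbb R\setminus\{1\}$: (i) $\lambda\in\sigma(\mathcal L_\beta)$ if and only if $\Lambda(\lambda)\in\sigma(L_\beta^+)\cup\sigma(L_\beta^-)$; (ii) $\dim_{\mathbb R}\ker(\mathcal L_\beta-\lambda)=\dim_{\mathbb C}\ker(L_\beta^+-\Lambda(\lambda))+\dim_{\mathbb C}\ker(L_\beta^--\Lambda(\lambda))$; (iii) $\lambda\in\sigma_{\mathrm{ess}}(\mathcal L_\beta)$ if and only if $\Lambda(\lambda)\in\sigma_{\mathrm{ess}}(L_\beta^+)\cup\sigma_{\mathrm{ess}}(L_\beta^-)$. In particular, $n(L_\beta^+)$ and $n(L_\beta^-)$ are finite and $n(\tilde L_\beta'')=n(L_\beta^+)+n(L_\beta^-)$, where multiplicities are real dimensions for $\tilde L_\beta''$ and complex dimensions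 for $L_\beta^\pm$. -/

import Mathlib

open MeasureTheory Filter Topology
open scoped ENNReal

noncomputable section

namespace DeltaKG

/-! ### Spectral notions for unbounded operators

They are stated over a field `𝕜`, which is `ℝ` or `ℂ`, since both `ℂ`-linear operators on complex
Hilbert spaces and `ℝ`-linear operators on real Hilbert spaces occur. -/

section Operators

variable {𝕜 E : Type*} [RCLike 𝕜] [NormedAddCommGroup E]

/-- The kernel of `A - z` (a subspace of the domain of `A`). -/
def opKer [NormedSpace 𝕜 E] (A : E →ₗ.[𝕜] E) (z : 𝕜) : Submodule 𝕜 A.domain :=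
  LinearMap.ker (A.toFun - z • A.domain.subtype)

/-- The resolvent set of `A`: those `z ∈ 𝕜` for which `A - z` is a bijection from the domain of `A`
onto `E` whose inverse `R` is a bounded operator on `E`. -/
def opResolventSet [NormedSpace 𝕜 E] (A : E →ₗ.[𝕜] E) : Set 𝕜 :=
  {z | ∃ R : E →L[𝕜] E,
    (∀ u : A.domain, R (A u - z • (u : E)) = u) ∧
    (∀ f : E, ∃ h : R f ∈ A.domain, A ⟨R f, h⟩ - z • R f = f)}

/-- The spectrum of `A`. -/
def opSpectrum [NormedSpace 𝕜 E] (A : E →ₗ.[𝕜] E) : Set 𝕜 := (opResolventSet A)ᶜ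

/-- The discrete spectrum: the isolated points of the spectrum which are eigenvalues of finite
multiplicity. -/
def opDiscreteSpectrum [NormedSpace 𝕜 E] (A : E →ₗ.[𝕜] E) : Set 𝕜 :=
  {z | z ∈ opSpectrum A ∧ ¬ AccPt z (𝓟 (opSpectrum A)) ∧
    opKer A z ≠ ⊥ ∧ FiniteDimensional 𝕜 (opKer A z)}

/-- The essential spectrum of a selfadjoint operator. -/
def opEssentialSpectrum [NormedSpace 𝕜 E] (A : E →ₗ.[𝕜] E) : Set 𝕜 :=
  opSpectrum A \ opDiscreteSpectrum A

/-- The number `n(A)` of negative eigenvalues of `A`, counted with multiplicities. -/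
def negEigenvalueCount [NormedSpace 𝕜 E] (A : E →ₗ.[𝕜] E) : Cardinal :=
  Cardinal.sum fun t : Set.Iio (0 : ℝ) => Module.rank 𝕜 (opKer A ((t : ℝ) : 𝕜))

/-- `A` is bounded from below: `⟨A u, u⟩ ≥ c ‖u‖²` on the domain of `A`, for some real `c`. -/
def IsBoundedFromBelow [InnerProductSpace 𝕜 E] (A : E →ₗ.[𝕜] E) : Prop :=
  ∃ c : ℝ, ∀ u : A.domain, c * ‖(u : E)‖ ^ 2 ≤ RCLike.re (inner 𝕜 (A u) (u : E))

end Operators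

/-! ### Function spaces on the line -/

/-- `L²(ℝ, ℂ)`. As a complex Hilbert space it is `L²_ℂ`; it is also a real Hilbert space, with the
inner product `Re ∫ u v̄`. -/
abbrev L2 : Type := Lp ℂ 2 (volume : Measure ℝ)

/-- `v` is a weak derivative of `u` on the open set `Ω`: `∫ φ' u = - ∫ φ v` for all test functions
`φ ∈ C_c^∞(Ω)`. -/
def HasWeakDerivOn (Ω : Set ℝ) (u v : ℝ → ℂ) : Prop :=
  ∀ φ : ℝ → ℝ, ContDiff ℝ (⊤ : ℕ∞) φ → HasCompactSupport φ → tsupport φ ⊆ Ω →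
    ∫ x, deriv φ x • u x = -∫ x, φ x • v x

theorem locallyIntegrable_coe (u : L2) : LocallyIntegrable u volume :=
  (Lp.memLp u).locallyIntegrable one_le_two

/-- Integration against a test function is a bounded linear functional on `L²`. -/
theorem exists_testCLM {ψ : ℝ → ℝ} (hc : Continuous ψ) (hs : HasCompactSupport ψ) :
    ∃ T : L2 →L[ℂ] ℂ, ∀ u : L2, T u = ∫ x, ψ x • u x := by
  have hm : MemLp (fun x => (ψ x : ℂ)) 2 (volume : Measure ℝ) :=
    (hc.memLp_of_hasCompactSupport hs).ofReal
  refine ⟨innerSL ℂ (hm.toLp _), fun u => ?_⟩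
  rw [innerSL_apply_apply, L2.inner_def]
  refine integral_congr_ae ?_
  filter_upwards [hm.coeFn_toLp] with x hx
  rw [hx]
  simp [mul_comm]

theorem exists_weakDeriv_iff {φ : ℝ → ℝ} (hφ : ContDiff ℝ (⊤ : ℕ∞) φ) (hs : HasCompactSupport φ) :
    ∃ T S : L2 →L[ℂ] ℂ, ∀ u v : L2,
      (∫ x, deriv φ x • u x = -∫ x, φ x • v x) ↔ T u = - S v := by
  obtain ⟨T, hT⟩ := exists_testCLM (hφ.continuous_deriv (by simp)) hs.deriv
  obtain ⟨S, hS⟩ := exists_testCLM hφ.continuous hs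
  exact ⟨T, S, fun u v => by rw [hT, hS]⟩

theorem real_smul_eq (c : ℝ) (u : L2) : c • u = (c : ℂ) • u :=
  (algebraMap_smul ℂ c u).symm

theorem HasWeakDerivOn.zero (Ω : Set ℝ) : HasWeakDerivOn Ω (0 : L2) (0 : L2) := by
  intro φ hφ hs _
  obtain ⟨T, S, h⟩ := exists_weakDeriv_iff hφ hs
  rw [h]; simp

theorem HasWeakDerivOn.add {Ω : Set ℝ} {u v u' v' : L2} (h₁ : HasWeakDerivOn Ω u v)
    (h₂ : HasWeakDerivOn Ω u' v') : HasWeakDerivOn Ω (u + u' : L2) (v + v' : L2) := by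
  intro φ hφ hs ht
  obtain ⟨T, S, h⟩ := exists_weakDeriv_iff hφ hs
  have e₁ := (h _ _).1 (h₁ φ hφ hs ht)
  have e₂ := (h _ _).1 (h₂ φ hφ hs ht)
  rw [h, map_add, map_add, e₁, e₂]; ring

theorem HasWeakDerivOn.smul {Ω : Set ℝ} {u v : L2} (c : ℂ) (h₁ : HasWeakDerivOn Ω u v) :
    HasWeakDerivOn Ω (c • u : L2) (c • v : L2) := by
  intro φ hφ hs ht
  obtain ⟨T, S, h⟩ := exists_weakDeriv_iff hφ hs
  have e₁ := (h _ _).1 (h₁ φ hφ hs ht)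
  rw [h, map_smul, map_smul, e₁]; simp

theorem HasWeakDerivOn.unique {Ω : Set ℝ} (hΩ : IsOpen Ω) (hn : volume Ωᶜ = 0) {u v w : L2}
    (h₁ : HasWeakDerivOn Ω u v) (h₂ : HasWeakDerivOn Ω u w) : v = w := by
  have hae := hΩ.ae_eq_zero_of_integral_contDiff_smul_eq_zero (μ := volume)
    (f := ((v - w : L2) : ℝ → ℂ)) ((locallyIntegrable_coe _).locallyIntegrableOn _)
    (by
      intro φ hφ hs ht
      obtain ⟨S, hS⟩ := exists_testCLM hφ.continuous hs
      have e₁ := h₁ φ hφ hs ht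
      have e₂ := h₂ φ hφ hs ht
      rw [← hS, map_sub, hS, hS]
      rw [e₁] at e₂
      rw [neg_inj.1 e₂, sub_self])
  have hΩae : ∀ᵐ x ∂(volume : Measure ℝ), x ∈ Ω := by
    rw [ae_iff]; exact hn
  rw [← sub_eq_zero]
  refine Lp.ext ?_
  filter_upwards [hae, hΩae, Lp.coeFn_zero ℂ 2 (volume : Measure ℝ)] with x h1 h2 h3
  rw [h1 h2, h3]; rfl

theorem HasWeakDerivOn.isClosed (Ω : Set ℝ) :
    IsClosed {q : WithLp 2 (L2 × L2) | HasWeakDerivOn Ω q.fst q.snd} := by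
  simp only [HasWeakDerivOn, Set.ofPred_forall]
  refine isClosed_iInter fun φ => isClosed_iInter fun hφ => isClosed_iInter fun hs =>
    isClosed_iInter fun _ => ?_
  obtain ⟨T, S, h⟩ := exists_weakDeriv_iff hφ hs
  simp only [h]
  exact isClosed_eq (T.continuous.comp (WithLp.fstL 2 ℂ L2 L2).continuous)
    (S.continuous.comp (WithLp.sndL 2 ℂ L2 L2).continuous).neg

/-- `H¹(ℝ)` as a real Hilbert space: a function `u ∈ L²` with weak derivative `u' ∈ L²` is
represented by the pair `(u, u')`, so that the inner product inherited from `L² × L²` is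
`⟨u, w⟩ + ⟨u', w'⟩` (with the real inner product of `L²`). -/
def H1 : Submodule ℝ (WithLp 2 (L2 × L2)) where
  carrier := {q | HasWeakDerivOn Set.univ q.fst q.snd}
  zero_mem' := HasWeakDerivOn.zero _
  add_mem' h₁ h₂ := HasWeakDerivOn.add h₁ h₂
  smul_mem' c q h := by
    have := HasWeakDerivOn.smul (c : ℂ) h
    rwa [← real_smul_eq, ← real_smul_eq] at this

instance : CompleteSpace H1 := (HasWeakDerivOn.isClosed Set.univ).completeSpace_coe

/-- The function `u ∈ L²` underlying an element of `H¹`. -/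
def H1.toL2 : H1 →L[ℝ] L2 := (WithLp.fstL 2 ℝ L2 L2).comp H1.subtypeL

/-- The derivative `u' ∈ L²` of an element `u` of `H¹`. -/
def H1.deriv : H1 →L[ℝ] L2 := (WithLp.sndL 2 ℝ L2 L2).comp H1.subtypeL

/-- Integration by parts against the primitive of a real function. -/
theorem integral_deriv_mul_primitive {φ : ℝ → ℝ} (hφ : ContDiff ℝ (⊤ : ℕ∞) φ) (hs : HasCompactSupport φ)
    {v : ℝ → ℝ} (hv : LocallyIntegrable v volume) :
    ∫ x, deriv φ x * (∫ t in (0 : ℝ)..x, v t) = -∫ x, φ x * v x := by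
  obtain ⟨R, hR0, hR⟩ : ∃ R : ℝ, 0 < R ∧ tsupport φ ⊆ Set.Ioo (-R) R := by
    obtain ⟨R, hR⟩ := hs.isBounded.subset_closedBall (0 : ℝ)
    refine ⟨|R| + 1, by positivity, fun x hx => ?_⟩
    have := hR hx
    rw [Metric.mem_closedBall, dist_zero_right, Real.norm_eq_abs] at this
    have h1 := abs_le.1 (this.trans (le_abs_self R))
    exact ⟨by linarith, by linarith⟩
  have hRR : -R ≤ R := by linarith
  have hvi : ∀ a b, IntervalIntegrable v volume a b := fun a b =>
    (hv.integrableOn_isCompact isCompact_uIcc).intervalIntegrable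
  have e1 : ∫ x, deriv φ x * (∫ t in (0 : ℝ)..x, v t)
      = ∫ x in (-R)..R, deriv φ x * (∫ t in (0 : ℝ)..x, v t) := by
    rw [intervalIntegral.integral_eq_integral_of_support_subset]
    intro x hx
    exact Set.Ioo_subset_Ioc_self
      (hR (support_deriv_subset (Function.support_mul_subset_left _ _ hx)))
  have e2 : ∫ x, φ x * v x = ∫ x in (-R)..R, φ x * v x := by
    rw [intervalIntegral.integral_eq_integral_of_support_subset]
    intro x hx
    exact Set.Ioo_subset_Ioc_self
      (hR (subset_tsupport _ (Function.support_mul_subset_left _ _ hx)))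
  have hac1 : AbsolutelyContinuousOnInterval φ (-R) R :=
    ContDiffOn.absolutelyContinuousOnInterval
      ((hφ.of_le (by exact_mod_cast le_top)).contDiffOn)
  have hac2 : AbsolutelyContinuousOnInterval (fun x => ∫ t in (0 : ℝ)..x, v t) (-R) R :=
    (hvi (-R) R).absolutelyContinuousOnInterval_intervalIntegral
      (c := 0) (by rw [Set.uIcc_of_le hRR]; exact ⟨by linarith, hR0.le⟩)
  have key := hac1.integral_mul_deriv_eq_deriv_mul hac2
  have e3 : ∫ x in (-R)..R, φ x * deriv (fun x => ∫ t in (0 : ℝ)..x, v t) x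
      = ∫ x in (-R)..R, φ x * v x := by
    apply intervalIntegral.integral_congr_ae
    filter_upwards [LocallyIntegrable.ae_hasDerivAt_integral hv] with x hx _
    rw [(hx 0).deriv]
  have hφ0 : ∀ x, x ∉ Set.Ioo (-R) R → φ x = 0 := fun x hx =>
    image_eq_zero_of_notMem_tsupport fun h => hx (hR h)
  rw [e1, e2, ← e3, key, hφ0 R (fun h => lt_irrefl _ h.2), hφ0 (-R) (fun h => lt_irrefl _ h.1)]
  simp

/-- A locally integrable function with vanishing weak derivative is constant. -/
theorem ae_eq_const_of_integral_deriv {g : ℝ → ℂ} (hg : LocallyIntegrable g volume)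
    (h : ∀ φ : ℝ → ℝ, ContDiff ℝ (⊤ : ℕ∞) φ → HasCompactSupport φ → ∫ x, deriv φ x • g x = 0) :
    ∃ c : ℂ, g =ᵐ[volume] fun _ => c := by
  obtain ⟨b⟩ : Nonempty (ContDiffBump (0 : ℝ)) := ⟨⟨1, 2, by norm_num, by norm_num⟩⟩
  set η : ℝ → ℝ := b.normed volume with hη
  have hηc : ContDiff ℝ (⊤ : ℕ∞) η := b.contDiff_normed
  have hηs : HasCompactSupport η := b.hasCompactSupport_normed
  have hη1 : ∫ x, η x = 1 := b.integral_normed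
  refine ⟨∫ x, η x • g x, ?_⟩
  refine ae_eq_of_integral_contDiff_smul_eq hg (continuous_const.locallyIntegrable) ?_
  intro φ hφ hs
  have hφi : Integrable φ volume := hφ.continuous.integrable_of_hasCompactSupport hs
  have hηi : Integrable η volume := hηc.continuous.integrable_of_hasCompactSupport hηs
  set a : ℝ := ∫ x, φ x with ha
  set χ : ℝ → ℝ := fun x => φ x - a * η x with hχ
  have hχc : ContDiff ℝ (⊤ : ℕ∞) χ := hφ.sub (contDiff_const.mul hηc)
  have hχs : HasCompactSupport χ := hs.sub (hηs.mul_left)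
  have hχi : Integrable χ volume := hχc.continuous.integrable_of_hasCompactSupport hχs
  have hχ0 : ∫ x, χ x = 0 := by
    rw [hχ, integral_sub hφi (hηi.const_mul a), integral_const_mul, hη1]; simp [ha]
  obtain ⟨R, hR⟩ : ∃ R : ℝ, tsupport χ ⊆ Set.Ioo (-R) R := by
    obtain ⟨R, hR⟩ := hχs.isBounded.subset_closedBall (0 : ℝ)
    refine ⟨R + 1, fun x hx => ?_⟩
    have := hR hx
    rw [Metric.mem_closedBall, dist_zero_right, Real.norm_eq_abs] at this
    have h1 := abs_le.1 this
    exact ⟨by linarith, by linarith⟩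
  set ψ : ℝ → ℝ := fun x => ∫ t in (-R)..x, χ t with hψ
  have hψd : ∀ x, HasDerivAt ψ (χ x) x := fun x =>
    intervalIntegral.integral_hasDerivAt_right (hχc.continuous.intervalIntegrable _ _)
      hχc.continuous.stronglyMeasurable.stronglyMeasurableAtFilter hχc.continuous.continuousAt
  have hψ' : deriv ψ = χ := funext fun x => (hψd x).deriv
  have hψc : ContDiff ℝ (⊤ : ℕ∞) ψ := by
    rw [contDiff_infty_iff_deriv, hψ']
    exact ⟨fun x => (hψd x).differentiableAt, hχc⟩
  have hχout : ∀ x, x ∉ Set.Ioo (-R) R → χ x = 0 := fun x hx =>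
    image_eq_zero_of_notMem_tsupport fun h => hx (hR h)
  have hψs : HasCompactSupport ψ := by
    refine HasCompactSupport.intro (isCompact_Icc (a := -R) (b := R)) fun x hx => ?_
    rw [Set.mem_Icc, not_and_or, not_le, not_le] at hx
    rcases hx with hx | hx
    · refine intervalIntegral.integral_zero_ae (Eventually.of_forall fun t ht => hχout t ?_)
      rw [Set.uIoc_of_ge hx.le] at ht
      exact fun h => absurd h.1 (not_lt.2 ht.2)
    · have : ∫ t in (-R)..x, χ t = ∫ t, χ t := by
        apply intervalIntegral.integral_eq_integral_of_support_subset
        intro t ht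
        have := hR (subset_tsupport _ ht)
        exact ⟨this.1, (this.2.trans hx).le⟩
      simp only [hψ, this, hχ0]
  have h0 := h ψ hψc hψs
  rw [hψ'] at h0
  have i1 : Integrable (fun x => φ x • g x) volume :=
    hg.integrable_smul_left_of_hasCompactSupport hφ.continuous hs
  have i2 : Integrable (fun x => η x • g x) volume :=
    hg.integrable_smul_left_of_hasCompactSupport hηc.continuous hηs
  have e : ∫ x, χ x • g x = (∫ x, φ x • g x) - a • ∫ x, η x • g x := by
    rw [← integral_smul, ← integral_sub i1 (i2.fun_smul a)]
    refine integral_congr_ae (Eventually.of_forall fun x => ?_)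
    simp only [hχ, sub_smul, mul_smul]
  rw [e, sub_eq_zero] at h0
  rw [h0, integral_smul_const]

/-- Every `u ∈ H¹(ℝ)` has a continuous representative, which is a primitive of `u'`. -/
theorem exists_continuous_rep {u v : L2} (h : HasWeakDerivOn Set.univ u v) :
    ∃ f : ℝ → ℂ, Continuous f ∧ f =ᵐ[volume] u ∧ ∀ x, f x = f 0 + ∫ t in (0 : ℝ)..x, v t := by
  have hu := locallyIntegrable_coe u
  have hv := locallyIntegrable_coe v
  have hvi : ∀ a b, IntervalIntegrable v volume a b := fun a b =>
    (hv.integrableOn_isCompact isCompact_uIcc).intervalIntegrable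
  set w : ℝ → ℂ := fun x => ∫ t in (0 : ℝ)..x, v t with hw
  have hwc : Continuous w :=
    intervalIntegral.continuous_primitive hvi 0
  have hg : LocallyIntegrable (fun x => u x - w x) volume := hu.sub hwc.locallyIntegrable
  obtain ⟨c, hc⟩ := ae_eq_const_of_integral_deriv hg (by
    intro φ hφ hs
    have hd : Continuous (deriv φ) := hφ.continuous_deriv (by simp)
    have i1 := hu.integrable_smul_left_of_hasCompactSupport hd hs.deriv
    have i2 := hwc.locallyIntegrable (μ := volume) |>.integrable_smul_left_of_hasCompactSupport
      hd hs.deriv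
    have i3 := hv.integrable_smul_left_of_hasCompactSupport hφ.continuous hs
    have e : ∫ x, deriv φ x • w x = -∫ x, φ x • v x := by
      have hre : LocallyIntegrable (fun x => (v x).re) volume := fun x => by
        obtain ⟨S, hS, hi⟩ := hv x
        exact ⟨S, hS, MeasureTheory.Integrable.re hi⟩
      have him : LocallyIntegrable (fun x => (v x).im) volume := fun x => by
        obtain ⟨S, hS, hi⟩ := hv x
        exact ⟨S, hS, MeasureTheory.Integrable.im hi⟩
      have hwre : ∀ x, (w x).re = ∫ t in (0 : ℝ)..x, (v t).re := fun x =>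
        (Complex.reCLM.intervalIntegral_comp_comm (hvi 0 x)).symm
      have hwim : ∀ x, (w x).im = ∫ t in (0 : ℝ)..x, (v t).im := fun x =>
        (Complex.imCLM.intervalIntegral_comp_comm (hvi 0 x)).symm
      apply Complex.ext
      · have := integral_deriv_mul_primitive hφ hs hre
        rw [Complex.neg_re]
        refine Eq.trans (Complex.reCLM.integral_comp_comm i2).symm
          (Eq.trans ?_ (congrArg Neg.neg (Complex.reCLM.integral_comp_comm i3)))
        simpa [hwre] using this
      · have := integral_deriv_mul_primitive hφ hs him
        rw [Complex.neg_im]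
        refine Eq.trans (Complex.imCLM.integral_comp_comm i2).symm
          (Eq.trans ?_ (congrArg Neg.neg (Complex.imCLM.integral_comp_comm i3)))
        simpa [hwim] using this
    simp only [smul_sub]
    rw [integral_sub i1 i2, h φ hφ hs (Set.subset_univ _), e, sub_self])
  refine ⟨fun x => c + w x, continuous_const.add hwc, ?_, fun x => ?_⟩
  · filter_upwards [hc] with x hx
    rw [← hx]; ring
  · simp [hw]

/-- The continuous representative of an element of `H¹(ℝ)`. -/
def H1.rep (u : H1) : ℝ → ℂ := (exists_continuous_rep u.2).choose

theorem H1.rep_continuous (u : H1) : Continuous (H1.rep u) :=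
  (exists_continuous_rep u.2).choose_spec.1

theorem H1.rep_ae_eq (u : H1) : H1.rep u =ᵐ[volume] H1.toL2 u :=
  (exists_continuous_rep u.2).choose_spec.2.1

theorem H1.rep_eq (u : H1) (x : ℝ) : H1.rep u x = H1.rep u 0 + ∫ t in (0 : ℝ)..x, H1.deriv u t :=
  (exists_continuous_rep u.2).choose_spec.2.2 x

theorem H1.rep_unique (u : H1) {f : ℝ → ℂ} (hf : Continuous f) (h : f =ᵐ[volume] H1.toL2 u) :
    H1.rep u = f :=
  ((H1.rep_continuous u).ae_eq_iff_eq volume hf).1 ((H1.rep_ae_eq u).trans h.symm)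

/-- `∫_0^1 |v| ≤ ‖v‖` for `v ∈ L²`. -/
theorem integral_norm_le_norm (v : L2) : ∫ t in Set.Ioc (0 : ℝ) 1, ‖v t‖ ≤ ‖v‖ := by
  have hm : MemLp v 2 (volume.restrict (Set.Ioc (0 : ℝ) 1)) := (Lp.memLp v).restrict _
  have h1 : eLpNorm v 1 (volume.restrict (Set.Ioc (0 : ℝ) 1)) ≤ eLpNorm v 2 volume := by
    refine le_trans ?_ (eLpNorm_mono_measure v (Measure.restrict_le_self (s := Set.Ioc (0 : ℝ) 1)))
    have : IsProbabilityMeasure (volume.restrict (Set.Ioc (0 : ℝ) 1)) := ⟨by simp⟩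
    exact eLpNorm_le_eLpNorm_of_exponent_le one_le_two hm.1
  rw [integral_norm_eq_lintegral_enorm hm.1, ← eLpNorm_one_eq_lintegral_enorm, Lp.norm_def]
  exact ENNReal.toReal_mono (Lp.eLpNorm_ne_top v) h1

theorem H1.norm_rep_zero_le (u : H1) : ‖H1.rep u 0‖ ≤ 2 * ‖u‖ := by
  have h1 := integral_norm_le_norm (H1.toL2 u)
  have h2 := integral_norm_le_norm (H1.deriv u)
  have hn1 : ‖H1.toL2 u‖ ≤ ‖u‖ := WithLp.norm_fst_le _ (u : WithLp 2 (L2 × L2))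
  have hn2 : ‖H1.deriv u‖ ≤ ‖u‖ := WithLp.norm_snd_le _ (u : WithLp 2 (L2 × L2))
  have hint : IntegrableOn (fun t => ‖H1.deriv u t‖) (Set.Ioc (0 : ℝ) 1) volume :=
    (((locallyIntegrable_coe (H1.deriv u)).integrableOn_isCompact
      (isCompact_Icc (a := (0 : ℝ)) (b := 1))).mono_set Set.Ioc_subset_Icc_self).norm
  have hpt : ∀ x ∈ Set.Ioc (0 : ℝ) 1,
      ‖H1.rep u 0‖ ≤ ‖H1.rep u x‖ + ∫ t in Set.Ioc (0 : ℝ) 1, ‖H1.deriv u t‖ := by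
    intro x hx
    have e : H1.rep u 0 = H1.rep u x - ∫ t in (0 : ℝ)..x, H1.deriv u t := by rw [H1.rep_eq u x]; ring
    have hb : ‖∫ t in (0 : ℝ)..x, H1.deriv u t‖ ≤ ∫ t in Set.Ioc (0 : ℝ) 1, ‖H1.deriv u t‖ := by
      rw [intervalIntegral.integral_of_le hx.1.le]
      refine (norm_integral_le_integral_norm _).trans ?_
      exact setIntegral_mono_set hint (Eventually.of_forall fun _ => norm_nonneg _)
        (Set.Ioc_subset_Ioc_right hx.2).eventuallyLE
    calc ‖H1.rep u 0‖ = ‖H1.rep u x - ∫ t in (0 : ℝ)..x, H1.deriv u t‖ := by rw [← e]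
      _ ≤ _ := (norm_sub_le _ _).trans (by gcongr)
  have hrepi : IntegrableOn (fun t => ‖H1.rep u t‖) (Set.Ioc (0 : ℝ) 1) volume :=
    ((H1.rep_continuous u).norm.integrableOn_Icc (a := (0 : ℝ)) (b := 1)).mono_set
      Set.Ioc_subset_Icc_self
  have hconst : ∀ c : ℝ, ∫ _ in Set.Ioc (0 : ℝ) 1, c = c := fun c => by simp
  have hI : ‖H1.rep u 0‖ ≤ (∫ t in Set.Ioc (0 : ℝ) 1, ‖H1.rep u t‖)
      + ∫ t in Set.Ioc (0 : ℝ) 1, ‖H1.deriv u t‖ := by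
    rw [← hconst ‖H1.rep u 0‖, ← hconst (∫ t in Set.Ioc (0 : ℝ) 1, ‖H1.deriv u t‖),
      ← integral_add hrepi (by simp)]
    exact setIntegral_mono_on (by simp) (hrepi.add (by simp)) measurableSet_Ioc
      (by simpa using hpt)
  have hcongr : ∫ t in Set.Ioc (0 : ℝ) 1, ‖H1.rep u t‖ = ∫ t in Set.Ioc (0 : ℝ) 1, ‖H1.toL2 u t‖ :=
    integral_congr_ae ((ae_restrict_of_ae (H1.rep_ae_eq u)).mono fun x hx => by simp only [hx])
  rw [hcongr] at hI
  linarith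

/-- The bounded functional `u ↦ u(0)` on `H¹(ℝ)`. -/
def H1.evalZero : H1 →L[ℝ] ℂ :=
  LinearMap.mkContinuous
    { toFun := fun u => H1.rep u 0
      map_add' := fun u v => by
        have h : H1.rep u + H1.rep v =ᵐ[volume] H1.toL2 (u + v) := by
          rw [map_add]
          exact ((H1.rep_ae_eq u).add (H1.rep_ae_eq v)).trans (Lp.coeFn_add _ _).symm
        rw [H1.rep_unique (u + v) ((H1.rep_continuous u).add (H1.rep_continuous v)) h,
          Pi.add_apply]
      map_smul' := fun c u => by
        have h : c • H1.rep u =ᵐ[volume] H1.toL2 (c • u) := by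
          rw [map_smul]
          exact ((H1.rep_ae_eq u).const_smul c).trans (Lp.coeFn_smul c (H1.toL2 u)).symm
        rw [H1.rep_unique (c • u) ((H1.rep_continuous u).const_smul c) h]
        rfl }
    2 (fun u => H1.norm_rep_zero_le u)

/-! ### The domain `D_β` -/

/-- `u ∈ H¹(ℝ) ∩ H²(ℝ ∖ {0})` with `u' = u₁` and with second derivative `u₂` on `ℝ ∖ {0}`. -/
def HasDerivs (u u₁ u₂ : L2) : Prop :=
  HasWeakDerivOn Set.univ u u₁ ∧ HasWeakDerivOn {0}ᶜ u₁ u₂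

/-- The jump condition `u'(0⁺) - u'(0⁻) = β u(0)`. Here `f` is the continuous representative of `u`
and `g` is the representative of the derivative `u₁` which is continuous on `ℝ ∖ {0}`. -/
def JumpCondition (β : ℝ) (u u₁ : L2) : Prop :=
  ∃ f g : ℝ → ℂ, Continuous f ∧ f =ᵐ[volume] u ∧ ContinuousOn g {0}ᶜ ∧ g =ᵐ[volume] u₁ ∧
    ∃ a b : ℂ, Tendsto g (𝓝[>] 0) (𝓝 a) ∧ Tendsto g (𝓝[<] 0) (𝓝 b) ∧ a - b = β * f 0

/-- `D_β`, the space of all `u ∈ H¹(ℝ) ∩ H²(ℝ ∖ {0})` with `u'(0⁺) - u'(0⁻) = β u(0)`. -/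
def deltaDomain (β : ℝ) : Submodule ℂ L2 where
  carrier := {u | ∃ u₁ u₂ : L2, HasDerivs u u₁ u₂ ∧ JumpCondition β u u₁}
  zero_mem' := ⟨0, 0, ⟨.zero _, .zero _⟩, 0, 0, continuous_const, (Lp.coeFn_zero _ _ _).symm,
    continuousOn_const, (Lp.coeFn_zero _ _ _).symm, 0, 0, tendsto_const_nhds, tendsto_const_nhds,
    by simp⟩
  add_mem' := by
    rintro u v ⟨u₁, u₂, hu, f, g, hf, hfu, hg, hgu, a, b, ha, hb, hab⟩
      ⟨v₁, v₂, hv, f', g', hf', hfv, hg', hgv, a', b', ha', hb', hab'⟩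
    refine ⟨u₁ + v₁, u₂ + v₂, ⟨hu.1.add hv.1, hu.2.add hv.2⟩, f + f', g + g', hf.add hf',
      (hfu.add hfv).trans (Lp.coeFn_add _ _).symm, hg.add hg',
      (hgu.add hgv).trans (Lp.coeFn_add _ _).symm, a + a', b + b', ha.add ha', hb.add hb', ?_⟩
    rw [Pi.add_apply]
    linear_combination hab + hab'
  smul_mem' := by
    rintro c u ⟨u₁, u₂, hu, f, g, hf, hfu, hg, hgu, a, b, ha, hb, hab⟩
    refine ⟨c • u₁, c • u₂, ⟨hu.1.smul c, hu.2.smul c⟩, c • f, c • g, hf.const_smul c,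
      (hfu.const_smul c).trans (Lp.coeFn_smul _ _).symm, hg.const_smul c,
      (hgu.const_smul c).trans (Lp.coeFn_smul _ _).symm, c • a, c • b, ha.const_smul c,
      hb.const_smul c, ?_⟩
    simp only [Pi.smul_apply, smul_eq_mul]
    linear_combination c * hab

theorem HasDerivs.unique {u u₁ u₂ v₁ v₂ : L2} (h : HasDerivs u u₁ u₂) (h' : HasDerivs u v₁ v₂) :
    u₂ = v₂ := by
  obtain rfl := h.1.unique isOpen_univ (by simp) h'.1
  exact h.2.unique isOpen_compl_singleton (by simp) h'.2

/-- The second derivative `u''` on `ℝ ∖ {0}` of `u ∈ D_β`, as an element of `L²`. -/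
def secondDeriv (β : ℝ) : deltaDomain β →ₗ[ℂ] L2 where
  toFun u := u.2.choose_spec.choose
  map_add' u v := by
    have hu := u.2.choose_spec.choose_spec.1
    have hv := v.2.choose_spec.choose_spec.1
    exact (u + v).2.choose_spec.choose_spec.1.unique ⟨hu.1.add hv.1, hu.2.add hv.2⟩
  map_smul' c u := by
    have hu := u.2.choose_spec.choose_spec.1
    exact (c • u).2.choose_spec.choose_spec.1.unique ⟨hu.1.smul c, hu.2.smul c⟩

theorem secondDeriv_eq {β : ℝ} (u : deltaDomain β) {u₁ u₂ : L2} (h : HasDerivs u u₁ u₂) :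
    secondDeriv β u = u₂ :=
  u.2.choose_spec.choose_spec.1.unique h

/-! ### The standing wave and the operators -/

/-- The parameters: the mass `m > 0`, the exponent `p > 1`, the frequency `ω` and the strength `β`
of the delta interaction, with `|β| < β₀ = 2 √(m² - ω²)` (in particular `m² > ω²`). -/
structure Params where
  m : ℝ
  p : ℝ
  ω : ℝ
  β : ℝ
  m_pos : 0 < m
  one_lt_p : 1 < p
  abs_β_lt : |β| < 2 * √(m ^ 2 - ω ^ 2)

variable (P : Params)

/-- The profile of the standing wave,
`φ_β(x) = [(p+1)(m²-ω²)/2 · sech²((p-1)√(m²-ω²)/2 · |x| + artanh(-β/(2√(m²-ω²))))]^(1/(p-1))`. -/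
def profile (x : ℝ) : ℝ :=
  ((P.p + 1) * (P.m ^ 2 - P.ω ^ 2) / 2 *
    (1 / Real.cosh ((P.p - 1) * √(P.m ^ 2 - P.ω ^ 2) / 2 * |x| +
      Real.artanh (-P.β / (2 * √(P.m ^ 2 - P.ω ^ 2))))) ^ 2) ^ (1 / (P.p - 1))

theorem sq_sub_sq_pos : 0 < P.m ^ 2 - P.ω ^ 2 := by
  have := (abs_nonneg P.β).trans_lt P.abs_β_lt
  exact Real.sqrt_pos.1 (by linarith)

theorem profile_rpow (x : ℝ) : profile P x ^ (P.p - 1) =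
    (P.p + 1) * (P.m ^ 2 - P.ω ^ 2) / 2 *
    (1 / Real.cosh ((P.p - 1) * √(P.m ^ 2 - P.ω ^ 2) / 2 * |x| +
      Real.artanh (-P.β / (2 * √(P.m ^ 2 - P.ω ^ 2))))) ^ 2 := by
  have h1 := sq_sub_sq_pos P
  have h2 := P.one_lt_p
  unfold profile
  rw [← Real.rpow_mul, one_div_mul_cancel (by linarith), Real.rpow_one]
  have := Real.cosh_pos ((P.p - 1) * √(P.m ^ 2 - P.ω ^ 2) / 2 * |x| +
      Real.artanh (-P.β / (2 * √(P.m ^ 2 - P.ω ^ 2))))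
  positivity

theorem memLp_potential :
    MemLp (fun x => ((profile P x ^ (P.p - 1) : ℝ) : ℂ)) ∞ (volume : Measure ℝ) := by
  have h1 := sq_sub_sq_pos P
  have h2 := P.one_lt_p
  refine memLp_top_of_bound ?_ ((P.p + 1) * (P.m ^ 2 - P.ω ^ 2) / 2) ?_
  · refine Continuous.aestronglyMeasurable ?_
    simp only [profile_rpow]
    refine Complex.continuous_ofReal.comp (continuous_const.mul (Continuous.pow ?_ 2))
    exact continuous_const.div (by fun_prop) fun x => (Real.cosh_pos _).ne'
  · refine Eventually.of_forall fun x => ?_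
    rw [profile_rpow, Complex.norm_real, Real.norm_of_nonneg (by positivity)]
    refine mul_le_of_le_one_right (by positivity) (pow_le_one₀ ?_ ?_)
    · have := Real.cosh_pos ((P.p - 1) * √(P.m ^ 2 - P.ω ^ 2) / 2 * |x| +
        Real.artanh (-P.β / (2 * √(P.m ^ 2 - P.ω ^ 2))))
      positivity
    · rw [div_le_one (Real.cosh_pos _)]
      exact Real.one_le_cosh _

/-- The bounded operator `u ↦ φ_β^{p-1} u` on `L²`. -/
def mulPotential : L2 →L[ℂ] L2 :=
  (ContinuousLinearMap.mul ℂ ℂ).holderL volume ∞ 2 2 ((memLp_potential P).toLp _)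

theorem mulPotential_ae (u : L2) :
    mulPotential P u =ᵐ[volume] fun x => ((profile P x ^ (P.p - 1) : ℝ) : ℂ) * u x := by
  refine ((ContinuousLinearMap.mul ℂ ℂ).coeFn_holder (r := 2)
    ((memLp_potential P).toLp _) u).trans ?_
  filter_upwards [(memLp_potential P).coeFn_toLp] with x hx
  simp [hx]

/-- The `ℝ`-linear map `u ↦ Re u` on `L²`. -/
def reL2 : L2 →L[ℝ] L2 := (Complex.ofRealCLM.comp Complex.reCLM).compLpL 2 volume

theorem reL2_ae (u : L2) : reL2 u =ᵐ[volume] fun x => ((u x).re : ℂ) :=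
  ContinuousLinearMap.coeFn_compLpL _ u

/-- `L_β^+ u = -u'' + (m² - ω²) u - p φ_β^{p-1} u` on `D_β`, as an operator on `L²_ℂ`. -/
def Lplus : L2 →ₗ.[ℂ] L2 where
  domain := deltaDomain P.β
  toFun := -secondDeriv P.β + ((P.m ^ 2 - P.ω ^ 2 : ℝ) : ℂ) • (deltaDomain P.β).subtype
    - (P.p : ℂ) • (mulPotential P : L2 →ₗ[ℂ] L2) ∘ₗ (deltaDomain P.β).subtype

/-- `L_β^- u = -u'' + (m² - ω²) u - φ_β^{p-1} u` on `D_β`, as an operator on `L²_ℂ`. -/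
def Lminus : L2 →ₗ.[ℂ] L2 where
  domain := deltaDomain P.β
  toFun := -secondDeriv P.β + ((P.m ^ 2 - P.ω ^ 2 : ℝ) : ℂ) • (deltaDomain P.β).subtype
    - (mulPotential P : L2 →ₗ[ℂ] L2) ∘ₗ (deltaDomain P.β).subtype

theorem Lplus_apply (u : (Lplus P).domain) :
    Lplus P u = -secondDeriv P.β u + ((P.m ^ 2 - P.ω ^ 2 : ℝ) : ℂ) • (u : L2)
      - (P.p : ℂ) • mulPotential P (u : L2) :=
  rfl

theorem Lminus_apply (u : (Lminus P).domain) :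
    Lminus P u = -secondDeriv P.β u + ((P.m ^ 2 - P.ω ^ 2 : ℝ) : ℂ) • (u : L2)
      - mulPotential P (u : L2) :=
  rfl

/-- The subspace `D_β × L²` of the real Hilbert space `L² × L²`. -/
def pairDomain (β : ℝ) : Submodule ℝ (WithLp 2 (L2 × L2)) :=
  ((deltaDomain β).restrictScalars ℝ).comap
    (WithLp.fstL 2 ℝ L2 L2 : WithLp 2 (L2 × L2) →ₗ[ℝ] L2)

/-- The first component `u` of `(u, v) ∈ D_β × L²`. -/
def pairDomain.fst (β : ℝ) : pairDomain β →ₗ[ℝ] deltaDomain β where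
  toFun U := ⟨(U : WithLp 2 (L2 × L2)).fst, U.2⟩
  map_add' _ _ := rfl
  map_smul' _ _ := rfl

/-- The second component `v` of `(u, v) ∈ D_β × L²`. -/
def pairDomain.snd (β : ℝ) : pairDomain β →ₗ[ℝ] L2 where
  toFun U := (U : WithLp 2 (L2 × L2)).snd
  map_add' _ _ := rfl
  map_smul' _ _ := rfl

/-- The `ℝ`-linear map `u ↦ -u'' + m² u - φ_β^{p-1} u - (p-1) φ_β^{p-1} Re u` on `D_β`. -/
def matrixOpDiag : deltaDomain P.β →ₗ[ℝ] L2 :=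
  (-secondDeriv P.β + ((P.m ^ 2 : ℝ) : ℂ) • (deltaDomain P.β).subtype
    - (mulPotential P : L2 →ₗ[ℂ] L2) ∘ₗ (deltaDomain P.β).subtype).restrictScalars ℝ
  - ((((P.p - 1 : ℝ) : ℂ) • mulPotential P).restrictScalars ℝ : L2 →ₗ[ℝ] L2) ∘ₗ
    (reL2 : L2 →ₗ[ℝ] L2) ∘ₗ (deltaDomain P.β).subtype.restrictScalars ℝ

/-- Multiplication by `iω` on `L²`. -/
def mulIω : L2 →L[ℝ] L2 :=
  ((Complex.I * P.ω) • ContinuousLinearMap.id ℂ L2).restrictScalars ℝ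

/-- The `ℝ`-linear operator
`𝓛_β (u, v) = (-u'' + m² u - φ_β^{p-1} u - (p-1) φ_β^{p-1} Re u + iωv, v - iωu)` with domain
`D_β × L²`, on the real Hilbert space `L² × L²`. -/
def matrixOp : WithLp 2 (L2 × L2) →ₗ.[ℝ] WithLp 2 (L2 × L2) where
  domain := pairDomain P.β
  toFun := (WithLp.linearEquiv 2 ℝ (L2 × L2)).symm.toLinearMap ∘ₗ LinearMap.prod
    (matrixOpDiag P ∘ₗ pairDomain.fst P.β + (mulIω P : L2 →ₗ[ℝ] L2) ∘ₗ pairDomain.snd P.β)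
    (pairDomain.snd P.β - (mulIω P : L2 →ₗ[ℝ] L2) ∘ₗ
      (deltaDomain P.β).subtype.restrictScalars ℝ ∘ₗ pairDomain.fst P.β)

theorem matrixOp_apply (U : (matrixOp P).domain) :
    matrixOp P U = WithLp.toLp 2
      (-secondDeriv P.β ⟨U.1.fst, U.2⟩ + ((P.m ^ 2 : ℝ) : ℂ) • U.1.fst
          - mulPotential P U.1.fst - ((P.p - 1 : ℝ) : ℂ) • mulPotential P (reL2 U.1.fst)
          + (Complex.I * P.ω) • U.1.snd,
        U.1.snd - (Complex.I * P.ω) • U.1.fst) :=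
  rfl

/-- The real Hilbert space `𝓗 = H¹(ℝ) × L²(ℝ)`. -/
abbrev EnergySpace : Type := WithLp 2 (H1 × L2)

/-- The map `(u, v) ↦ m² u - φ_β^{p-1} u - (p-1) φ_β^{p-1} Re u + iωv`. -/
def lowerOrder : EnergySpace →L[ℝ] L2 :=
  ((((P.m ^ 2 : ℝ) : ℂ) • ContinuousLinearMap.id ℂ L2 - mulPotential P).restrictScalars ℝ
    - ((((P.p - 1 : ℝ) : ℂ) • mulPotential P).restrictScalars ℝ).comp reL2).comp
      (H1.toL2.comp (WithLp.fstL 2 ℝ H1 L2))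
  + mulIω P ∘L WithLp.sndL 2 ℝ H1 L2

/-- The map `(u, v) ↦ v - iωu`. -/
def secondComponent : EnergySpace →L[ℝ] L2 :=
  WithLp.sndL 2 ℝ H1 L2 - mulIω P ∘L
    (H1.toL2.comp (WithLp.fstL 2 ℝ H1 L2))

/-- The operator `L_β'' : 𝓗 → 𝓗*`,
`L_β''(u, v) = (-u'' + m² u - φ_β^{p-1} u - (p-1) φ_β^{p-1} Re u + βδu + iωv, v - iωu)`,
as the bilinear form `(U, W) ↦ ⟨L_β'' U, W⟩` on `𝓗`. -/
def hessian : EnergySpace →L⋆[ℝ] EnergySpace →L[ℝ] ℝ :=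
  (innerSL ℝ).bilinearComp (H1.deriv.comp (WithLp.fstL 2 ℝ H1 L2))
      (H1.deriv.comp (WithLp.fstL 2 ℝ H1 L2))
  + (innerSL ℝ).bilinearComp (lowerOrder P) (H1.toL2.comp (WithLp.fstL 2 ℝ H1 L2))
  + P.β • (innerSL ℝ).bilinearComp (H1.evalZero.comp (WithLp.fstL 2 ℝ H1 L2))
      (H1.evalZero.comp (WithLp.fstL 2 ℝ H1 L2))
  + (innerSL ℝ).bilinearComp (secondComponent P) (WithLp.sndL 2 ℝ H1 L2)

/-- `⟨L_β''(u, v), (w, z)⟩ = ⟨u', w'⟩ + ⟨m² u - φ_β^{p-1} u - (p-1) φ_β^{p-1} Re u + iωv, w⟩ +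
β Re(u(0) conj w(0)) + ⟨v - iωu, z⟩`, with the real inner product of `L²`. -/
theorem hessian_apply (U W : EnergySpace) :
    hessian P U W = inner ℝ (H1.deriv U.fst) (H1.deriv W.fst)
      + inner ℝ (((P.m ^ 2 : ℝ) : ℂ) • H1.toL2 U.fst - mulPotential P (H1.toL2 U.fst)
          - ((P.p - 1 : ℝ) : ℂ) • mulPotential P (reL2 (H1.toL2 U.fst))
          + (Complex.I * P.ω) • U.snd) (H1.toL2 W.fst)
      + P.β * (H1.rep U.fst 0 * (starRingEnd ℂ) (H1.rep W.fst 0)).re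
      + inner ℝ (U.snd - (Complex.I * P.ω) • H1.toL2 U.fst) W.snd := by
  have h : inner ℝ (H1.evalZero U.fst) (H1.evalZero W.fst)
      = (H1.rep U.fst 0 * (starRingEnd ℂ) (H1.rep W.fst 0)).re := by
    rw [real_inner_comm]
    exact Complex.inner _ _
  rw [← h]
  rfl

/-- The bounded operator `L̃_β'' = R̃⁻¹ L_β''` on `𝓗`, where `R̃ : 𝓗 → 𝓗*` is the Riesz isomorphism,
that is, `⟨L̃_β'' U, W⟩_𝓗 = ⟨L_β'' U, W⟩`. -/
def hessianOp : EnergySpace →L[ℝ] EnergySpace :=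
  InnerProductSpace.continuousLinearMapOfBilin (hessian P)

theorem inner_hessianOp (U W : EnergySpace) : inner ℝ (hessianOp P U) W = hessian P U W :=
  InnerProductSpace.continuousLinearMapOfBilin_apply _ _ _

/-- `L̃_β''` as an (everywhere defined) operator. -/
def hessianPMap : EnergySpace →ₗ.[ℝ] EnergySpace :=
  LinearMap.toPMap (hessianOp P : EnergySpace →ₗ[ℝ] EnergySpace) ⊤

/-- `Λ(λ) = λ + λ ω² / (1 - λ)`, for `λ ≠ 1`. -/
def bigLambda (t : ℝ) : ℝ := t + t * P.ω ^ 2 / (1 - t)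

end DeltaKG

end

/-! Reduction to scalar operators. In (𝓛_β - λ)(u, v) = (f, g) the second row reads (1 - λ)v - iωu =
g. For λ ≠ 1 it determines v, and substitution into the first row leaves (N - Λ(λ))u = f - iω(1 -
λ)⁻¹g, because λ - ω² + ω²/(1 - λ) = Λ(λ). Here N is the ℝ-linear operator `reducedD`. Since β and
the potential are real, D_β is stable under real and imaginary parts, and N(a + ib) = L_β^+ a + i
L_β^- b for real a, b (`reducedD_eq`). Thus N - Λ(λ) is invertible iff both L_β^± - Λ(λ) are, and
ker(N - Λ(λ)) is a real form of the two complex kernels together. This gives (i) and (ii).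

Essential spectrum. Λ' = 1 + ω²/(1 - λ)² > 0, so Λ is a local homeomorphism and accumulation points
of the spectra correspond. Isolated spectral points of L_β^± are eigenvalues: apply the continuous
functional calculus to a real resolvent (`IsResolvent.opKer_ne_bot_of_not_accPt`). Hence "essential"
means "accumulation point or infinite multiplicity" for all three operators, and (iii) follows from
(i) and (ii).

Selfadjointness. The form ‖u'‖² + β|u(0)|² on H¹ is bounded below by the trace inequality.
Lax–Milgram solves the weak equation, and `mem_deltaDomain_of_form` shows that weak solutions lie in
D_β, the jump condition being the natural boundary condition. So L_β^± are symmetric and L_β^± + k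
is onto for some real k.

Counting. 𝓛_β and L̃_β'' represent one and the same quadratic form, relative to the inner products
of L² × L² and of 𝓗. Both counts of negative eigenvalues are the index of that form, and by the
inertia argument `NegEigenFamily.IsMaximal.card_eq` the index does not depend on the inner product.
The index is finite, and attained by eigenvectors, because the form is coercive up to a multiple of
the L² norm and nonnegative on a closed subspace of finite codimension: make u vanish at 0 and on a
fine mesh of an interval outside which the potential is small. As Λ is a bijection of (-∞, 0), (ii)
turns the count for 𝓛_β into n(L_β^+) + n(L_β^-). -/

noncomputable section

namespace DeltaKG

section
-- Resolvents of unbounded operators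
section Resolvent

variable {𝕜 E : Type*} [RCLike 𝕜] [NormedAddCommGroup E]

/-- `R` is the (bounded) inverse of `A - z`. -/
def IsResolvent [NormedSpace 𝕜 E] (A : E →ₗ.[𝕜] E) (z : 𝕜) (R : E →L[𝕜] E) : Prop :=
  (∀ u : A.domain, R (A u - z • (u : E)) = u) ∧
    (∀ f : E, ∃ h : R f ∈ A.domain, A ⟨R f, h⟩ - z • R f = f)

variable [NormedSpace 𝕜 E] {A : E →ₗ.[𝕜] E} {z w : 𝕜} {R R' : E →L[𝕜] E}

theorem IsResolvent.mem (h : IsResolvent A z R) : z ∈ opResolventSet A := ⟨R, h⟩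

theorem IsResolvent.apply_sub (h : IsResolvent A z R) (w : 𝕜) (u : A.domain) :
    R (A u - w • (u : E)) = u - (w - z) • R u := by
  have := h.1 u
  have e : A u - w • (u : E) = (A u - z • (u : E)) - (w - z) • (u : E) := by module
  rw [e, map_sub, this, map_smul]

theorem IsResolvent.sub_apply (h : IsResolvent A z R) (w : 𝕜) (f : E) :
    ∃ hf : R f ∈ A.domain, A ⟨R f, hf⟩ - w • R f = f - (w - z) • R f := by
  obtain ⟨hf, e⟩ := h.2 f
  refine ⟨hf, ?_⟩
  have e' : A ⟨R f, hf⟩ = f + z • R f := sub_eq_iff_eq_add.1 e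
  rw [e']
  module

/-- The first resolvent identity, obtained by applying R to (A - w)R'f = f. -/
theorem IsResolvent.comp_eq (h : IsResolvent A z R) (h' : IsResolvent A w R') (f : E) :
    R f = R' f - (w - z) • R (R' f) := by
  obtain ⟨hf, e⟩ := h'.2 f
  have := h.apply_sub w ⟨R' f, hf⟩
  rwa [e] at this

/-- Formally A - w = (w - z)((w - z)⁻¹ - R)(A - z). The spectrum of A away from z is thereby the
image of that of a bounded operator, for which spectral theory is at hand. -/
theorem IsResolvent.mem_resolventSet_iff (h : IsResolvent A z R) (hwz : w ≠ z) :
    w ∈ opResolventSet A ↔ (w - z)⁻¹ ∈ resolventSet 𝕜 R := by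
  have hd : w - z ≠ 0 := sub_ne_zero.2 hwz
  rw [spectrum.mem_resolventSet_iff]
  constructor
  · rintro ⟨R', h'⟩
    change IsResolvent A w R' at h'
    have e1 : (algebraMap 𝕜 (E →L[𝕜] E) (w - z)⁻¹ - R) * ((w - z) • (1 + (w - z) • R')) = 1 := by
      ext f
      have := h.comp_eq h' f
      simp only [mul_apply_eq_comp, _root_.sub_apply,
        Algebra.algebraMap_eq_smul_one, smul_apply,
        one_apply_eq_self, add_apply, map_smul, map_add, smul_add,
        smul_sub]
      rw [smul_inv_smul₀ hd, smul_inv_smul₀ hd, this]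
      module
    have e2 : ((w - z) • (1 + (w - z) • R')) * (algebraMap 𝕜 (E →L[𝕜] E) (w - z)⁻¹ - R) = 1 := by
      ext f
      have := h'.comp_eq h f
      simp only [mul_apply_eq_comp, _root_.sub_apply,
        Algebra.algebraMap_eq_smul_one, smul_apply,
        one_apply_eq_self, add_apply, map_smul, map_sub, smul_add]
      rw [inv_smul_smul₀ hd, inv_smul_smul₀ hd, this]
      module
    exact ⟨⟨_, _, e1, e2⟩, rfl⟩
  · rintro ⟨⟨S, T, hST, hTS⟩, rfl : S = _⟩
    have e1 : ∀ f, (w - z)⁻¹ • T f - R (T f) = f := fun f => by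
      have := congrArg (fun L : E →L[𝕜] E => L f) hST
      simpa [Algebra.algebraMap_eq_smul_one] using this
    have e2 : ∀ f, (w - z)⁻¹ • T f - T (R f) = f := fun f => by
      have := congrArg (fun L : E →L[𝕜] E => L f) hTS
      simpa [Algebra.algebraMap_eq_smul_one] using this
    -- An operator commutes with its own inverse, hence T commutes with R; this puts the candidate
    -- resolvent (w - z)⁻¹RT on either side.
    have e3 : ∀ f, T (R f) = R (T f) := fun f => by
      have := (e2 f).trans (e1 f).symm
      exact sub_right_injective this
    refine ⟨(w - z)⁻¹ • (R * T), fun u => ?_, fun f => ?_⟩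
    · have := h.apply_sub w u
      simp only [smul_apply, mul_apply_eq_comp]
      rw [← e3, this, map_sub, map_smul, smul_sub, inv_smul_smul₀ hd]
      exact e2 u
    · have hf := h.sub_apply w ((w - z)⁻¹ • T f)
      simp only [smul_apply, mul_apply_eq_comp]
      simp only [map_smul] at hf
      obtain ⟨hf, e⟩ := hf
      refine ⟨hf, ?_⟩
      rw [e, smul_inv_smul₀ hd]
      exact e1 f

theorem isOpen_opResolventSet [CompleteSpace E] (A : E →ₗ.[𝕜] E) : IsOpen (opResolventSet A) := by
  rw [isOpen_iff_mem_nhds]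
  rintro z ⟨R, h⟩
  change IsResolvent A z R at h
  -- The norm criterion for the resolvent set of R is used with ‖1‖ = 1, which fails on the zero
  -- space; there every point is in the resolvent set.
  rcases subsingleton_or_nontrivial E with hE | hE
  · refine Filter.univ_mem' fun w => ⟨0, fun u => Subsingleton.elim _ _, fun f => ⟨?_, Subsingleton.elim _ _⟩⟩
    exact A.domain.zero_mem
  have : Metric.ball z (1 / (‖R‖ + 1)) ∈ 𝓝 z := Metric.ball_mem_nhds _ (by positivity)
  filter_upwards [this] with w hw
  by_cases hwz : w = z
  · exact hwz ▸ h.mem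
  rw [h.mem_resolventSet_iff hwz]
  refine spectrum.mem_resolventSet_of_norm_lt ?_
  rw [Metric.mem_ball, dist_eq_norm, lt_div_iff₀ (by positivity)] at hw
  have hp : 0 < ‖w - z‖ := norm_pos_iff.2 (sub_ne_zero.2 hwz)
  rw [norm_inv, ← one_div, lt_div_iff₀ hp]
  nlinarith

theorem mem_opSpectrum_of_accPt [CompleteSpace E] (h : AccPt z (𝓟 (opSpectrum A))) :
    z ∈ opSpectrum A := by
  have : IsClosed (opSpectrum A) := (isOpen_opResolventSet A).isClosed_compl
  exact isClosed_iff_clusterPt.1 this z h.clusterPt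

theorem mem_opSpectrum_of_opKer_ne_bot (h : opKer A z ≠ ⊥) : z ∈ opSpectrum A := by
  rintro ⟨R, h1, -⟩
  refine h (eq_bot_iff.2 fun u hu => ?_)
  have hu' : A u - z • (u : E) = 0 := hu
  have := h1 u
  rw [hu', map_zero] at this
  exact Subtype.ext this.symm

theorem mem_opKer {u : A.domain} : u ∈ opKer A z ↔ A u = z • (u : E) := by
  change A u - z • (u : E) = 0 ↔ _
  rw [sub_eq_zero]

end Resolvent

/-! ### Selfadjointness and isolated points of the spectrum -/

section SelfAdjoint

variable {E : Type*} [NormedAddCommGroup E] [InnerProductSpace ℂ E] [CompleteSpace E]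
  {A : E →ₗ.[ℂ] E} {c : ℝ} {R : E →L[ℂ] E}

/-- A symmetric operator `A` such that `A - c` is onto for some real `c` is selfadjoint. -/
theorem isSelfAdjoint_of_symmetric_of_surjective
    (hs : ∀ u v : A.domain, inner ℂ (A u) (v : E) = inner ℂ (u : E) (A v))
    (hsur : ∀ f : E, ∃ u : A.domain, A u - (c : ℂ) • (u : E) = f) : IsSelfAdjoint A := by
  have hs' : ∀ u v : A.domain, inner ℂ (A u - (c : ℂ) • (u : E)) (v : E)
      = inner ℂ (u : E) (A v - (c : ℂ) • (v : E)) := fun u v => by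
    rw [inner_sub_left, inner_sub_right, hs, inner_smul_left, inner_smul_right,
      Complex.conj_ofReal]
  -- A vector orthogonal to the range of A - c vanishes, since the range is everything.
  have key : ∀ y : E, (∀ u : A.domain, inner ℂ y (A u - (c : ℂ) • (u : E)) = 0) → y = 0 := by
    intro y hy
    obtain ⟨u, hu⟩ := hsur y
    have := hy u
    rwa [hu, inner_self_eq_zero] at this
  have hdense : Dense (A.domain : Set E) := by
    rw [Submodule.dense_iff_topologicalClosure_eq_top,
      Submodule.topologicalClosure_eq_top_iff, Submodule.eq_bot_iff]
    -- Write f = (A - c)x. If f is orthogonal to the domain, then by symmetry x is orthogonal to the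
    -- range of A - c, so x = 0 and f = 0.
    intro f hf
    obtain ⟨x, hx⟩ := hsur f
    have : (x : E) = 0 := key x fun u => by
      rw [← hs', hx]
      exact Submodule.inner_left_of_mem_orthogonal u.2 hf
    have hx0 : x = 0 := Subtype.ext this
    rw [← hx, hx0]; simp
  rw [LinearPMap.isSelfAdjoint_def]
  have hle : A ≤ A.adjoint := LinearPMap.IsFormalAdjoint.le_adjoint hdense hs
  refine (LinearPMap.eq_of_le_of_domain_eq hle (le_antisymm hle.1 fun y hy => ?_)).symm
  -- Solve (A - c)x = (A* - c)y inside the domain of A. Then y - x is orthogonal to the range of A -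
  -- c, so y = x.
  obtain ⟨x, hx⟩ := hsur (A.adjoint ⟨y, hy⟩ - (c : ℂ) • y)
  have : y - x = 0 := key _ fun u => by
    have h1 := A.adjoint_isFormalAdjoint hdense ⟨y, hy⟩ u
    rw [inner_sub_left, ← hs', hx, inner_sub_left, h1, inner_sub_right, inner_smul_left,
      inner_smul_right, Complex.conj_ofReal]
    simp
  rw [sub_eq_zero.1 this]
  exact x.2

theorem IsResolvent.isSelfAdjoint (h : IsResolvent A (c : ℂ) R)
    (hs : ∀ u v : A.domain, inner ℂ (A u) (v : E) = inner ℂ (u : E) (A v)) :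
    IsSelfAdjoint R := by
  rw [ContinuousLinearMap.isSelfAdjoint_iff_isSymmetric]
  intro f g
  obtain ⟨hf, ef⟩ := h.2 f
  obtain ⟨hg, eg⟩ := h.2 g
  have := hs ⟨R f, hf⟩ ⟨R g, hg⟩
  change inner ℂ (R f) g = inner ℂ f (R g)
  have e1 : inner ℂ (R f) g = inner ℂ (R f) (A ⟨R g, hg⟩ - (c : ℂ) • R g) := by rw [eg]
  have e2 : inner ℂ f (R g) = inner ℂ (A ⟨R f, hf⟩ - (c : ℂ) • R f) (R g) := by rw [ef]
  rw [e1, e2, inner_sub_left, inner_sub_right, inner_smul_left, inner_smul_right,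
      Complex.conj_ofReal, this]

/-- The map z ↦ (z - c)⁻¹ carries the spectrum into that of the bounded selfadjoint R, which is
real, and c is real. -/
theorem IsResolvent.im_eq_zero_of_mem_opSpectrum (h : IsResolvent A (c : ℂ) R)
    (hR : IsSelfAdjoint R) {z : ℂ} (hz : z ∈ opSpectrum A) : z.im = 0 := by
  have hzc : z ≠ c := fun e => hz (e ▸ h.mem)
  have h1 : (z - c)⁻¹ ∈ spectrum ℂ R := fun h' => hz ((h.mem_resolventSet_iff hzc).2 h')
  have h2 := hR.im_eq_zero_of_mem_spectrum h1
  rw [Complex.inv_im, div_eq_zero_iff, Complex.normSq_eq_zero, sub_eq_zero] at h2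
  rcases h2 with h2 | h2
  · simpa using h2
  · exact absurd h2 hzc

/-- Isolated points of the spectrum of a selfadjoint operator are eigenvalues. -/
theorem IsResolvent.opKer_ne_bot_of_not_accPt (h : IsResolvent A (c : ℂ) R)
    (hR : IsSelfAdjoint R) {z : ℂ} (hz : z ∈ opSpectrum A)
    (hacc : ¬ AccPt z (𝓟 (opSpectrum A))) : opKer A z ≠ ⊥ := by
  have hzc : z ≠ c := fun e => hz (e ▸ h.mem)
  obtain ⟨x, rfl⟩ : ∃ x : ℝ, z = x :=
    ⟨z.re, Complex.ext rfl (h.im_eq_zero_of_mem_opSpectrum hR hz)⟩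
  have hxc : x - c ≠ 0 := fun e => hzc (by rw [sub_eq_zero.1 e])
  -- Dictionary between the nonzero real spectrum of R and the spectrum of A: y corresponds to c +
  -- 1/y.
  have hspec : ∀ y : ℝ, y ≠ 0 → (y ∈ spectrum ℝ R ↔ ((c + y⁻¹ : ℝ) : ℂ) ∈ opSpectrum A) := by
    intro y hy
    have hne : ((c + y⁻¹ : ℝ) : ℂ) ≠ c := by
      intro e
      have : c + y⁻¹ = c := by exact_mod_cast e
      exact inv_ne_zero hy (by linarith)
    have e := h.mem_resolventSet_iff hne
    have e2 : (((c + y⁻¹ : ℝ) : ℂ) - c)⁻¹ = y := by push_cast; simp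
    rw [e2] at e
    rw [← spectrum.preimage_algebraMap ℂ]
    exact (not_congr e).symm
  set μ : ℝ := (x - c)⁻¹ with hμ
  have hμ0 : μ ≠ 0 := inv_ne_zero hxc
  have hcx : c + μ⁻¹ = x := by rw [hμ, inv_inv]; ring
  have hμs : μ ∈ spectrum ℝ R := (hspec μ hμ0).2 (by rwa [hcx])
  have hiso : ∀ᶠ y in 𝓝[≠] μ, y ∉ spectrum ℝ R := by
    have h1 : ∀ᶠ w in 𝓝[≠] (x : ℂ), w ∉ opSpectrum A := by
      rwa [accPt_iff_frequently_nhdsNE, not_frequently] at hacc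
    have hcont : Tendsto (fun y : ℝ => ((c + y⁻¹ : ℝ) : ℂ)) (𝓝 μ) (𝓝 (x : ℂ)) := by
      have : ContinuousAt (fun y : ℝ => ((c + y⁻¹ : ℝ) : ℂ)) μ := by
        refine Complex.continuous_ofReal.continuousAt.comp ?_
        exact continuousAt_const.add (continuousAt_inv₀ hμ0)
      simpa only [ContinuousAt, hcx] using this
    have ht : Tendsto (fun y : ℝ => ((c + y⁻¹ : ℝ) : ℂ)) (𝓝[≠] μ) (𝓝[≠] (x : ℂ)) := by
      refine tendsto_nhdsWithin_iff.2 ⟨hcont.mono_left nhdsWithin_le_nhds, ?_⟩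
      filter_upwards [self_mem_nhdsWithin] with y hy e
      have e' : c + y⁻¹ = c + μ⁻¹ := by
        rw [hcx]; exact Complex.ofReal_injective e
      exact hy (inv_injective (add_left_cancel e'))
    filter_upwards [ht.eventually h1, nhdsWithin_le_nhds (eventually_ne_nhds hμ0)] with y h2 h3 h4
    exact h2 ((hspec y h3).1 h4)
  -- The indicator of {μ} is continuous on the spectrum because μ is isolated there, so `cfc f R` is
  -- the spectral projection onto the eigenspace of μ.
  set f : ℝ → ℝ := fun y => if y = μ then 1 else 0 with hf
  have hfc : ContinuousOn f (spectrum ℝ R) := by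
    intro y hy
    by_cases hyμ : y = μ
    · rw [hyμ]
      refine ContinuousWithinAt.congr_of_eventuallyEq (f := fun _ => 1) continuousWithinAt_const ?_
        (by simp [hf])
      rw [eventually_nhdsWithin_iff] at hiso
      filter_upwards [nhdsWithin_le_nhds hiso, self_mem_nhdsWithin] with w h1 h2
      have : w = μ := by by_contra h3; exact h1 h3 h2
      simp [hf, this]
    · refine ContinuousAt.continuousWithinAt (ContinuousAt.congr (f := fun _ => (0:ℝ)) continuousAt_const ?_)
      filter_upwards [eventually_ne_nhds hyμ] with w hw
      simp [hf, hw]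
  -- By spectral mapping 1 = f(μ) lies in the spectrum of `cfc f R`, so this operator is not zero.
  have hP : cfc f R ≠ 0 := by
    intro h0
    have := cfc_map_spectrum (R := ℝ) f R hR hfc
    rw [h0] at this
    have h1 : (1 : ℝ) ∈ f '' spectrum ℝ R := ⟨μ, hμs, by simp [hf]⟩
    rw [← this] at h1
    have : IsUnit (algebraMap ℝ (E →L[ℂ] E) 1 - 0) := by simp
    exact h1 this
  -- On functions y·f(y) = μ·f(y), so every vector in the range of the projection is an eigenvector
  -- of R.
  have hmul : R * cfc f R = (μ : ℂ) • cfc f R := by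
    have e1 : cfc (fun y : ℝ => y * f y) R = R * cfc f R := by
      rw [cfc_mul (fun y : ℝ => y) f R continuousOn_id hfc, cfc_id' ℝ R]
    have e2 : cfc (fun y : ℝ => μ * f y) R = μ • cfc f R := by
      rw [← cfc_smul μ f R hfc]; rfl
    have e3 : (fun y : ℝ => y * f y) = fun y => μ * f y := by
      funext y
      by_cases hy : y = μ <;> simp [hf, hy]
    rw [← e1, e3, e2]
    ext f
    simp
  obtain ⟨g, hg⟩ : ∃ g, cfc f R g ≠ 0 := by
    by_contra! h0
    exact hP (ContinuousLinearMap.ext h0)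
  set v := cfc f R g with hv
  have hRv : R v = (μ : ℂ) • v := congrArg (fun L : E →L[ℂ] E => L g) hmul
  obtain ⟨h1, h2⟩ := h.2 v
  -- Since μ ≠ 0, the eigenvector is a multiple of R v and therefore lies in the domain.
  have hvd : v ∈ A.domain := by
    have : v = (μ : ℂ)⁻¹ • R v := by
      rw [hRv, inv_smul_smul₀ (by exact_mod_cast hμ0)]
    rw [this]
    exact A.domain.smul_mem _ h1
  intro hbot
  have hmem : (⟨v, hvd⟩ : A.domain) ∈ opKer A (x : ℂ) := by
    rw [mem_opKer]
    have e : (⟨R v, h1⟩ : A.domain) = (μ : ℂ) • ⟨v, hvd⟩ := Subtype.ext hRv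
    rw [e, LinearPMap.map_smul, hRv] at h2
    have hμc : (μ : ℂ) ≠ 0 := by exact_mod_cast hμ0
    have h3 : A ⟨v, hvd⟩ = (μ : ℂ)⁻¹ • v + (c : ℂ) • v := by
      have : (μ : ℂ) • (A ⟨v, hvd⟩ - (c : ℂ) • v) = v := by
        rw [smul_sub, smul_comm (μ : ℂ) (c : ℂ)]; exact h2
      rw [← sub_eq_iff_eq_add, eq_inv_smul_iff₀ hμc]
      exact this
    rw [h3, ← hcx]
    push_cast
    module
  rw [hbot, Submodule.mem_bot] at hmem
  exact hg (congrArg Subtype.val hmem)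

end SelfAdjoint

end

section
-- Negative eigenvalues of a pencil B - tK and their index
section Pencil

variable {H : Type*} [NormedAddCommGroup H] [InnerProductSpace ℝ H]

/-- Evaluate the nonnegative form at x - sTx with s = (‖T‖ + 1)⁻¹; the summand 1 avoids dividing by
zero. This turns minimising sequences of the form into approximate kernel vectors. -/
theorem norm_sq_apply_le_of_nonneg {T : H →L[ℝ] H}
    (hT : ∀ x y, inner ℝ (T x) y = inner ℝ x (T y)) (hpos : ∀ x, 0 ≤ inner ℝ (T x) x) (x : H) :
    ‖T x‖ ^ 2 ≤ (‖T‖ + 1) * inner ℝ (T x) x := by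
  set s : ℝ := (‖T‖ + 1)⁻¹ with hs
  have hT1 : 0 < ‖T‖ + 1 := by positivity
  have hs0 : 0 < s := inv_pos.2 hT1
  have h1 := hpos (x - s • T x)
  have h2 : inner ℝ (T (T x)) (T x) ≤ ‖T‖ * ‖T x‖ ^ 2 := by
    refine (real_inner_le_norm _ _).trans ?_
    have := T.le_opNorm (T x)
    nlinarith [norm_nonneg (T x)]
  rw [map_sub, map_smul, inner_sub_left, inner_sub_right, inner_sub_right, inner_smul_left,
    inner_smul_left, inner_smul_right, inner_smul_right, hT (T x) x, real_inner_self_eq_norm_sq]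
    at h1
  simp only [conj_trivial] at h1
  have h3 : s * (‖T‖ + 1) = 1 := inv_mul_cancel₀ hT1.ne'
  have h4 : s * ‖T x‖ ^ 2 ≤ inner ℝ (T x) x := by
    have : s * (s * inner ℝ (T (T x)) (T x)) ≤ s * (s * (‖T‖ * ‖T x‖ ^ 2)) := by gcongr
    have h5 : s * (s * (‖T‖ * ‖T x‖ ^ 2)) ≤ s * ‖T x‖ ^ 2 := by
      have : s * ‖T‖ ≤ 1 := by nlinarith
      calc s * (s * (‖T‖ * ‖T x‖ ^ 2)) = (s * ‖T‖) * (s * ‖T x‖ ^ 2) := by ring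
        _ ≤ 1 * (s * ‖T x‖ ^ 2) := by gcongr
        _ = _ := one_mul _
    linarith
  calc ‖T x‖ ^ 2 = (‖T‖ + 1) * (s * ‖T x‖ ^ 2) := by rw [← mul_assoc, mul_comm _ s, h3, one_mul]
    _ ≤ _ := by gcongr

/-- A nonnegative symmetric operator `T` which is coercive on the complement of a finite dimensional
space and which has `0` in its approximate point spectrum has a nontrivial kernel. -/
theorem exists_unit_ker_of_approx [CompleteSpace H] {T : H →L[ℝ] H}
    {G : Submodule ℝ H} [FiniteDimensional ℝ G] {δ : ℝ} (hδ : 0 < δ)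
    (hG : ∀ x ∈ Gᗮ, δ * ‖x‖ ^ 2 ≤ inner ℝ (T x) x)
    {x : ℕ → H} (hx : ∀ n, ‖x n‖ = 1) (hTx : Tendsto (fun n => T (x n)) atTop (𝓝 0)) :
    ∃ y, ‖y‖ = 1 ∧ T y = 0 := by
  -- The components in G are bounded in a finite dimensional space, so a subsequence of them
  -- converges; coercivity handles the rest.
  set g : ℕ → G := fun n => G.orthogonalProjectionOnto (x n) with hg
  have hgb : ∀ n, g n ∈ Metric.closedBall (0 : G) 1 := fun n => by
    rw [mem_closedBall_zero_iff, ← hx n]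
    exact G.norm_orthogonalProjectionOnto_apply_le (x n)
  obtain ⟨g₀, -, φ, hφ, hlim⟩ := (isCompact_closedBall (0 : G) 1).tendsto_subseq hgb
  set w : ℕ → H := fun n => x (φ n) - g (φ n) with hw
  have hwG : ∀ n, w n ∈ Gᗮ := fun n => G.sub_starProjection_mem_orthogonal _
  have hTw : Tendsto (fun n => T (w n)) atTop (𝓝 (0 - T g₀)) := by
    simp only [hw, map_sub]
    refine (hTx.comp hφ.tendsto_atTop).sub ?_
    exact (T.continuous.tendsto _).comp ((continuous_subtype_val.tendsto g₀).comp hlim)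
  have hbound : ∀ v ∈ Gᗮ, δ * ‖v‖ ≤ ‖T v‖ := fun v hv => by
    have h1 := (hG v hv).trans (real_inner_le_norm _ _)
    rcases (norm_nonneg v).eq_or_lt with h0 | h0
    · rw [← h0]; simp
    · refine le_of_mul_le_mul_right ?_ h0
      linarith [sq ‖v‖, mul_assoc δ ‖v‖ ‖v‖]
  -- T(wₙ) converges and T is bounded below on the complement of G, which forces wₙ itself to be
  -- Cauchy.
  have hcw : CauchySeq w := by
    have hc := hTw.cauchySeq
    rw [Metric.cauchySeq_iff] at hc ⊢
    intro ε hε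
    obtain ⟨N, hN⟩ := hc (δ * ε) (by positivity)
    refine ⟨N, fun m hm n hn => ?_⟩
    have h1 := hN m hm n hn
    rw [dist_eq_norm, ← map_sub] at h1
    have h2 := hbound _ (Gᗮ.sub_mem (hwG m) (hwG n))
    rw [dist_eq_norm]
    exact lt_of_mul_lt_mul_left (h2.trans_lt h1) hδ.le
  obtain ⟨w₀, hw₀⟩ := cauchySeq_tendsto_of_complete hcw
  have hxlim : Tendsto (fun n => x (φ n)) atTop (𝓝 (w₀ + g₀)) := by
    have := hw₀.add ((continuous_subtype_val.tendsto g₀).comp hlim)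
    refine this.congr fun n => ?_
    simp [hw]
  refine ⟨w₀ + g₀, ?_, ?_⟩
  · refine tendsto_nhds_unique hxlim.norm ?_
    simp only [hx]; exact tendsto_const_nhds
  · exact tendsto_nhds_unique ((T.continuous.tendsto _).comp hxlim) (hTx.comp hφ.tendsto_atTop)

/-- If the form of `B` is bounded below relative to `K`, is nonnegative on the complement of a finite
dimensional space, and takes a negative value, then `B - t K` has a kernel for some `t < 0`. -/
theorem exists_neg_generalized_eigenvector [CompleteSpace H] {B K : H →L[ℝ] H}
    (hB : ∀ x y, inner ℝ (B x) y = inner ℝ x (B y)) (hK : ∀ x y, inner ℝ (K x) y = inner ℝ x (K y))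
    (hKpos : ∀ x, x ≠ 0 → 0 < inner ℝ (K x) x) {c δ : ℝ} (hδ : 0 < δ)
    (hc : ∀ x, δ * ‖x‖ ^ 2 ≤ inner ℝ (B x) x + c * inner ℝ (K x) x)
    {G : Submodule ℝ H} [FiniteDimensional ℝ G] (hG : ∀ x ∈ Gᗮ, 0 ≤ inner ℝ (B x) x)
    {x₀ : H} (hx₀ : inner ℝ (B x₀) x₀ < 0) :
    ∃ t : ℝ, t < 0 ∧ ∃ y, y ≠ 0 ∧ B y = t • K y := by
  have hx₀0 : x₀ ≠ 0 := by rintro rfl; simp at hx₀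
  have hK0 : ∀ x, 0 ≤ inner ℝ (K x) x := fun x => by
    by_cases h : x = 0
    · simp [h]
    · exact (hKpos x h).le
  -- Rayleigh quotients of B relative to K. Their infimum m is finite by `hc` and negative by `hx₀`;
  -- it will be the eigenvalue, and T = B - mK is nonnegative.
  set Q : Set ℝ := (fun x => inner ℝ (B x) x / inner ℝ (K x) x) '' {x | x ≠ 0} with hQ
  have hQb : BddBelow Q := by
    refine ⟨-c, ?_⟩
    rintro _ ⟨x, hx, rfl⟩
    have := hc x
    simp only
    rw [le_div_iff₀ (hKpos x hx)]
    nlinarith [sq_nonneg ‖x‖, mul_nonneg hδ.le (sq_nonneg ‖x‖)]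
  have hQn : Q.Nonempty := ⟨_, x₀, hx₀0, rfl⟩
  set m := sInf Q with hm
  have hm0 : m < 0 :=
    (csInf_le hQb ⟨x₀, hx₀0, rfl⟩).trans_lt (div_neg_of_neg_of_pos hx₀ (hKpos _ hx₀0))
  have hmle : ∀ x, m * inner ℝ (K x) x ≤ inner ℝ (B x) x := fun x => by
    by_cases hx : x = 0
    · simp [hx]
    · rw [← le_div_iff₀ (hKpos x hx)]
      exact csInf_le hQb ⟨x, hx, rfl⟩
  set T : H →L[ℝ] H := B - m • K with hT
  have hTap : ∀ x, T x = B x - m • K x := fun x => rfl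
  have hTin : ∀ x, inner ℝ (T x) x = inner ℝ (B x) x - m * inner ℝ (K x) x := fun x => by
    rw [hTap, inner_sub_left, inner_smul_left]; rfl
  have hTs : ∀ x y, inner ℝ (T x) y = inner ℝ x (T y) := fun x y => by
    rw [hTap, hTap, inner_sub_left, inner_smul_left, inner_sub_right, inner_smul_right, hB, hK]; rfl
  have hTpos : ∀ x, 0 ≤ inner ℝ (T x) x := fun x => by
    rw [hTin]; linarith [hmle x]
  -- A minimising sequence, normalised in H rather than for ⟨K·, ·⟩, since K need not be bounded
  -- below.
  have hseq : ∀ n : ℕ, ∃ x : H, ‖x‖ = 1 ∧ inner ℝ (T x) x ≤ 1 / ((n : ℝ) + 1) * ‖K‖ := by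
    intro n
    have hn : (0 : ℝ) < 1 / ((n : ℝ) + 1) := by positivity
    obtain ⟨_, ⟨x, hx, rfl⟩, hlt⟩ := exists_lt_of_csInf_lt hQn (lt_add_of_pos_right m hn)
    have hx' : x ≠ 0 := hx
    rw [div_lt_iff₀ (hKpos x hx')] at hlt
    have hxn : 0 < ‖x‖ := norm_pos_iff.2 hx'
    have h1 : inner ℝ (T x) x ≤ 1 / ((n : ℝ) + 1) * (‖K‖ * ‖x‖ ^ 2) := by
      rw [hTin]
      have h2 : inner ℝ (K x) x ≤ ‖K‖ * ‖x‖ ^ 2 := by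
        refine (real_inner_le_norm _ _).trans ?_
        nlinarith [K.le_opNorm x]
      have := mul_le_mul_of_nonneg_left h2 hn.le
      linarith
    refine ⟨‖x‖⁻¹ • x, norm_smul_inv_norm (𝕜 := ℝ) hx', ?_⟩
    rw [map_smul, inner_smul_left, inner_smul_right, conj_trivial]
    calc ‖x‖⁻¹ * (‖x‖⁻¹ * inner ℝ (T x) x)
        ≤ ‖x‖⁻¹ * (‖x‖⁻¹ * (1 / ((n : ℝ) + 1) * (‖K‖ * ‖x‖ ^ 2))) := by gcongr
      _ = _ := by field_simp
  choose x hx1 hx2 using hseq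
  have hlim : Tendsto (fun n => T (x n)) atTop (𝓝 0) := by
    have h1 : Tendsto (fun n : ℕ => (‖T‖ + 1) * (1 / ((n : ℝ) + 1) * ‖K‖)) atTop (𝓝 0) := by
      have := (tendsto_one_div_add_atTop_nhds_zero_nat (𝕜 := ℝ)).mul_const ‖K‖ |>.const_mul (‖T‖ + 1)
      simpa using this
    have h2 : Tendsto (fun n => ‖T (x n)‖ ^ 2) atTop (𝓝 0) := by
      refine squeeze_zero (fun n => by positivity) (fun n => ?_) h1
      refine (norm_sq_apply_le_of_nonneg hTs hTpos _).trans ?_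
      exact mul_le_mul_of_nonneg_left (hx2 n) (by positivity)
    rw [tendsto_zero_iff_norm_tendsto_zero]
    have h3 := (Real.continuous_sqrt.tendsto 0).comp h2
    rw [Real.sqrt_zero] at h3
    exact h3.congr fun n => Real.sqrt_sq (norm_nonneg _)
  -- Coercivity of T off G comes from B - mK = (1 - θ)B + θ(B + dK) + (-m - θd)K. All three
  -- coefficients are nonnegative for this θ, B is nonnegative off G, and B + dK ≥ δ.
  set d : ℝ := |c| + 1 with hd
  have hdpos : 0 < d := by positivity
  have hcd : c ≤ d := (le_abs_self c).trans (by linarith)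
  set θ : ℝ := min 1 (-m / d) with hθ
  have hθ0 : 0 < θ := lt_min one_pos (div_pos (by linarith) hdpos)
  have hθ1 : θ ≤ 1 := min_le_left _ _
  have hθ2 : θ * d ≤ -m := by
    rw [← le_div_iff₀ hdpos]; exact min_le_right _ _
  obtain ⟨y, hy1, hy2⟩ := exists_unit_ker_of_approx (T := T) (G := G) (mul_pos hθ0 hδ) (by
    intro w hw
    rw [hTin]
    have h1 := hG w hw
    have h2 := hc w
    have h3 : θ * (δ * ‖w‖ ^ 2) ≤ θ * (inner ℝ (B w) w + d * inner ℝ (K w) w) :=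
      mul_le_mul_of_nonneg_left (h2.trans (by nlinarith [hK0 w])) hθ0.le
    nlinarith [hK0 w]) hx1 hlim
  refine ⟨m, hm0, y, ?_, sub_eq_zero.1 hy2⟩
  rintro rfl
  simp at hy1

/-- A family of generalized eigenvectors `B fᵢ = tᵢ K fᵢ`, `tᵢ < 0`, orthonormal for `⟨K ·, ·⟩`. -/
structure NegEigenFamily (B K : H →L[ℝ] H) (n : ℕ) where
  vec : Fin n → H
  val : Fin n → ℝ
  val_neg : ∀ i, val i < 0
  apply_vec : ∀ i, B (vec i) = val i • K (vec i)
  inner_vec : ∀ i j, inner ℝ (K (vec i)) (vec j) = if i = j then 1 else 0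

variable {B K K' : H →L[ℝ] H} {n n' : ℕ}

theorem NegEigenFamily.form_sum (F : NegEigenFamily B K n) (a : Fin n → ℝ) :
    inner ℝ (B (∑ i, a i • F.vec i)) (∑ i, a i • F.vec i) = ∑ i, F.val i * a i ^ 2 := by
  simp only [map_sum, map_smul, sum_inner, _root_.inner_sum, inner_smul_left, inner_smul_right,
    F.apply_vec, F.inner_vec, conj_trivial]
  refine Finset.sum_congr rfl fun i _ => ?_
  simp
  ring

/-- In the coordinates of the family the form is diagonal with negative entries, so it is negative
definite there. -/
theorem NegEigenFamily.eq_zero_of_form_nonneg (F : NegEigenFamily B K n) {a : Fin n → ℝ}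
    (h : 0 ≤ inner ℝ (B (∑ i, a i • F.vec i)) (∑ i, a i • F.vec i)) : a = 0 := by
  rw [F.form_sum] at h
  by_contra ha
  obtain ⟨j, hj⟩ := Function.ne_iff.1 ha
  refine absurd h (not_le.2 (Finset.sum_neg' (fun i _ => ?_) ⟨j, Finset.mem_univ j, ?_⟩))
  · exact mul_nonpos_of_nonpos_of_nonneg (F.val_neg i).le (sq_nonneg _)
  · exact mul_neg_of_neg_of_pos (F.val_neg j) (by have : a j ≠ 0 := hj; positivity)

/-- If `ker L` contains only vectors on which the form is nonnegative, its codimension bounds the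
number of negative generalized eigenvectors. -/
theorem NegEigenFamily.card_le {V : Type*} [AddCommGroup V] [Module ℝ V] [FiniteDimensional ℝ V]
    (F : NegEigenFamily B K n) (L : H →ₗ[ℝ] V)
    (hL : ∀ x, L x = 0 → 0 ≤ inner ℝ (B x) x) : n ≤ Module.finrank ℝ V := by
  -- The span of the family meets ker L only in 0, because the form has opposite signs on the two.
  set S : (Fin n → ℝ) →ₗ[ℝ] V := L ∘ₗ Fintype.linearCombination ℝ F.vec with hS
  have hinj : Function.Injective S := by
    rw [← LinearMap.ker_eq_bot, LinearMap.ker_eq_bot']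
    intro a ha
    exact F.eq_zero_of_form_nonneg (hL _ ha)
  simpa using LinearMap.finrank_le_finrank_of_injective hinj

/-- The map `x ↦ (⟨K x, fᵢ⟩)ᵢ`. -/
def NegEigenFamily.coord (F : NegEigenFamily B K n) : H →ₗ[ℝ] (Fin n → ℝ) :=
  LinearMap.pi fun i => (innerₗ H (F.vec i)) ∘ₗ (K : H →ₗ[ℝ] H)

theorem NegEigenFamily.coord_apply (F : NegEigenFamily B K n) (x : H) (i : Fin n) :
    F.coord x i = inner ℝ (K x) (F.vec i) := by
  simp [NegEigenFamily.coord, real_inner_comm]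

/-- `B` is nonnegative on the `K`-orthogonal complement of the family. -/
def NegEigenFamily.IsMaximal (F : NegEigenFamily B K n) : Prop :=
  ∀ x, F.coord x = 0 → 0 ≤ inner ℝ (B x) x

/-- Sylvester's law of inertia: each span is negative definite for B, and the kernel of the other
family's coordinates is nonnegative. The Gram operators K and K' may differ; only B is shared. -/
theorem NegEigenFamily.IsMaximal.card_eq {F : NegEigenFamily B K n} {F' : NegEigenFamily B K' n'}
    (h : F.IsMaximal) (h' : F'.IsMaximal) : n = n' :=
  le_antisymm (by simpa using F.card_le F'.coord h') (by simpa using F'.card_le F.coord h)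

/-- A family that is not maximal can be extended. -/
theorem NegEigenFamily.exists_succ [CompleteSpace H] (F : NegEigenFamily B K n)
    (hB : ∀ x y, inner ℝ (B x) y = inner ℝ x (B y)) (hK : ∀ x y, inner ℝ (K x) y = inner ℝ x (K y))
    (hKpos : ∀ x, x ≠ 0 → 0 < inner ℝ (K x) x) {c δ : ℝ} (hδ : 0 < δ)
    (hc : ∀ x, δ * ‖x‖ ^ 2 ≤ inner ℝ (B x) x + c * inner ℝ (K x) x)
    {G : Submodule ℝ H} [FiniteDimensional ℝ G] (hG : ∀ x ∈ Gᗮ, 0 ≤ inner ℝ (B x) x)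
    (hF : ¬ F.IsMaximal) : Nonempty (NegEigenFamily B K (n + 1)) := by
  unfold NegEigenFamily.IsMaximal at hF
  push Not at hF
  obtain ⟨x₀, hx₀, hneg⟩ := hF
  have hx₀' : ∀ i, inner ℝ (K x₀) (F.vec i) = 0 := fun i => by
    rw [← F.coord_apply, hx₀]; rfl
  -- Deflation: B' annihilates the vectors found so far and its form dominates that of B, so the
  -- lower bounds persist, while the value at x₀ is unchanged because x₀ is K-orthogonal to the
  -- family.
  set B' : H →L[ℝ] H := B - ∑ i, F.val i •
    (innerSL ℝ (K (F.vec i))).smulRight (K (F.vec i)) with hB'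
  have hB'ap : ∀ x, B' x = B x - ∑ i, (F.val i * inner ℝ (K x) (F.vec i)) • K (F.vec i) := by
    intro x
    simp only [hB', _root_.sub_apply, sum_apply, smul_apply, ContinuousLinearMap.smulRight_apply,
      innerSL_apply_apply, smul_smul]
    congr 1
    refine Finset.sum_congr rfl fun i _ => ?_
    rw [hK, real_inner_comm]
  have hB'in : ∀ x y, inner ℝ (B' x) y = inner ℝ (B x) y
      - ∑ i, F.val i * (inner ℝ (K x) (F.vec i) * inner ℝ (K y) (F.vec i)) := by
    intro x y
    rw [hB'ap, inner_sub_left, sum_inner]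
    congr 1
    refine Finset.sum_congr rfl fun i _ => ?_
    rw [inner_smul_left, hK (F.vec i) y, real_inner_comm (K y)]
    simp [mul_assoc]
  have hB's : ∀ x y, inner ℝ (B' x) y = inner ℝ x (B' y) := fun x y => by
    rw [← real_inner_comm x, hB'in, hB'in, hB, real_inner_comm]
    congr 1
    exact Finset.sum_congr rfl fun i _ => by ring
  have hle : ∀ x, inner ℝ (B x) x ≤ inner ℝ (B' x) x := fun x => by
    rw [hB'in]
    have : ∑ i, F.val i * (inner ℝ (K x) (F.vec i) * inner ℝ (K x) (F.vec i)) ≤ 0 :=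
      Finset.sum_nonpos fun i _ =>
        mul_nonpos_of_nonpos_of_nonneg (F.val_neg i).le (mul_self_nonneg _)
    linarith
  obtain ⟨t, ht, y, hy0, hy⟩ := exists_neg_generalized_eigenvector hB's hK hKpos hδ
    (c := c) (fun x => (hc x).trans (by linarith [hle x])) (fun x hx => (hG x hx).trans (hle x))
    (x₀ := x₀) (by rw [hB'in]; simpa [hx₀'] using hneg)
  -- B' y = tKy with t ≠ 0, and ⟨B' y, fⱼ⟩ = 0, so y is K-orthogonal to the family. The deflation is
  -- then invisible at y, which is an eigenvector of B itself.
  have hyF : ∀ j, inner ℝ (K y) (F.vec j) = 0 := fun j => by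
    have h1 : inner ℝ (B' y) (F.vec j) = 0 := by
      rw [hB'in]
      simp only [F.inner_vec, hB y, F.apply_vec, inner_smul_right, ← hK]
      simp
    rw [hy, inner_smul_left] at h1
    simpa [ht.ne] using h1
  have hBy : B y = t • K y := by
    rw [← hy, hB'ap]; simp [hyF]
  have hs : 0 < inner ℝ (K y) y := hKpos y hy0
  set s : ℝ := (√(inner ℝ (K y) y))⁻¹ with hsd
  have hss : s * (s * inner ℝ (K y) y) = 1 := by
    have h1 : √(inner ℝ (K y) y) ≠ 0 := (Real.sqrt_pos.2 hs).ne'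
    have h2 := Real.mul_self_sqrt hs.le
    rw [hsd, ← mul_assoc, ← mul_inv, h2, inv_mul_cancel₀ hs.ne']
  refine ⟨⟨Fin.snoc (α := fun _ => H) F.vec (s • y), Fin.snoc (α := fun _ => ℝ) F.val t, ?_, ?_, ?_⟩⟩
  · intro i
    refine Fin.lastCases ?_ (fun i => ?_) i
    · simpa using ht
    · simpa using F.val_neg i
  · intro i
    refine Fin.lastCases ?_ (fun i => ?_) i
    · simp [hBy, smul_comm s t]
    · simpa using F.apply_vec i
  · intro i j
    refine Fin.lastCases ?_ (fun i => ?_) i <;> refine Fin.lastCases ?_ (fun j => ?_) j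
    · simpa [inner_smul_left, inner_smul_right] using hss
    · simp [inner_smul_left, hyF, (Fin.castSucc_lt_last j).ne']
    · have : inner ℝ (K (F.vec i)) y = 0 := by rw [hK, real_inner_comm]; exact hyF i
      simp [inner_smul_right, this, (Fin.castSucc_lt_last i).ne]
    · simp [F.inner_vec]

/-- If no family were maximal, extension would produce one with dim G + 1 members; but projecting
its span to G is injective, since the form is nonnegative on the complement of G. -/
theorem exists_maximal_negEigenFamily [CompleteSpace H]
    (hB : ∀ x y, inner ℝ (B x) y = inner ℝ x (B y)) (hK : ∀ x y, inner ℝ (K x) y = inner ℝ x (K y))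
    (hKpos : ∀ x, x ≠ 0 → 0 < inner ℝ (K x) x) {c δ : ℝ} (hδ : 0 < δ)
    (hc : ∀ x, δ * ‖x‖ ^ 2 ≤ inner ℝ (B x) x + c * inner ℝ (K x) x)
    {G : Submodule ℝ H} [FiniteDimensional ℝ G] (hG : ∀ x ∈ Gᗮ, 0 ≤ inner ℝ (B x) x) :
    ∃ (n : ℕ) (F : NegEigenFamily B K n), F.IsMaximal := by
  by_contra! hcon
  have hall : ∀ n, Nonempty (NegEigenFamily B K n) := by
    intro n
    induction n with
    | zero => exact ⟨⟨Fin.elim0, Fin.elim0, fun i => i.elim0, fun i => i.elim0, fun i => i.elim0⟩⟩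
    | succ n ih =>
      obtain ⟨F⟩ := ih
      exact F.exists_succ hB hK hKpos hδ hc hG (hcon n F)
  obtain ⟨F⟩ := hall (Module.finrank ℝ G + 1)
  have := F.card_le (G.orthogonalProjectionOnto : H →ₗ[ℝ] G) fun x hx =>
    hG x ((Submodule.orthogonalProjectionOnto_eq_zero_iff).1 hx)
  omega

theorem NegEigenFamily.inner_apply_eq_zero (F : NegEigenFamily B K n)
    (hB : ∀ x y, inner ℝ (B x) y = inner ℝ x (B y)) (hK : ∀ x y, inner ℝ (K x) y = inner ℝ x (K y))
    {t : ℝ} {x : H} (hx : B x = t • K x) {i : Fin n} (hi : F.val i ≠ t) :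
    inner ℝ (K x) (F.vec i) = 0 := by
  have h := hB x (F.vec i)
  rw [hx, F.apply_vec, inner_smul_left, inner_smul_right, ← hK, conj_trivial] at h
  have h2 : (F.val i - t) * inner ℝ (K x) (F.vec i) = 0 := by linarith
  exact (mul_eq_zero.1 h2).resolve_left (sub_ne_zero.2 hi)

/-- The generalized eigenvectors of a maximal family with eigenvalue `t` form a basis of
`ker (B - t K)`. -/
theorem NegEigenFamily.IsMaximal.rank_ker {H : Type} [NormedAddCommGroup H]
    [InnerProductSpace ℝ H] {B K : H →L[ℝ] H} {F : NegEigenFamily B K n} (h : F.IsMaximal)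
    (hB : ∀ x y, inner ℝ (B x) y = inner ℝ x (B y)) (hK : ∀ x y, inner ℝ (K x) y = inner ℝ x (K y))
    (hKpos : ∀ x, x ≠ 0 → 0 < inner ℝ (K x) x) {t : ℝ} (ht : t < 0) :
    Module.rank ℝ (LinearMap.ker ((B - t • K : H →L[ℝ] H) : H →ₗ[ℝ] H))
      = Cardinal.mk {i // F.val i = t} := by
  set S : LinearMap.ker ((B - t • K : H →L[ℝ] H) : H →ₗ[ℝ] H) →ₗ[ℝ] ({i // F.val i = t} → ℝ) :=
    LinearMap.funLeft ℝ ℝ Subtype.val ∘ₗ F.coord ∘ₗ Submodule.subtype _ with hS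
  have hSap : ∀ u i, S u i = inner ℝ (K u) (F.vec i) := fun u i => F.coord_apply u i
  have hker : ∀ u : H, u ∈ LinearMap.ker ((B - t • K : H →L[ℝ] H) : H →ₗ[ℝ] H) ↔ B u = t • K u :=
    fun u => sub_eq_zero
  have hinj : Function.Injective S := by
    rw [← LinearMap.ker_eq_bot, LinearMap.ker_eq_bot']
    intro u hu
    have hu1 := (hker u).1 u.2
    -- Coordinates with eigenvalue other than t vanish by K-orthogonality, those with eigenvalue t
    -- by assumption. Maximality then makes the form nonnegative at u, although it equals t⟨Ku, u⟩.
    have h0 : F.coord u = 0 := by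
      funext i
      rw [F.coord_apply]
      by_cases hi : F.val i = t
      · rw [← hSap u ⟨i, hi⟩, hu]; rfl
      · exact F.inner_apply_eq_zero hB hK hu1 hi
    have h1 := h _ h0
    rw [hu1, inner_smul_left, conj_trivial] at h1
    by_contra hne
    have := hKpos u (fun e => hne (Subtype.ext e))
    nlinarith
  have hsurj : Function.Surjective S := by
    intro a
    have hm : (∑ i, a i • F.vec i) ∈ LinearMap.ker ((B - t • K : H →L[ℝ] H) : H →ₗ[ℝ] H) := by
      rw [hker]
      simp only [map_sum, map_smul, F.apply_vec, Finset.smul_sum]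
      refine Finset.sum_congr rfl fun i _ => ?_
      rw [i.2, smul_comm]
    refine ⟨⟨_, hm⟩, ?_⟩
    funext j
    rw [hSap]
    simp [sum_inner, inner_smul_left, F.inner_vec, Subtype.coe_inj]
  rw [(LinearEquiv.ofBijective S ⟨hinj, hsurj⟩).rank_eq, rank_fun']
  simp

/-- Each member of the family is counted exactly once, at t equal to its own eigenvalue. -/
theorem NegEigenFamily.IsMaximal.sum_rank_ker {H : Type} [NormedAddCommGroup H]
    [InnerProductSpace ℝ H] {B K : H →L[ℝ] H} {F : NegEigenFamily B K n} (h : F.IsMaximal)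
    (hB : ∀ x y, inner ℝ (B x) y = inner ℝ x (B y)) (hK : ∀ x y, inner ℝ (K x) y = inner ℝ x (K y))
    (hKpos : ∀ x, x ≠ 0 → 0 < inner ℝ (K x) x) :
    (Cardinal.sum fun t : Set.Iio (0 : ℝ) =>
      Module.rank ℝ (LinearMap.ker ((B - (t : ℝ) • K : H →L[ℝ] H) : H →ₗ[ℝ] H))) = n := by
  have e : (fun t : Set.Iio (0 : ℝ) =>
      Module.rank ℝ (LinearMap.ker ((B - (t : ℝ) • K : H →L[ℝ] H) : H →ₗ[ℝ] H)))
      = fun t : Set.Iio (0 : ℝ) => Cardinal.mk {i // F.val i = (t : ℝ)} :=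
    funext fun t => h.rank_ker hB hK hKpos t.2
  rw [e, ← Cardinal.mk_sigma, ← Cardinal.mk_fin n]
  refine Cardinal.mk_congr
    ⟨fun q => q.2, fun i => ⟨⟨F.val i, F.val_neg i⟩, i, rfl⟩, ?_, fun i => rfl⟩
  rintro ⟨⟨t, ht⟩, i, hi : F.val i = t⟩
  subst hi
  rfl

end Pencil

end

section
/-! ### Primitives of locally integrable functions -/

theorem LocallyIntegrable.intervalIntegrable_all {F : Type*} [NormedAddCommGroup F] {v : ℝ → F}
    (hv : LocallyIntegrable v volume) (a b : ℝ) : IntervalIntegrable v volume a b :=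
  (hv.integrableOn_isCompact isCompact_uIcc).intervalIntegrable

/-- A function whose weak derivative vanishes on an open interval is constant there. -/
theorem ae_eq_const_on_of_integral_deriv {Ω : Set ℝ} (hΩ : IsOpen Ω) (hΩc : Ω.OrdConnected)
    (hΩn : Ω.Nonempty) {g : ℝ → ℂ} (hg : LocallyIntegrable g volume)
    (h : ∀ φ : ℝ → ℝ, ContDiff ℝ (⊤ : ℕ∞) φ → HasCompactSupport φ → tsupport φ ⊆ Ω →
      ∫ x, deriv φ x • g x = 0) :
    ∃ c : ℂ, ∀ᵐ x ∂(volume : Measure ℝ), x ∈ Ω → g x = c := by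
  obtain ⟨x₀, hx₀⟩ := hΩn
  obtain ⟨ε, hε, hball⟩ := Metric.nhds_basis_closedBall.mem_iff.1 (hΩ.mem_nhds hx₀)
  obtain ⟨b, hb⟩ : ∃ b : ContDiffBump x₀, b.rOut = ε :=
    ⟨⟨ε / 2, ε, by positivity, by linarith⟩, rfl⟩
  set η : ℝ → ℝ := b.normed volume with hη
  have hηc : ContDiff ℝ (⊤ : ℕ∞) η := b.contDiff_normed
  have hηs : HasCompactSupport η := b.hasCompactSupport_normed
  have hη1 : ∫ x, η x = 1 := b.integral_normed
  have hηΩ : tsupport η ⊆ Ω := by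
    rw [hη, b.tsupport_normed_eq, hb]; exact hball
  have hηi : Integrable η volume := hηc.continuous.integrable_of_hasCompactSupport hηs
  refine ⟨∫ x, η x • g x, ?_⟩
  have hmain : ∀ φ : ℝ → ℝ, ContDiff ℝ (⊤ : ℕ∞) φ → HasCompactSupport φ → tsupport φ ⊆ Ω →
      ∫ x, φ x • (g x - ∫ x, η x • g x) = 0 := by
    intro φ hφ hs hφΩ
    have hφi : Integrable φ volume := hφ.continuous.integrable_of_hasCompactSupport hs
    set a : ℝ := ∫ x, φ x with ha
    -- Subtracting a multiple of the bump η gives mean zero, so the primitive of χ is again a test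
    -- function and may be inserted in the hypothesis.
    set χ : ℝ → ℝ := fun x => φ x - a * η x with hχ
    have hχc : ContDiff ℝ (⊤ : ℕ∞) χ := hφ.sub (contDiff_const.mul hηc)
    have hχi : Integrable χ volume := hφi.sub (hηi.const_mul a)
    have hχ0 : ∫ x, χ x = 0 := by
      rw [hχ, integral_sub hφi (hηi.const_mul a), integral_const_mul, hη1]; simp [ha]
    set S : Set ℝ := tsupport φ ∪ tsupport η with hS
    have hSc : IsCompact S := hs.isCompact.union hηs.isCompact
    have hSn : S.Nonempty := by
      refine ⟨x₀, Or.inr ?_⟩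
      rw [hη, b.tsupport_normed_eq]
      exact Metric.mem_closedBall_self b.rOut_pos.le
    have hSΩ : S ⊆ Ω := Set.union_subset hφΩ hηΩ
    set c := sInf S with hc
    set d := sSup S with hd
    -- The primitive is supported in the convex hull of the two supports; this is where order
    -- connectedness of Ω enters.
    have hcdΩ : Set.Icc c d ⊆ Ω :=
      hΩc.out (hSΩ (hSc.sInf_mem hSn)) (hSΩ (hSc.sSup_mem hSn))
    have hχout : ∀ x, x ∉ Set.Icc c d → χ x = 0 := by
      intro x hx
      have hxS : x ∉ S := fun h => hx ⟨csInf_le hSc.bddBelow h, le_csSup hSc.bddAbove h⟩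
      rw [hS, Set.mem_union, not_or] at hxS
      simp [hχ, image_eq_zero_of_notMem_tsupport hxS.1, image_eq_zero_of_notMem_tsupport hxS.2]
    set ψ : ℝ → ℝ := fun x => ∫ t in c..x, χ t with hψ
    have hψd : ∀ x, HasDerivAt ψ (χ x) x := fun x =>
      intervalIntegral.integral_hasDerivAt_right (hχc.continuous.intervalIntegrable _ _)
        hχc.continuous.stronglyMeasurable.stronglyMeasurableAtFilter hχc.continuous.continuousAt
    have hψ' : deriv ψ = χ := funext fun x => (hψd x).deriv
    have hψc : ContDiff ℝ (⊤ : ℕ∞) ψ := by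
      rw [contDiff_infty_iff_deriv, hψ']
      exact ⟨fun x => (hψd x).differentiableAt, hχc⟩
    have hψout : ∀ x, x ∉ Set.Icc c d → ψ x = 0 := by
      intro x hx
      rw [Set.mem_Icc, not_and_or, not_le, not_le] at hx
      rcases hx with hx | hx
      · have h1 : ∀ᵐ t ∂(volume : Measure ℝ), t ≠ c := by simp [ae_iff, measure_singleton]
        refine intervalIntegral.integral_zero_ae ?_
        filter_upwards [h1] with t htc ht
        rw [Set.uIoc_of_ge hx.le] at ht
        exact hχout t fun h => htc (le_antisymm ht.2 h.1)
      · have h1 : ∫ t in c..x, χ t = ∫ t, χ t := by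
          rw [intervalIntegral.integral_of_le
            ((csInf_le hSc.bddBelow (hSc.sSup_mem hSn)).trans hx.le),
            ← integral_Icc_eq_integral_Ioc]
          refine setIntegral_eq_integral_of_forall_compl_eq_zero fun t ht => hχout t fun h => ht ?_
          exact ⟨h.1, h.2.trans hx.le⟩
        simp only [hψ, h1, hχ0]
    have hψs : HasCompactSupport ψ := HasCompactSupport.intro isCompact_Icc hψout
    have hψt : tsupport ψ ⊆ Set.Icc c d := by
      refine closure_minimal (fun x hx => ?_) isClosed_Icc
      by_contra h
      exact hx (hψout x h)
    have h0 := h ψ hψc hψs (hψt.trans hcdΩ)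
    rw [hψ'] at h0
    have i1 : Integrable (fun x => φ x • g x) volume :=
      hg.integrable_smul_left_of_hasCompactSupport hφ.continuous hs
    have i2 : Integrable (fun x => η x • g x) volume :=
      hg.integrable_smul_left_of_hasCompactSupport hηc.continuous hηs
    have e : ∫ x, χ x • g x = (∫ x, φ x • g x) - a • ∫ x, η x • g x := by
      rw [← integral_smul, ← integral_sub i1 (i2.fun_smul a)]
      refine integral_congr_ae (Eventually.of_forall fun x => ?_)
      simp only [hχ, sub_smul, mul_smul]
    rw [e, sub_eq_zero] at h0
    simp only [smul_sub]
    rw [integral_sub i1 (hφi.smul_const _), h0, integral_smul_const, sub_self]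
  have := hΩ.ae_eq_zero_of_integral_contDiff_smul_eq_zero (μ := volume)
    (f := fun x => g x - ∫ x, η x • g x)
    ((hg.sub continuous_const.locallyIntegrable).locallyIntegrableOn _) hmain
  filter_upwards [this] with x hx hxΩ
  exact sub_eq_zero.1 (hx hxΩ)

/-- Product rule for primitives of real locally integrable functions. -/
theorem integral_product_rule_real {a b : ℝ → ℝ} (ha : LocallyIntegrable a volume)
    (hb : LocallyIntegrable b volume) (A B R : ℝ) :
    ∫ x in (0 : ℝ)..R, ((A + ∫ t in (0 : ℝ)..x, a t) * b x + a x * (B + ∫ t in (0 : ℝ)..x, b t))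
      = (A + ∫ t in (0 : ℝ)..R, a t) * (B + ∫ t in (0 : ℝ)..R, b t) - A * B := by
  have hai := LocallyIntegrable.intervalIntegrable_all ha
  have hbi := LocallyIntegrable.intervalIntegrable_all hb
  have hac : ∀ {v : ℝ → ℝ} (hv : ∀ a b, IntervalIntegrable v volume a b) (C : ℝ),
      AbsolutelyContinuousOnInterval (fun x => C + ∫ t in (0 : ℝ)..x, v t) 0 R := by
    intro v hv C
    have h1 : AbsolutelyContinuousOnInterval (fun _ : ℝ => C) 0 R :=
      ContDiffOn.absolutelyContinuousOnInterval contDiffOn_const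
    exact h1.add ((hv 0 R).absolutelyContinuousOnInterval_intervalIntegral (c := 0) (by simp))
  have hderiv : ∀ {v : ℝ → ℝ} (hv : LocallyIntegrable v volume) (C : ℝ),
      ∀ᵐ x ∂(volume : Measure ℝ), deriv (fun x => C + ∫ t in (0 : ℝ)..x, v t) x = v x := by
    intro v hv C
    filter_upwards [LocallyIntegrable.ae_hasDerivAt_integral hv] with x hx
    exact ((hx 0).const_add C).deriv
  have key := (hac hai A).integral_mul_deriv_eq_deriv_mul (hac hbi B)
  have hca : Continuous (fun x => A + ∫ t in (0 : ℝ)..x, a t) :=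
    continuous_const.add (intervalIntegral.continuous_primitive hai 0)
  have hcb : Continuous (fun x => B + ∫ t in (0 : ℝ)..x, b t) :=
    continuous_const.add (intervalIntegral.continuous_primitive hbi 0)
  have i1 : IntervalIntegrable (fun x => (A + ∫ t in (0 : ℝ)..x, a t) * b x) volume 0 R :=
    (hbi 0 R).continuousOn_mul hca.continuousOn
  have i2 : IntervalIntegrable (fun x => a x * (B + ∫ t in (0 : ℝ)..x, b t)) volume 0 R :=
    (hai 0 R).mul_continuousOn hcb.continuousOn
  have e1 : ∫ x in (0 : ℝ)..R, (A + ∫ t in (0 : ℝ)..x, a t) *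
      deriv (fun x => B + ∫ t in (0 : ℝ)..x, b t) x
      = ∫ x in (0 : ℝ)..R, (A + ∫ t in (0 : ℝ)..x, a t) * b x := by
    apply intervalIntegral.integral_congr_ae
    filter_upwards [hderiv hb B] with x hx _
    rw [hx]
  have e2 : ∫ x in (0 : ℝ)..R, deriv (fun x => A + ∫ t in (0 : ℝ)..x, a t) x *
      (B + ∫ t in (0 : ℝ)..x, b t) = ∫ x in (0 : ℝ)..R, a x * (B + ∫ t in (0 : ℝ)..x, b t) := by
    apply intervalIntegral.integral_congr_ae
    filter_upwards [hderiv ha A] with x hx _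
    rw [hx]
  rw [e1, e2] at key
  rw [intervalIntegral.integral_add i1 i2, key]
  simp

theorem inner_eq_re_add_im (z w : ℂ) : inner ℝ z w = z.re * w.re + z.im * w.im := by
  rw [Complex.inner]; simp; ring

theorem LocallyIntegrable.re {v : ℝ → ℂ} (hv : LocallyIntegrable v volume) :
    LocallyIntegrable (fun x => (v x).re) volume := fun x => by
  obtain ⟨S, hS, hi⟩ := hv x
  exact ⟨S, hS, MeasureTheory.Integrable.re hi⟩

theorem LocallyIntegrable.im {v : ℝ → ℂ} (hv : LocallyIntegrable v volume) :
    LocallyIntegrable (fun x => (v x).im) volume := fun x => by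
  obtain ⟨S, hS, hi⟩ := hv x
  exact ⟨S, hS, MeasureTheory.Integrable.im hi⟩

theorem intervalIntegral_re {v : ℝ → ℂ} (hv : LocallyIntegrable v volume) (a b : ℝ) :
    (∫ t in a..b, v t).re = ∫ t in a..b, (v t).re :=
  (Complex.reCLM.intervalIntegral_comp_comm (LocallyIntegrable.intervalIntegrable_all hv a b)).symm

theorem intervalIntegral_im {v : ℝ → ℂ} (hv : LocallyIntegrable v volume) (a b : ℝ) :
    (∫ t in a..b, v t).im = ∫ t in a..b, (v t).im :=
  (Complex.imCLM.intervalIntegral_comp_comm (LocallyIntegrable.intervalIntegrable_all hv a b)).symm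

theorem integral_product_rule {a b : ℝ → ℂ} (ha : LocallyIntegrable a volume)
    (hb : LocallyIntegrable b volume) (A B : ℂ) (R : ℝ) :
    ∫ x in (0 : ℝ)..R, (inner ℝ (A + ∫ t in (0 : ℝ)..x, a t) (b x)
        + inner ℝ (a x) (B + ∫ t in (0 : ℝ)..x, b t))
      = inner ℝ (A + ∫ t in (0 : ℝ)..R, a t) (B + ∫ t in (0 : ℝ)..R, b t) - inner ℝ A B := by
  have h1 := integral_product_rule_real (LocallyIntegrable.re ha) (LocallyIntegrable.re hb)
    A.re B.re R
  have h2 := integral_product_rule_real (LocallyIntegrable.im ha) (LocallyIntegrable.im hb)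
    A.im B.im R
  have hI : ∀ {a b : ℝ → ℝ} (ha : LocallyIntegrable a volume) (hb : LocallyIntegrable b volume)
      (A B : ℝ), IntervalIntegrable (fun x => (A + ∫ t in (0 : ℝ)..x, a t) * b x
        + a x * (B + ∫ t in (0 : ℝ)..x, b t)) volume 0 R := by
    intro a b ha hb A B
    have hai := LocallyIntegrable.intervalIntegrable_all ha
    have hbi := LocallyIntegrable.intervalIntegrable_all hb
    exact ((hbi 0 R).continuousOn_mul (continuous_const.add
      (intervalIntegral.continuous_primitive hai 0)).continuousOn).add
      ((hai 0 R).mul_continuousOn (continuous_const.add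
        (intervalIntegral.continuous_primitive hbi 0)).continuousOn)
  simp only [inner_eq_re_add_im, Complex.add_re, Complex.add_im, intervalIntegral_re ha,
    intervalIntegral_im ha, intervalIntegral_re hb, intervalIntegral_im hb]
  rw [show ∀ p q r s : ℝ, p + q - (r + s) = (p - r) + (q - s) from fun p q r s => by ring,
    ← h1, ← h2, ← intervalIntegral.integral_add
      (hI (LocallyIntegrable.re ha) (LocallyIntegrable.re hb) _ _)
      (hI (LocallyIntegrable.im ha) (LocallyIntegrable.im hb) _ _)]
  refine intervalIntegral.integral_congr fun x _ => ?_
  ring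

/-! ### Real inner products on `L²` -/

theorem inner_real_eq (u v : L2) : inner ℝ u v = ∫ x, inner ℝ (u x) (v x) := L2.inner_def u v

theorem integrable_inner_real (u v : L2) :
    Integrable (fun x => inner ℝ (u x) (v x)) (volume : Measure ℝ) := L2.integrable_inner u v

theorem inner_real_eq_re (u v : L2) : inner ℝ u v = (inner ℂ u v).re := by
  rw [inner_real_eq, L2.inner_def]
  refine Eq.trans ?_ (Complex.reCLM.integral_comp_comm (L2.integrable_inner (𝕜 := ℂ) u v))
  refine integral_congr_ae (Eventually.of_forall fun x => ?_)
  simp only [Complex.reCLM_apply]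
  rw [Complex.inner, RCLike.inner_apply, mul_comm]

theorem norm_sq_eq_integral (u : L2) : ‖u‖ ^ 2 = ∫ x, ‖u x‖ ^ 2 := by
  rw [← real_inner_self_eq_norm_sq, inner_real_eq]
  simp

theorem integrable_norm_sq (u : L2) : Integrable (fun x => ‖u x‖ ^ 2) (volume : Measure ℝ) := by
  have := integrable_inner_real u u
  simpa [real_inner_self_eq_norm_sq] using this

/-! ### Real parts -/

theorem HasWeakDerivOn.reL2 {Ω : Set ℝ} {u v : L2} (h : HasWeakDerivOn Ω u v) :
    HasWeakDerivOn Ω (reL2 u) (reL2 v) := by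
  intro φ hφ hs ht
  have key : ∀ (w : L2) (ψ : ℝ → ℝ), Continuous ψ → HasCompactSupport ψ →
      ∫ x, ψ x • (DeltaKG.reL2 w : ℝ → ℂ) x = (((∫ x, ψ x • w x).re : ℝ) : ℂ) := by
    intro w ψ hψ hψs
    have hi := (locallyIntegrable_coe w).integrable_smul_left_of_hasCompactSupport hψ hψs
    refine Eq.trans ?_ ((Complex.ofRealCLM.comp Complex.reCLM).integral_comp_comm hi)
    refine integral_congr_ae ?_
    filter_upwards [reL2_ae w] with x hx
    rw [hx]; simp
  rw [key u _ (hφ.continuous_deriv (by simp)) hs.deriv, key v _ hφ.continuous hs, h φ hφ hs ht]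
  simp

theorem JumpCondition.reL2 {β : ℝ} {u v : L2} (h : JumpCondition β u v) :
    JumpCondition β (reL2 u) (reL2 v) := by
  obtain ⟨f, g, hf, hfu, hg, hgu, a, b, ha, hb, hab⟩ := h
  have hc : Continuous fun z : ℂ => ((z.re : ℝ) : ℂ) :=
    Complex.continuous_ofReal.comp Complex.continuous_re
  refine ⟨fun x => ((f x).re : ℂ), fun x => ((g x).re : ℂ), hc.comp hf, ?_,
    hc.comp_continuousOn hg, ?_, (a.re : ℂ), (b.re : ℂ), (hc.tendsto a).comp ha,
    (hc.tendsto b).comp hb, ?_⟩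
  · filter_upwards [hfu, reL2_ae u] with x h1 h2
    rw [h1, h2]
  · filter_upwards [hgu, reL2_ae v] with x h1 h2
    rw [h1, h2]
  · have := congrArg Complex.re hab
    simp only [Complex.sub_re, Complex.re_ofReal_mul] at this
    rw [← Complex.ofReal_sub, this]
    simp

/-- The jump condition survives because β is real. This invariance is what lets L_β^± be split along
real and imaginary parts. -/
theorem reL2_mem_deltaDomain {β : ℝ} {u : L2} (hu : u ∈ deltaDomain β) :
    reL2 u ∈ deltaDomain β := by
  obtain ⟨u₁, u₂, h, hj⟩ := hu
  exact ⟨reL2 u₁, reL2 u₂, ⟨h.1.reL2, h.2.reL2⟩, hj.reL2⟩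

theorem secondDeriv_reL2 {β : ℝ} (u : deltaDomain β) :
    secondDeriv β ⟨reL2 u, reL2_mem_deltaDomain u.2⟩ = reL2 (secondDeriv β u) := by
  obtain ⟨u₁, u₂, h, hj⟩ := u.2
  rw [secondDeriv_eq u h]
  exact secondDeriv_eq _ ⟨h.1.reL2, h.2.reL2⟩

theorem reL2_reL2 (u : L2) : reL2 (reL2 u) = reL2 u := by
  refine Lp.ext ?_
  filter_upwards [reL2_ae u, reL2_ae (reL2 u)] with x h1 h2
  rw [h2, h1]; simp

theorem reL2_I_smul_reL2 (u : L2) : reL2 (Complex.I • reL2 u) = 0 := by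
  refine Lp.ext ?_
  filter_upwards [reL2_ae u, reL2_ae (Complex.I • reL2 u), Lp.coeFn_smul Complex.I (reL2 u),
    Lp.coeFn_zero ℂ 2 (volume : Measure ℝ)] with x h1 h2 h3 h4
  rw [h2, h3, h4, Pi.smul_apply, h1]; simp

/-- `u = Re u - i Re (i u)`. -/
theorem reL2_sub_I_smul (u : L2) : reL2 u - Complex.I • reL2 (Complex.I • u) = u := by
  refine Lp.ext ?_
  filter_upwards [reL2_ae u, reL2_ae (Complex.I • u), Lp.coeFn_smul Complex.I u,
    Lp.coeFn_sub (reL2 u) (Complex.I • reL2 (Complex.I • u)),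
    Lp.coeFn_smul Complex.I (reL2 (Complex.I • u))] with x h1 h2 h3 h4 h5
  rw [h4, Pi.sub_apply, h5, Pi.smul_apply, h2, h3, h1, Pi.smul_apply]
  apply Complex.ext <;> simp

end

/-! ### Integration by parts on half lines and the form on D_β -/

section
theorem LocallyIntegrable.continuous_primitive {v : ℝ → ℂ} (hv : LocallyIntegrable v volume)
    (C : ℂ) : Continuous fun x => C + ∫ t in (0 : ℝ)..x, v t :=
  continuous_const.add
    (intervalIntegral.continuous_primitive (LocallyIntegrable.intervalIntegrable_all hv) 0)

/-- Integration by parts of a test function against a primitive. -/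
theorem integral_deriv_smul_primitive {φ : ℝ → ℝ} (hφ : ContDiff ℝ (⊤ : ℕ∞) φ)
    (hs : HasCompactSupport φ) {v : ℝ → ℂ} (hv : LocallyIntegrable v volume) :
    ∫ x, deriv φ x • (∫ t in (0 : ℝ)..x, v t) = -∫ x, φ x • v x := by
  have hwc : Continuous fun x => ∫ t in (0 : ℝ)..x, v t :=
    intervalIntegral.continuous_primitive (LocallyIntegrable.intervalIntegrable_all hv) 0
  have hd : Continuous (deriv φ) := hφ.continuous_deriv (by simp)
  have i2 := hwc.locallyIntegrable (μ := volume) |>.integrable_smul_left_of_hasCompactSupport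
    hd hs.deriv
  have i3 := hv.integrable_smul_left_of_hasCompactSupport hφ.continuous hs
  apply Complex.ext
  · have := integral_deriv_mul_primitive hφ hs (LocallyIntegrable.re hv)
    rw [Complex.neg_re]
    refine Eq.trans (Complex.reCLM.integral_comp_comm i2).symm
      (Eq.trans ?_ (congrArg Neg.neg (Complex.reCLM.integral_comp_comm i3)))
    simpa [intervalIntegral_re hv] using this
  · have := integral_deriv_mul_primitive hφ hs (LocallyIntegrable.im hv)
    rw [Complex.neg_im]
    refine Eq.trans (Complex.imCLM.integral_comp_comm i2).symm
      (Eq.trans ?_ (congrArg Neg.neg (Complex.imCLM.integral_comp_comm i3)))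
    simpa [intervalIntegral_im hv] using this

/-- On each half line, a weak derivative in `L²` determines the function up to a constant. -/
theorem HasWeakDerivOn.exists_const {Ω : Set ℝ} (hΩ : IsOpen Ω) (hΩc : Ω.OrdConnected)
    (hΩn : Ω.Nonempty) {u v : L2} (h : HasWeakDerivOn Ω u v) :
    ∃ C : ℂ, ∀ᵐ x ∂(volume : Measure ℝ), x ∈ Ω → u x = C + ∫ t in (0 : ℝ)..x, v t := by
  have hu := locallyIntegrable_coe u
  have hv := locallyIntegrable_coe v
  have hwc : Continuous fun x => ∫ t in (0 : ℝ)..x, v t :=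
    intervalIntegral.continuous_primitive (LocallyIntegrable.intervalIntegrable_all hv) 0
  obtain ⟨C, hC⟩ := ae_eq_const_on_of_integral_deriv hΩ hΩc hΩn
    (g := fun x => u x - ∫ t in (0 : ℝ)..x, v t) (hu.sub hwc.locallyIntegrable) (by
    intro φ hφ hs hφΩ
    have hd : Continuous (_root_.deriv φ) := hφ.continuous_deriv (by simp)
    have i1 := hu.integrable_smul_left_of_hasCompactSupport hd hs.deriv
    have i2 := hwc.locallyIntegrable (μ := volume) |>.integrable_smul_left_of_hasCompactSupport
      hd hs.deriv
    simp only [smul_sub]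
    rw [integral_sub i1 i2, h φ hφ hs hφΩ, integral_deriv_smul_primitive hφ hs hv,
      sub_self])
  refine ⟨C, hC.mono fun x hx hxΩ => ?_⟩
  rw [← hx hxΩ]; ring

theorem HasWeakDerivOn.mono {Ω Ω' : Set ℝ} (hΩ : Ω' ⊆ Ω) {u v : ℝ → ℂ}
    (h : HasWeakDerivOn Ω u v) : HasWeakDerivOn Ω' u v :=
  fun φ hφ hs ht => h φ hφ hs (ht.trans hΩ)

/-- Integration by parts on the half line `(0, ∞)`. -/
theorem integral_Ioi_inner_add {u v : L2} {C : ℂ}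
    (hu : ∀ᵐ x ∂(volume : Measure ℝ), x ∈ Set.Ioi (0 : ℝ) → u x = C + ∫ t in (0 : ℝ)..x, v t)
    (w : H1) :
    ∫ x in Set.Ioi (0 : ℝ), (inner ℝ (u x) (H1.deriv w x) + inner ℝ (v x) (H1.toL2 w x))
      = - inner ℝ C (H1.rep w 0) := by
  have hv := locallyIntegrable_coe v
  have hw := locallyIntegrable_coe (H1.deriv w)
  have hint : IntegrableOn (fun x => inner ℝ (u x) (H1.deriv w x) + inner ℝ (v x) (H1.toL2 w x))
      (Set.Ioi (0 : ℝ)) volume :=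
    ((integrable_inner_real u _).add (integrable_inner_real v _)).integrableOn
  have hae : ∀ᵐ x ∂(volume : Measure ℝ), x ∈ Set.Ioi (0 : ℝ) →
      inner ℝ (u x) (H1.deriv w x) + inner ℝ (v x) (H1.toL2 w x)
      = inner ℝ (C + ∫ t in (0 : ℝ)..x, v t) (H1.deriv w x)
        + inner ℝ (v x) (H1.rep w 0 + ∫ t in (0 : ℝ)..x, H1.deriv w t) := by
    filter_upwards [hu, H1.rep_ae_eq w] with x h1 h2 hx
    rw [h1 hx, ← h2, H1.rep_eq w x]
  have hR : ∀ R : ℝ, 0 ≤ R →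
      ∫ x in (0 : ℝ)..R, (inner ℝ (u x) (H1.deriv w x) + inner ℝ (v x) (H1.toL2 w x))
      = inner ℝ (C + ∫ t in (0 : ℝ)..R, v t) (H1.rep w R) - inner ℝ C (H1.rep w 0) := by
    intro R hR0
    rw [H1.rep_eq w R, ← integral_product_rule hv hw C (H1.rep w 0) R]
    refine intervalIntegral.integral_congr_ae ?_
    filter_upwards [hae] with x hx hx'
    rw [Set.uIoc_of_le hR0] at hx'
    exact hx hx'.1
  have hlim := intervalIntegral_tendsto_integral_Ioi (0 : ℝ) hint tendsto_id
  -- The boundary term at R has a limit as R → ∞ because everything else in the identity does. It is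
  -- also integrable over the half line, as a product of two L² functions, so the limit must be 0.
  have hlim2 : Tendsto (fun R : ℝ => inner ℝ (C + ∫ t in (0 : ℝ)..R, v t) (H1.rep w R)) atTop
      (𝓝 ((∫ x in Set.Ioi (0 : ℝ), (inner ℝ (u x) (H1.deriv w x)
        + inner ℝ (v x) (H1.toL2 w x))) + inner ℝ C (H1.rep w 0))) := by
    refine (hlim.add_const (inner ℝ C (H1.rep w 0))).congr' ?_
    filter_upwards [eventually_ge_atTop (0 : ℝ)] with R hR0
    simp only [id, hR R hR0, sub_add_cancel]
  have hint2 : IntegrableOn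
      (fun R : ℝ => inner ℝ (C + ∫ t in (0 : ℝ)..R, v t) (H1.rep w R)) (Set.Ioi 0) volume := by
    refine Integrable.congr (integrable_inner_real u (H1.toL2 w)).integrableOn ?_
    filter_upwards [ae_restrict_of_ae hu, ae_restrict_of_ae (H1.rep_ae_eq w),
      ae_restrict_mem measurableSet_Ioi] with x h1 h2 h3
    rw [h1 h3, h2]
  have h0 := IntegrableAtFilter.eq_zero_of_tendsto
    (l := atTop) ⟨Set.Ioi 0, Ioi_mem_atTop 0, hint2⟩ (by
      intro s hs
      rcases mem_atTop_sets.1 hs with ⟨b, hb⟩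
      rw [← top_le_iff, ← Real.volume_Ici (a := b)]
      exact measure_mono hb) hlim2
  linarith

/-- Integration by parts on the half line `(-∞, 0)`. -/
theorem integral_Iic_inner_add {u v : L2} {C : ℂ}
    (hu : ∀ᵐ x ∂(volume : Measure ℝ), x ∈ Set.Iio (0 : ℝ) → u x = C + ∫ t in (0 : ℝ)..x, v t)
    (w : H1) :
    ∫ x in Set.Iic (0 : ℝ), (inner ℝ (u x) (H1.deriv w x) + inner ℝ (v x) (H1.toL2 w x))
      = inner ℝ C (H1.rep w 0) := by
  have hv := locallyIntegrable_coe v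
  have hw := locallyIntegrable_coe (H1.deriv w)
  have hint : IntegrableOn (fun x => inner ℝ (u x) (H1.deriv w x) + inner ℝ (v x) (H1.toL2 w x))
      (Set.Iic (0 : ℝ)) volume :=
    ((integrable_inner_real u _).add (integrable_inner_real v _)).integrableOn
  have hne : ∀ᵐ x ∂(volume : Measure ℝ), x ≠ 0 := by simp [ae_iff, measure_singleton]
  have hae : ∀ᵐ x ∂(volume : Measure ℝ), x ∈ Set.Iic (0 : ℝ) →
      inner ℝ (u x) (H1.deriv w x) + inner ℝ (v x) (H1.toL2 w x)
      = inner ℝ (C + ∫ t in (0 : ℝ)..x, v t) (H1.deriv w x)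
        + inner ℝ (v x) (H1.rep w 0 + ∫ t in (0 : ℝ)..x, H1.deriv w t) := by
    filter_upwards [hu, H1.rep_ae_eq w, hne] with x h1 h2 h3 hx
    rw [h1 (lt_of_le_of_ne hx h3), ← h2, H1.rep_eq w x]
  have hR : ∀ R : ℝ, R ≤ 0 →
      ∫ x in R..(0 : ℝ), (inner ℝ (u x) (H1.deriv w x) + inner ℝ (v x) (H1.toL2 w x))
      = inner ℝ C (H1.rep w 0) - inner ℝ (C + ∫ t in (0 : ℝ)..R, v t) (H1.rep w R) := by
    intro R hR0
    rw [intervalIntegral.integral_symm, H1.rep_eq w R, neg_eq_iff_eq_neg, neg_sub,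
      ← integral_product_rule hv hw C (H1.rep w 0) R]
    refine intervalIntegral.integral_congr_ae ?_
    filter_upwards [hae] with x hx hx'
    rw [Set.uIoc_of_ge hR0] at hx'
    exact hx hx'.2
  have hlim := intervalIntegral_tendsto_integral_Iic (0 : ℝ) hint tendsto_id
  have hlim2 : Tendsto (fun R : ℝ => inner ℝ (C + ∫ t in (0 : ℝ)..R, v t) (H1.rep w R)) atBot
      (𝓝 (inner ℝ C (H1.rep w 0) - (∫ x in Set.Iic (0 : ℝ), (inner ℝ (u x) (H1.deriv w x)
        + inner ℝ (v x) (H1.toL2 w x))))) := by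
    refine (hlim.const_sub (inner ℝ C (H1.rep w 0))).congr' ?_
    filter_upwards [eventually_le_atBot (0 : ℝ)] with R hR0
    simp only [id, hR R hR0, sub_sub_cancel]
  have hint2 : IntegrableOn
      (fun R : ℝ => inner ℝ (C + ∫ t in (0 : ℝ)..R, v t) (H1.rep w R)) (Set.Iio 0) volume := by
    refine Integrable.congr (integrable_inner_real u (H1.toL2 w)).integrableOn ?_
    filter_upwards [ae_restrict_of_ae hu, ae_restrict_of_ae (H1.rep_ae_eq w),
      ae_restrict_mem measurableSet_Iio] with x h1 h2 h3
    rw [h1 h3, h2]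
  have h0 := IntegrableAtFilter.eq_zero_of_tendsto
    (l := atBot) ⟨Set.Iio 0, Iio_mem_atBot 0, hint2⟩ (by
      intro s hs
      rcases mem_atBot_sets.1 hs with ⟨b, hb⟩
      rw [← top_le_iff, ← Real.volume_Iic (a := b)]
      exact measure_mono hb) hlim2
  linarith

/-- The form associated with `-d²/dx²` on `D_β`. -/
theorem inner_deriv_add_jump {β : ℝ} {u u₁ u₂ : L2} (h : HasDerivs u u₁ u₂)
    (hj : JumpCondition β u u₁) {f : ℝ → ℂ} (hf : Continuous f) (hfu : f =ᵐ[volume] u) (w : H1) :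
    inner ℝ u₁ (H1.deriv w) + β * inner ℝ (f 0) (H1.rep w 0) = - inner ℝ u₂ (H1.toL2 w) := by
  obtain ⟨f', g, hf', hfu', hg, hgu, a, b, ha, hb, hab⟩ := hj
  obtain rfl : f' = f := (hf'.ae_eq_iff_eq volume hf).1 (hfu'.trans hfu.symm)
  obtain ⟨C, hC⟩ := (h.2.mono (Ω' := Set.Ioi 0) fun x hx => ne_of_gt hx).exists_const isOpen_Ioi
    Set.ordConnected_Ioi Set.nonempty_Ioi
  obtain ⟨D, hD⟩ := (h.2.mono (Ω' := Set.Iio 0) fun x hx => ne_of_lt hx).exists_const isOpen_Iio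
    Set.ordConnected_Iio Set.nonempty_Iio
  have hprim := fun C => LocallyIntegrable.continuous_primitive (locallyIntegrable_coe u₂) C
  -- On a half line g and the primitive are continuous and agree almost everywhere, hence
  -- everywhere; so the one-sided limits of u' are the constants of integration.
  have key : ∀ {Ω : Set ℝ}, IsOpen Ω → Ω ⊆ {0}ᶜ → (𝓝[Ω] (0 : ℝ)).NeBot → ∀ {C a : ℂ},
      (∀ᵐ x ∂(volume : Measure ℝ), x ∈ Ω → u₁ x = C + ∫ t in (0 : ℝ)..x, u₂ t) →
      Tendsto g (𝓝[Ω] 0) (𝓝 a) → a = C := by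
    intro Ω hΩ hΩ0 hne C a hC ha
    have heq : Set.EqOn g (fun x => C + ∫ t in (0 : ℝ)..x, u₂ t) Ω := by
      refine MeasureTheory.Measure.eqOn_open_of_ae_eq (μ := volume) ?_ hΩ (hg.mono hΩ0)
        (hprim C).continuousOn
      rw [EventuallyEq, ae_restrict_iff' hΩ.measurableSet]
      filter_upwards [hC, hgu] with x h1 h2 hx
      rw [h2, h1 hx]
    have h1 : Tendsto (fun x => C + ∫ t in (0 : ℝ)..x, u₂ t) (𝓝[Ω] 0) (𝓝 C) := by
      have := ((hprim C).tendsto 0).mono_left (nhdsWithin_le_nhds (s := Ω))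
      simpa using this
    refine tendsto_nhds_unique ha (h1.congr' ?_)
    filter_upwards [self_mem_nhdsWithin] with x hx
    exact (heq hx).symm
  have haC := key isOpen_Ioi (fun x hx => ne_of_gt hx) inferInstance hC ha
  have hbD := key isOpen_Iio (fun x hx => ne_of_lt hx) inferInstance hD hb
  have h1 := integral_Ioi_inner_add hC w
  have h2 := integral_Iic_inner_add hD w
  have hint := (integrable_inner_real u₁ (H1.deriv w)).add (integrable_inner_real u₂ (H1.toL2 w))
  have h3 := intervalIntegral.integral_Iic_add_Ioi (b := (0 : ℝ)) hint.integrableOn hint.integrableOn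
  simp only [Pi.add_apply] at h3
  rw [h1, h2, integral_add (integrable_inner_real _ _) (integrable_inner_real _ _),
    ← inner_real_eq, ← inner_real_eq] at h3
  have h4 : inner ℝ C (H1.rep w 0) - inner ℝ D (H1.rep w 0) = β * inner ℝ (f' 0) (H1.rep w 0) := by
    rw [← inner_sub_left, ← haC, ← hbD, hab, inner_eq_re_add_im, inner_eq_re_add_im]
    simp
    ring
  linarith

end

/-! ### From the weak equation back to D_β -/

section
theorem H1.norm_sq_eq (u : H1) : ‖u‖ ^ 2 = ‖H1.toL2 u‖ ^ 2 + ‖H1.deriv u‖ ^ 2 :=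
  WithLp.prod_norm_sq_eq_of_L2 (u : WithLp 2 (L2 × L2))

/-- Test functions belong to `H¹(ℝ)`. -/
theorem exists_H1_of_test {φ : ℝ → ℝ} (hφ : ContDiff ℝ (⊤ : ℕ∞) φ) (hs : HasCompactSupport φ)
    (c : ℂ) : ∃ w : H1, H1.toL2 w =ᵐ[volume] (fun x => φ x • c) ∧
      H1.deriv w =ᵐ[volume] (fun x => deriv φ x • c) ∧ H1.rep w 0 = φ 0 • c := by
  have hd : Continuous (_root_.deriv φ) := hφ.continuous_deriv (by simp)
  have hm : ∀ {ψ : ℝ → ℝ}, Continuous ψ → HasCompactSupport ψ →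
      MemLp (fun x => ψ x • c) 2 (volume : Measure ℝ) := fun hψ hψs =>
    (hψ.smul continuous_const).memLp_of_hasCompactSupport hψs.smul_right
  have h1 := (hm hφ.continuous hs).coeFn_toLp
  have h2 := (hm hd hs.deriv).coeFn_toLp
  have hw : HasWeakDerivOn Set.univ ((hm hφ.continuous hs).toLp _) ((hm hd hs.deriv).toLp _) := by
    intro ψ hψ hψs _
    have hψd : Continuous (_root_.deriv ψ) := hψ.continuous_deriv (by simp)
    have e1 : ∫ x, _root_.deriv ψ x • ((hm hφ.continuous hs).toLp _ : ℝ → ℂ) x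
        = (∫ x, _root_.deriv ψ x * φ x) • c := by
      rw [← integral_smul_const]
      refine integral_congr_ae ?_
      filter_upwards [h1] with x hx
      rw [hx, smul_smul]
    have e2 : ∫ x, ψ x • ((hm hd hs.deriv).toLp _ : ℝ → ℂ) x
        = (∫ x, ψ x * _root_.deriv φ x) • c := by
      rw [← integral_smul_const]
      refine integral_congr_ae ?_
      filter_upwards [h2] with x hx
      rw [hx, smul_smul]
    have hint : ∀ {a b : ℝ → ℝ}, Continuous a → Continuous b → HasCompactSupport a →
        Integrable (a * b) volume := fun ha hb has =>
      (ha.mul hb).integrable_of_hasCompactSupport has.mul_right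
    have e3 := integral_mul_deriv_eq_deriv_mul_of_integrable (u := ψ) (v := φ)
      (u' := _root_.deriv ψ) (v' := _root_.deriv φ)
      (fun x _ => (hψ.differentiable (by simp) x).hasDerivAt)
      (fun x _ => (hφ.differentiable (by simp) x).hasDerivAt)
      (hint hψ.continuous hd hψs) (hint hψd hφ.continuous hψs.deriv)
      (hint hψ.continuous hφ.continuous hψs)
    rw [e1, e2, e3, neg_smul, neg_neg]
  refine ⟨⟨WithLp.toLp 2 (_, _), hw⟩, h1, h2, ?_⟩
  rw [H1.rep_unique _ (hφ.continuous.smul continuous_const) h1.symm]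
  rfl

/-- Elements of `H¹` satisfying the form equation belong to `D_β`. -/
theorem mem_deltaDomain_of_form {β : ℝ} {u : H1} {f : L2}
    (h : ∀ w : H1, inner ℝ (H1.deriv u) (H1.deriv w) + β * inner ℝ (H1.rep u 0) (H1.rep w 0)
      = inner ℝ f (H1.toL2 w)) :
    ∃ hu : H1.toL2 u ∈ deltaDomain β, secondDeriv β ⟨H1.toL2 u, hu⟩ = -f := by
  have hf := locallyIntegrable_coe f
  have hu' := locallyIntegrable_coe (H1.deriv u)
  have hin : ∀ (v : L2) {ψ : ℝ → ℝ} (hψ : Continuous ψ) (hψs : HasCompactSupport ψ) (c : ℂ)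
      {w : L2} (hw : w =ᵐ[volume] fun x => ψ x • c),
      inner ℝ v w = inner ℝ (∫ x, ψ x • v x) c := by
    intro v ψ hψ hψs c w hw
    have hi := (locallyIntegrable_coe v).integrable_smul_left_of_hasCompactSupport hψ hψs
    rw [inner_real_eq, real_inner_comm c, ← integral_inner hi]
    refine integral_congr_ae ?_
    filter_upwards [hw] with x hx
    rw [hx, inner_smul_right, inner_smul_right, real_inner_comm]
  -- Testing with φ·c for all c ∈ ℂ: in the sense of distributions, u'' = -f + βu(0)δ₀. Away from
  -- the origin the point mass is not seen.
  have hE : ∀ φ : ℝ → ℝ, ContDiff ℝ (⊤ : ℕ∞) φ → HasCompactSupport φ →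
      ∫ x, deriv φ x • H1.deriv u x = (∫ x, φ x • f x) - (β * φ 0) • H1.rep u 0 := by
    intro φ hφ hs
    refine ext_inner_right ℝ fun c => ?_
    obtain ⟨w, h1, h2, h3⟩ := exists_H1_of_test hφ hs c
    have := h w
    rw [hin _ (hφ.continuous_deriv (by simp)) hs.deriv c h2, hin _ hφ.continuous hs c h1, h3,
      inner_smul_right] at this
    rw [inner_sub_left, inner_smul_left, conj_trivial]
    linarith
  have hD : HasDerivs (H1.toL2 u) (H1.deriv u) (-f) := by
    refine ⟨u.2, fun φ hφ hs hφΩ => ?_⟩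
    have h0 : φ 0 = 0 := image_eq_zero_of_notMem_tsupport fun h => hφΩ h rfl
    rw [hE φ hφ hs, h0, mul_zero, zero_smul, sub_zero, ← integral_neg]
    refine integral_congr_ae ?_
    filter_upwards [Lp.coeFn_neg f] with x hx
    rw [hx, Pi.neg_apply, smul_neg, neg_neg]
  set k : ℂ := β * H1.rep u 0 with hk
  set F : ℝ → ℂ := fun x => ∫ t in (0 : ℝ)..x, f t with hF
  have hFc : Continuous F :=
    intervalIntegral.continuous_primitive (LocallyIntegrable.intervalIntegrable_all hf) 0
  -- A step of height βu(0), whose distributional derivative is the point mass. Hence u' + F - s has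
  -- zero derivative and is a constant C, so C - F + s is the representative of u' that exhibits the
  -- jump.
  set s : ℝ → ℂ := (Set.Ioi (0 : ℝ)).indicator fun _ => k with hs
  have hsl : LocallyIntegrable s volume :=
    (continuous_const.locallyIntegrable).indicator measurableSet_Ioi
  obtain ⟨C, hC⟩ := ae_eq_const_of_integral_deriv
    (g := fun x => H1.deriv u x + F x - s x) ((hu'.add hFc.locallyIntegrable).sub hsl) (by
    intro φ hφ hs'
    have hd : Continuous (_root_.deriv φ) := hφ.continuous_deriv (by simp)
    have i1 := hu'.integrable_smul_left_of_hasCompactSupport hd hs'.deriv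
    have i2 := (hFc.locallyIntegrable (μ := volume)).integrable_smul_left_of_hasCompactSupport
      hd hs'.deriv
    have i3 := hsl.integrable_smul_left_of_hasCompactSupport hd hs'.deriv
    have e3 : ∫ x, _root_.deriv φ x • s x = -(φ 0 • k) := by
      have : ∀ x, _root_.deriv φ x • s x
          = (Set.Ioi (0 : ℝ)).indicator (fun x => _root_.deriv φ x • k) x := fun x => by
        by_cases hx : x ∈ Set.Ioi (0 : ℝ) <;> simp [hs, hx]
      simp only [this]
      rw [integral_indicator measurableSet_Ioi, integral_smul_const,
        hs'.integral_Ioi_deriv_eq (hφ.of_le (by exact_mod_cast le_top)), neg_smul]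
    simp only [smul_sub, smul_add]
    rw [integral_sub (i1.fun_add i2) i3, integral_add i1 i2, hE φ hφ hs',
      integral_deriv_smul_primitive hφ hs' hf, e3, hk]
    simp only [Complex.real_smul]
    push_cast
    ring)
  have hJ : JumpCondition β (H1.toL2 u) (H1.deriv u) := by
    have hcC : Continuous fun x => C - F x := continuous_const.sub hFc
    have hlim : Tendsto (fun x => C - F x) (𝓝 0) (𝓝 C) := by
      have := hcC.tendsto 0
      simpa [hF] using this
    refine ⟨H1.rep u, fun x => C - F x + s x, H1.rep_continuous u, H1.rep_ae_eq u, ?_, ?_,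
      C + k, C, ?_, ?_, ?_⟩
    · intro x hx
      rcases lt_or_gt_of_ne (show x ≠ 0 from hx) with h0 | h0
      · refine (hcC.continuousAt.congr ?_).continuousWithinAt
        filter_upwards [Iio_mem_nhds h0] with y hy
        simp [hs, not_lt.2 (le_of_lt (show y < 0 from hy))]
      · refine ((hcC.add continuous_const).continuousAt.congr
          (f := fun x => C - F x + k) ?_).continuousWithinAt
        filter_upwards [Ioi_mem_nhds h0] with y hy
        simp [hs, show 0 < y from hy]
    · filter_upwards [hC] with x hx
      rw [← hx]; ring
    · refine ((hlim.mono_left nhdsWithin_le_nhds).add_const k).congr' ?_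
      filter_upwards [self_mem_nhdsWithin] with y hy
      simp [hs, show 0 < y from hy]
    · refine (hlim.mono_left nhdsWithin_le_nhds).congr' ?_
      filter_upwards [self_mem_nhdsWithin] with y hy
      simp [hs, not_lt.2 (le_of_lt (show y < 0 from hy))]
    · rw [hk]; ring
  exact ⟨⟨_, _, hD, hJ⟩, secondDeriv_eq _ hD⟩

/-- The form of `-d²/dx²` on `D_β`. -/
theorem exists_H1_of_mem_deltaDomain {β : ℝ} (u : deltaDomain β) :
    ∃ U : H1, H1.toL2 U = u ∧ ∀ w : H1,
      inner ℝ (H1.deriv U) (H1.deriv w) + β * inner ℝ (H1.rep U 0) (H1.rep w 0)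
        = -inner ℝ (secondDeriv β u) (H1.toL2 w) := by
  obtain ⟨u₁, u₂, h, hj⟩ := u.2
  refine ⟨⟨WithLp.toLp 2 ((u : L2), u₁), h.1⟩, rfl, fun w => ?_⟩
  rw [secondDeriv_eq u h]
  exact inner_deriv_add_jump h hj (H1.rep_continuous _) (H1.rep_ae_eq _) w

theorem H1.toL2_injective : Function.Injective H1.toL2 := by
  intro u v h
  have h1 : HasWeakDerivOn Set.univ (H1.toL2 u) (H1.deriv u) := u.2
  have h2 : HasWeakDerivOn Set.univ (H1.toL2 v) (H1.deriv v) := v.2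
  rw [← h] at h2
  have h3 := h1.unique isOpen_univ (by simp) h2
  refine Subtype.ext (WithLp.ofLp_injective 2 (Prod.ext h h3))

/-! ### Pointwise estimates in `H¹` -/

/-- Cauchy–Schwarz for u(x) - u(y) = ∫ u' over a subinterval of [a, b]. -/
theorem H1.norm_rep_sub_sq_le (u : H1) {a b x y : ℝ} (hx : x ∈ Set.Icc a b)
    (hy : y ∈ Set.Icc a b) :
    ‖H1.rep u x - H1.rep u y‖ ^ 2 ≤ (b - a) * ∫ t in a..b, ‖H1.deriv u t‖ ^ 2 := by
  have hab : a ≤ b := hx.1.trans hx.2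
  have hv := locallyIntegrable_coe (H1.deriv u)
  have hvi := LocallyIntegrable.intervalIntegrable_all hv
  have hi1 : IntervalIntegrable (fun t => ‖H1.deriv u t‖) volume a b := (hvi a b).norm
  have hi2 : IntervalIntegrable (fun t => ‖H1.deriv u t‖ ^ 2) volume a b :=
    (integrable_norm_sq _).intervalIntegrable
  set I := ∫ t in a..b, ‖H1.deriv u t‖ with hI
  set Q := ∫ t in a..b, ‖H1.deriv u t‖ ^ 2 with hQ
  have hle : ‖H1.rep u x - H1.rep u y‖ ≤ I := by
    have e : H1.rep u x - H1.rep u y = ∫ t in y..x, H1.deriv u t := by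
      rw [H1.rep_eq u x, H1.rep_eq u y, ← intervalIntegral.integral_interval_sub_left (hvi 0 x)
        (hvi 0 y)]
      ring
    rw [e]
    refine intervalIntegral.norm_integral_le_integral_norm_uIoc.trans ?_
    rw [hI, intervalIntegral.integral_of_le hab]
    refine setIntegral_mono_set ((intervalIntegrable_iff_integrableOn_Ioc_of_le hab).1 hi1)
      (Eventually.of_forall fun _ => norm_nonneg _) (LE.le.eventuallyLE ?_)
    exact Set.Ioc_subset_Ioc (le_min hy.1 hx.1) (max_le hy.2 hx.2)
  have hCS : I ^ 2 ≤ (b - a) * Q := by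
    rcases hab.eq_or_lt with rfl | hlt
    · simp [hI]
    -- Cauchy–Schwarz as a variance: expand the square of (b - a)|u'| - I, then divide by b - a.
    have h0 : 0 ≤ ∫ t in a..b, ((b - a) * ‖H1.deriv u t‖ - I) ^ 2 :=
      intervalIntegral.integral_nonneg hab fun t _ => sq_nonneg _
    have e : ∫ t in a..b, ((b - a) * ‖H1.deriv u t‖ - I) ^ 2
        = (b - a) ^ 2 * Q - (2 * (b - a) * I) * I + (b - a) * I ^ 2 := by
      have : ∀ t, ((b - a) * ‖H1.deriv u t‖ - I) ^ 2
          = (b - a) ^ 2 * ‖H1.deriv u t‖ ^ 2 - (2 * (b - a) * I) * ‖H1.deriv u t‖ + I ^ 2 :=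
        fun t => by ring
      simp only [this]
      rw [intervalIntegral.integral_add ((hi2.const_mul _).sub (hi1.const_mul _)) (by simp),
        intervalIntegral.integral_sub (hi2.const_mul _) (hi1.const_mul _),
        intervalIntegral.integral_const_mul, intervalIntegral.integral_const_mul,
        intervalIntegral.integral_const, ← hI, ← hQ, smul_eq_mul]
    rw [e] at h0
    have h1 : 0 ≤ (b - a) * ((b - a) * Q - I ^ 2) := by linarith
    have := nonneg_of_mul_nonneg_right h1 (sub_pos.2 hlt)
    linarith
  calc _ ≤ I ^ 2 := by gcongr
    _ ≤ _ := hCS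

theorem H1.intervalIntegrable_rep_sq (u : H1) (a b : ℝ) :
    IntervalIntegrable (fun x => ‖H1.rep u x‖ ^ 2) volume a b :=
  ((H1.rep_continuous u).norm.pow 2).intervalIntegrable a b

/-- Poincaré's inequality for functions vanishing at an endpoint. -/
theorem H1.integral_rep_sq_le (u : H1) {a b : ℝ} (hab : a ≤ b) (h0 : H1.rep u a = 0) :
    ∫ x in a..b, ‖H1.rep u x‖ ^ 2 ≤ (b - a) ^ 2 * ∫ t in a..b, ‖H1.deriv u t‖ ^ 2 := by
  have h1 : ∫ x in a..b, ‖H1.rep u x‖ ^ 2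
      ≤ ∫ _ in a..b, (b - a) * ∫ t in a..b, ‖H1.deriv u t‖ ^ 2 := by
    refine intervalIntegral.integral_mono_on hab (H1.intervalIntegrable_rep_sq u a b) (by simp)
      fun x hx => ?_
    simpa [h0] using H1.norm_rep_sub_sq_le u hx (Set.left_mem_Icc.2 hab)
  refine h1.trans_eq ?_
  rw [intervalIntegral.integral_const, smul_eq_mul]
  ring

theorem H1.intervalIntegral_deriv_sq_le (u : H1) {a b : ℝ} (hab : a ≤ b) :
    ∫ x in a..b, ‖H1.deriv u x‖ ^ 2 ≤ ‖H1.deriv u‖ ^ 2 := by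
  rw [norm_sq_eq_integral, intervalIntegral.integral_of_le hab]
  exact setIntegral_le_integral (integrable_norm_sq _) (Eventually.of_forall fun _ => sq_nonneg _)

theorem H1.integrable_rep_sq (u : H1) : Integrable (fun x => ‖H1.rep u x‖ ^ 2) volume :=
  (integrable_norm_sq (H1.toL2 u)).congr ((H1.rep_ae_eq u).mono fun x hx => by simp only [hx])

theorem H1.integral_rep_sq (u : H1) : ∫ x, ‖H1.rep u x‖ ^ 2 = ‖H1.toL2 u‖ ^ 2 := by
  rw [norm_sq_eq_integral]
  exact integral_congr_ae ((H1.rep_ae_eq u).mono fun x hx => by simp only [hx])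

/-- The trace inequality `|u(0)|² ≤ (2/h) ‖u‖² + 2h ‖u'‖²`. -/
theorem H1.norm_rep_zero_sq_le (u : H1) {h : ℝ} (hh : 0 < h) :
    ‖H1.rep u 0‖ ^ 2 ≤ 2 / h * ‖H1.toL2 u‖ ^ 2 + 2 * h * ‖H1.deriv u‖ ^ 2 := by
  have hpt : ∀ x ∈ Set.Icc 0 h,
      ‖H1.rep u 0‖ ^ 2 ≤ 2 * ‖H1.rep u x‖ ^ 2 + 2 * (h * ‖H1.deriv u‖ ^ 2) := by
    intro x hx
    have h1 := H1.norm_rep_sub_sq_le u (Set.left_mem_Icc.2 hh.le) hx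
    rw [sub_zero] at h1
    have h2 := mul_le_mul_of_nonneg_left (H1.intervalIntegral_deriv_sq_le u hh.le) hh.le
    have h3 : ‖H1.rep u 0‖ ≤ ‖H1.rep u x‖ + ‖H1.rep u 0 - H1.rep u x‖ := by
      have := norm_add_le (H1.rep u x) (H1.rep u 0 - H1.rep u x)
      simpa using this
    have h4 : ‖H1.rep u 0‖ ^ 2 ≤ (‖H1.rep u x‖ + ‖H1.rep u 0 - H1.rep u x‖) ^ 2 := by gcongr
    nlinarith [sq_nonneg (‖H1.rep u x‖ - ‖H1.rep u 0 - H1.rep u x‖)]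
  -- Average the pointwise bound over [0, h]; the gain of the factor h is divided out at the end.
  have h5 : ∫ _ in (0 : ℝ)..h, ‖H1.rep u 0‖ ^ 2
      ≤ ∫ x in (0 : ℝ)..h, (2 * ‖H1.rep u x‖ ^ 2 + 2 * (h * ‖H1.deriv u‖ ^ 2)) :=
    intervalIntegral.integral_mono_on hh.le (by simp)
      (((H1.intervalIntegrable_rep_sq u 0 h).const_mul 2).add (by simp)) hpt
  rw [intervalIntegral.integral_add ((H1.intervalIntegrable_rep_sq u 0 h).const_mul 2) (by simp),
    intervalIntegral.integral_const_mul, intervalIntegral.integral_const,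
    intervalIntegral.integral_const, smul_eq_mul, smul_eq_mul, sub_zero] at h5
  have h6 : ∫ x in (0 : ℝ)..h, ‖H1.rep u x‖ ^ 2 ≤ ‖H1.toL2 u‖ ^ 2 := by
    rw [← H1.integral_rep_sq, intervalIntegral.integral_of_le hh.le]
    exact setIntegral_le_integral (H1.integrable_rep_sq u)
      (Eventually.of_forall fun _ => sq_nonneg _)
  have h7 : h * ‖H1.rep u 0‖ ^ 2
      ≤ h * (2 / h * ‖H1.toL2 u‖ ^ 2 + 2 * h * ‖H1.deriv u‖ ^ 2) := by
    have : h * (2 / h * ‖H1.toL2 u‖ ^ 2 + 2 * h * ‖H1.deriv u‖ ^ 2)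
        = 2 * ‖H1.toL2 u‖ ^ 2 + h * (2 * (h * ‖H1.deriv u‖ ^ 2)) := by field_simp
    rw [this]; linarith
  exact le_of_mul_le_mul_left h7 hh

/-- The delta interaction is a small perturbation of the Dirichlet form. -/
theorem exists_delta_form_bound (β : ℝ) : ∃ C : ℝ, 0 ≤ C ∧ ∀ u : H1,
    -(1 / 2 * ‖H1.deriv u‖ ^ 2 + C * ‖H1.toL2 u‖ ^ 2) ≤ β * ‖H1.rep u 0‖ ^ 2 := by
  -- This width makes |β|·2h ≤ 1/2, so half of the Dirichlet form absorbs the trace term.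
  set h : ℝ := 1 / (4 * (|β| + 1)) with hh
  have hb : 0 < |β| + 1 := by positivity
  have hh0 : 0 < h := by positivity
  refine ⟨|β| * (2 / h), by positivity, fun u => ?_⟩
  have h1 := mul_le_mul_of_nonneg_left (H1.norm_rep_zero_sq_le u hh0) (abs_nonneg β)
  have h2 : |β| * (2 * h) ≤ 1 / 2 := by
    have : |β| * (2 * h) = |β| / (|β| + 1) / 2 := by rw [hh]; field_simp; norm_num
    rw [this]
    have : |β| / (|β| + 1) ≤ 1 := by rw [div_le_one hb]; linarith
    linarith
  have h3 := mul_le_mul_of_nonneg_right h2 (sq_nonneg ‖H1.deriv u‖)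
  have h4 := mul_le_mul_of_nonneg_right (neg_abs_le β) (sq_nonneg ‖H1.rep u 0‖)
  linarith

end

section
/-! ### Schrödinger operators with a delta interaction -/

/-- The operator `u ↦ -u'' + M u` on `D_β`, for a bounded operator `M` on `L²`. -/
def schrodinger (β : ℝ) (M : L2 →L[ℂ] L2) : L2 →ₗ.[ℂ] L2 where
  domain := deltaDomain β
  toFun := -secondDeriv β + (M : L2 →ₗ[ℂ] L2) ∘ₗ (deltaDomain β).subtype

theorem abs_inner_apply_self_le (M : L2 →L[ℝ] L2) (u : L2) :
    |inner ℝ (M u) u| ≤ ‖M‖ * ‖u‖ ^ 2 := by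
  refine (abs_real_inner_le_norm _ _).trans ?_
  nlinarith [M.le_opNorm u, norm_nonneg u]

/-- Lax–Milgram for the form of `-d²/dx² + M` on `H¹(ℝ)`. -/
theorem exists_lower_bound (β : ℝ) (M : L2 →L[ℝ] L2) : ∃ k : ℝ,
    (∀ u : H1, 1 / 2 * ‖u‖ ^ 2 ≤ ‖H1.deriv u‖ ^ 2 + β * ‖H1.rep u 0‖ ^ 2
      + inner ℝ (M (H1.toL2 u)) (H1.toL2 u) + k * ‖H1.toL2 u‖ ^ 2) := by
  obtain ⟨C, hC0, hC⟩ := exists_delta_form_bound β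
  -- C pays for the delta interaction and ‖M‖ for the bounded part; 1/2 supplies the L² part of the
  -- H¹ norm.
  refine ⟨C + ‖M‖ + 1 / 2, fun u => ?_⟩
  have h1 := hC u
  have h2 := neg_le_of_abs_le (abs_inner_apply_self_le M (H1.toL2 u))
  rw [H1.norm_sq_eq]
  nlinarith

/-- Lax–Milgram: the Riesz operator of the form shifted by k is coercive, hence invertible, and the
data f enters through the adjoint of the embedding of H¹ in L². -/
theorem exists_form_solution (β : ℝ) (M : L2 →L[ℝ] L2) {k : ℝ}
    (hk : ∀ u : H1, 1 / 2 * ‖u‖ ^ 2 ≤ ‖H1.deriv u‖ ^ 2 + β * ‖H1.rep u 0‖ ^ 2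
      + inner ℝ (M (H1.toL2 u)) (H1.toL2 u) + k * ‖H1.toL2 u‖ ^ 2) (f : L2) :
    ∃ u : H1, ∀ w : H1, inner ℝ (H1.deriv u) (H1.deriv w)
      + β * inner ℝ (H1.rep u 0) (H1.rep w 0)
      = inner ℝ (f - M (H1.toL2 u) - k • H1.toL2 u) (H1.toL2 w) := by
  set T : H1 →L[ℝ] H1 := H1.deriv.adjoint ∘L H1.deriv + β • (H1.evalZero.adjoint ∘L H1.evalZero)
    + H1.toL2.adjoint ∘L (M ∘L H1.toL2 + k • H1.toL2) with hT
  have hTin : ∀ u w, inner ℝ (T u) w = inner ℝ (H1.deriv u) (H1.deriv w)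
      + β * inner ℝ (H1.rep u 0) (H1.rep w 0)
      + inner ℝ (M (H1.toL2 u) + k • H1.toL2 u) (H1.toL2 w) := by
    intro u w
    have e : T u = H1.deriv.adjoint (H1.deriv u) + β • H1.evalZero.adjoint (H1.rep u 0)
      + H1.toL2.adjoint (M (H1.toL2 u) + k • H1.toL2 u) := rfl
    have e' : inner ℝ (β • H1.evalZero.adjoint (H1.rep u 0)) w
        = β * inner ℝ (H1.evalZero.adjoint (H1.rep u 0)) w := real_inner_smul_left (F := H1) _ _ _
    rw [e, inner_add_left, inner_add_left, e',
      ContinuousLinearMap.adjoint_inner_left, ContinuousLinearMap.adjoint_inner_left,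
      ContinuousLinearMap.adjoint_inner_left]
    rfl
  have hunit : IsUnit T := by
    refine ContinuousLinearMap.isUnit_of_forall_le_norm_inner_map T (c := 1 / 2) (by norm_num)
      fun u => ?_
    refine le_trans ?_ (le_abs_self _)
    have h1 := hk u
    rw [hTin, real_inner_self_eq_norm_sq, real_inner_self_eq_norm_sq, inner_add_left,
      inner_smul_left, conj_trivial, real_inner_self_eq_norm_sq]
    push_cast
    linarith
  obtain ⟨u, hu⟩ := (ContinuousLinearMap.isUnit_iff_bijective.1 hunit).2 (H1.toL2.adjoint f)
  refine ⟨u, fun w => ?_⟩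
  have h1 := hTin u w
  rw [hu, ContinuousLinearMap.adjoint_inner_left] at h1
  rw [sub_sub, inner_sub_left, h1]
  ring

/-- The common source of all facts on L_β^±. The form identity on D_β gives symmetry and coercivity
of A + k; weak solutions lie in D_β, so A + k is onto. -/
theorem exists_schrodinger_resolvent (β : ℝ) (M : L2 →L[ℂ] L2)
    (hM : ∀ u v : L2, inner ℂ (M u) v = inner ℂ u (M v)) :
    (∀ u v : (schrodinger β M).domain,
      inner ℂ (schrodinger β M u) (v : L2) = inner ℂ (u : L2) (schrodinger β M v)) ∧
    ∃ k : ℝ, (∀ u : (schrodinger β M).domain,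
        -k * ‖(u : L2)‖ ^ 2 ≤ (inner ℂ (schrodinger β M u) (u : L2)).re) ∧
      ∃ R, IsResolvent (schrodinger β M) ((-k : ℝ) : ℂ) R := by
  set A := schrodinger β M with hA
  have hAap : ∀ u : A.domain, A u = -secondDeriv β u + M u := fun _ => rfl
  have hsymR : ∀ u v : A.domain, inner ℝ (A u) (v : L2) = inner ℝ (u : L2) (A v) := by
    intro u v
    obtain ⟨U, hU, h1⟩ := exists_H1_of_mem_deltaDomain (β := β) u
    obtain ⟨V, hV, h2⟩ := exists_H1_of_mem_deltaDomain (β := β) v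
    have e1 := h1 V
    have e2 := h2 U
    rw [hV] at e1
    rw [hU] at e2
    rw [real_inner_comm (H1.deriv U), real_inner_comm (H1.rep U 0), e1] at e2
    rw [hAap, hAap, inner_add_left, inner_add_right, inner_neg_left,
      e2, inner_neg_right, real_inner_comm (secondDeriv β v)]
    rw [inner_real_eq_re (M u), inner_real_eq_re _ (M v), hM]
  have hsym : ∀ u v : A.domain, inner ℂ (A u) (v : L2) = inner ℂ (u : L2) (A v) := by
    intro u v
    have h1 := hsymR u v
    -- Symmetry for the real part of the inner product, applied to iu, yields the imaginary part.
    have h2 := hsymR (Complex.I • u) v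
    rw [inner_real_eq_re, inner_real_eq_re] at h1 h2
    rw [LinearPMap.map_smul, Submodule.coe_smul, inner_smul_left, inner_smul_left] at h2
    refine Complex.ext h1 ?_
    simpa using h2
  refine ⟨hsym, ?_⟩
  obtain ⟨k, hk⟩ := exists_lower_bound β (M.restrictScalars ℝ)
  have hlow : ∀ u : A.domain, 1 / 2 * ‖(u : L2)‖ ^ 2
      ≤ inner ℝ (A u - ((-k : ℝ) : ℂ) • (u : L2)) (u : L2) := by
    intro u
    obtain ⟨U, hU, h1⟩ := exists_H1_of_mem_deltaDomain (β := β) u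
    have e := h1 U
    have h2 := hk U
    rw [hU, real_inner_self_eq_norm_sq, real_inner_self_eq_norm_sq] at e
    rw [H1.norm_sq_eq, hU, ContinuousLinearMap.coe_restrictScalars'] at h2
    rw [hAap, ← real_smul_eq, inner_sub_left, inner_add_left, inner_neg_left,
      inner_smul_left, real_inner_self_eq_norm_sq, conj_trivial]
    nlinarith [sq_nonneg ‖H1.deriv U‖]
  refine ⟨k, fun u => ?_, ?_⟩
  · have := hlow u
    rw [inner_sub_left, ← real_smul_eq, inner_smul_left, real_inner_self_eq_norm_sq,
      conj_trivial, inner_real_eq_re] at this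
    nlinarith [sq_nonneg ‖(u : L2)‖]
  have hsur : ∀ f : L2, ∃ u : A.domain, A u - ((-k : ℝ) : ℂ) • (u : L2) = f := by
    intro f
    obtain ⟨U, hU⟩ := exists_form_solution β (M.restrictScalars ℝ) hk f
    obtain ⟨hmem, hdd⟩ := mem_deltaDomain_of_form hU
    refine ⟨⟨H1.toL2 U, hmem⟩, ?_⟩
    change -secondDeriv β ⟨H1.toL2 U, hmem⟩ + M (H1.toL2 U) - ((-k : ℝ) : ℂ) • H1.toL2 U = f
    rw [hdd, ← real_smul_eq]
    simp only [ContinuousLinearMap.coe_restrictScalars']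
    module
  -- Coercivity in the L² norm bounds the inverse of A + k by 2.
  have hb : ∀ u : A.domain, ‖(u : L2)‖ ≤ 2 * ‖A u - ((-k : ℝ) : ℂ) • (u : L2)‖ := by
    intro u
    have h1 := (hlow u).trans (real_inner_le_norm _ _)
    rcases (norm_nonneg (u : L2)).eq_or_lt with h0 | h0
    · rw [← h0]; positivity
    · nlinarith
  set D : A.domain →ₗ[ℂ] L2 := A.toFun - ((-k : ℝ) : ℂ) • A.domain.subtype with hD
  have hDap : ∀ u, D u = A u - ((-k : ℝ) : ℂ) • (u : L2) := fun u => rfl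
  have hDinj : Function.Injective D := by
    rw [← LinearMap.ker_eq_bot, LinearMap.ker_eq_bot']
    intro u hu
    have := hb u
    rw [← hDap, hu, norm_zero, mul_zero] at this
    exact Subtype.ext (norm_le_zero_iff.1 this)
  set e := LinearEquiv.ofBijective D ⟨hDinj, hsur⟩ with he
  have heD : ∀ f, D (e.symm f) = f := fun f => e.apply_symm_apply f
  refine ⟨(A.domain.subtype ∘ₗ e.symm.toLinearMap).mkContinuous 2 fun f => ?_, fun u => ?_,
    fun f => ⟨(e.symm f).2, heD f⟩⟩
  · have := hb (e.symm f)
    rwa [← hDap, heD] at this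
  · change ((e.symm (D u) : A.domain) : L2) = u
    rw [show D u = e u from rfl, e.symm_apply_apply]

theorem inner_mulPotential (P : Params) (u v : L2) :
    inner ℂ (mulPotential P u) v = inner ℂ u (mulPotential P v) := by
  rw [L2.inner_def, L2.inner_def]
  refine integral_congr_ae ?_
  filter_upwards [mulPotential_ae P u, mulPotential_ae P v] with x h1 h2
  rw [h1, h2, RCLike.inner_apply, RCLike.inner_apply, map_mul, Complex.conj_ofReal]
  ring

/-- The bounded part `m² - ω² - κ φ_β^{p-1}` of `L_β^±`. -/
def boundedPart (P : Params) (κ : ℝ) : L2 →L[ℂ] L2 :=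
  ((P.m ^ 2 - P.ω ^ 2 : ℝ) : ℂ) • ContinuousLinearMap.id ℂ L2 - (κ : ℂ) • mulPotential P

theorem boundedPart_apply (P : Params) (κ : ℝ) (u : L2) : boundedPart P κ u
    = ((P.m ^ 2 - P.ω ^ 2 : ℝ) : ℂ) • u - (κ : ℂ) • mulPotential P u := rfl

theorem inner_boundedPart (P : Params) (κ : ℝ) (u v : L2) :
    inner ℂ (boundedPart P κ u) v = inner ℂ u (boundedPart P κ v) := by
  rw [boundedPart_apply, boundedPart_apply, inner_sub_left, inner_sub_right, inner_smul_left,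
    inner_smul_left, inner_smul_right, inner_smul_right, inner_mulPotential, Complex.conj_ofReal,
    Complex.conj_ofReal]

theorem Lplus_eq (P : Params) : Lplus P = schrodinger P.β (boundedPart P P.p) := by
  unfold Lplus schrodinger
  congr 1
  refine LinearMap.ext fun u => ?_
  change -secondDeriv P.β u + _ - _ = -secondDeriv P.β u + (_ - _)
  rw [add_sub_assoc]
  rfl

theorem Lminus_eq (P : Params) : Lminus P = schrodinger P.β (boundedPart P 1) := by
  unfold Lminus schrodinger
  congr 1
  refine LinearMap.ext fun u => ?_
  change -secondDeriv P.β u + _ - _ = -secondDeriv P.β u + (_ - ((1 : ℝ) : ℂ) • _)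
  rw [Complex.ofReal_one, one_smul, add_sub_assoc]
  rfl

theorem isSelfAdjoint_schrodinger (P : Params) (κ : ℝ) :
    IsSelfAdjoint (schrodinger P.β (boundedPart P κ)) ∧
      IsBoundedFromBelow (schrodinger P.β (boundedPart P κ)) := by
  obtain ⟨hs, k, hk, R, hR⟩ := exists_schrodinger_resolvent P.β _ (inner_boundedPart P κ)
  exact ⟨isSelfAdjoint_of_symmetric_of_surjective (c := -k) hs fun f =>
    ⟨⟨R f, (hR.2 f).1⟩, (hR.2 f).2⟩, -k, hk⟩

theorem im_eq_zero_of_mem_opSpectrum_schrodinger (P : Params) (κ : ℝ) {z : ℂ}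
    (hz : z ∈ opSpectrum (schrodinger P.β (boundedPart P κ))) : z.im = 0 := by
  obtain ⟨hs, k, hk, R, hR⟩ := exists_schrodinger_resolvent P.β _ (inner_boundedPart P κ)
  exact hR.im_eq_zero_of_mem_opSpectrum (hR.isSelfAdjoint hs) hz

theorem opKer_schrodinger_ne_bot (P : Params) (κ : ℝ) {z : ℂ}
    (hz : z ∈ opSpectrum (schrodinger P.β (boundedPart P κ)))
    (hacc : ¬ AccPt z (𝓟 (opSpectrum (schrodinger P.β (boundedPart P κ))))) :
    opKer (schrodinger P.β (boundedPart P κ)) z ≠ ⊥ := by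
  obtain ⟨hs, k, hk, R, hR⟩ := exists_schrodinger_resolvent P.β _ (inner_boundedPart P κ)
  exact hR.opKer_ne_bot_of_not_accPt (hR.isSelfAdjoint hs) hz hacc

end

section
/-! ### Real and imaginary parts -/

/-- The `ℝ`-linear map `u ↦ Im u` on `L²`. -/
def imL2 : L2 →L[ℝ] L2 :=
  -(reL2 ∘L (Complex.I • ContinuousLinearMap.id ℂ L2).restrictScalars ℝ)

theorem imL2_apply (u : L2) : imL2 u = -reL2 (Complex.I • u) := rfl

theorem reL2_add_I_smul_imL2 (u : L2) : reL2 u + Complex.I • imL2 u = u := by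
  rw [imL2_apply, smul_neg, ← sub_eq_add_neg, reL2_sub_I_smul]

theorem reL2_I_smul (u : L2) : reL2 (Complex.I • u) = -imL2 u := by
  rw [imL2_apply, neg_neg]

theorem imL2_I_smul (u : L2) : imL2 (Complex.I • u) = reL2 u := by
  rw [imL2_apply, smul_smul, Complex.I_mul_I, neg_one_smul, map_neg, neg_neg]

theorem imL2_reL2 (u : L2) : imL2 (reL2 u) = 0 := by
  rw [imL2_apply, reL2_I_smul_reL2, neg_zero]

theorem reL2_imL2 (u : L2) : reL2 (imL2 u) = imL2 u := by
  rw [imL2_apply, map_neg, reL2_reL2]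

theorem imL2_imL2 (u : L2) : imL2 (imL2 u) = 0 := by
  rw [← reL2_imL2 u, imL2_reL2]

theorem reL2_real_smul (s : ℝ) (u : L2) : reL2 ((s : ℂ) • u) = (s : ℂ) • reL2 u := by
  rw [← real_smul_eq, ← real_smul_eq, map_smul]

theorem imL2_real_smul (s : ℝ) (u : L2) : imL2 ((s : ℂ) • u) = (s : ℂ) • imL2 u := by
  rw [← real_smul_eq, ← real_smul_eq, map_smul]

theorem reL2_mulPotential (P : Params) (u : L2) :
    reL2 (mulPotential P u) = mulPotential P (reL2 u) := by
  refine Lp.ext ?_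
  filter_upwards [reL2_ae u, reL2_ae (mulPotential P u), mulPotential_ae P u,
    mulPotential_ae P (reL2 u)] with x h1 h2 h3 h4
  rw [h2, h3, h4, h1, Complex.re_ofReal_mul, Complex.ofReal_mul]

/-- The real part as a map on `D_β`. -/
def reD (β : ℝ) : deltaDomain β →ₗ[ℝ] deltaDomain β where
  toFun u := ⟨reL2 u, reL2_mem_deltaDomain u.2⟩
  map_add' u v := Subtype.ext (map_add reL2 (u : L2) v)
  map_smul' c u := Subtype.ext (map_smul reL2 c (u : L2))

/-- The imaginary part as a map on `D_β`. -/
def imD (β : ℝ) : deltaDomain β →ₗ[ℝ] deltaDomain β where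
  toFun u := -reD β (Complex.I • u)
  map_add' u v := Subtype.ext (map_add imL2 (u : L2) v)
  map_smul' c u := Subtype.ext (map_smul imL2 c (u : L2))

theorem imD_apply {β : ℝ} (u : deltaDomain β) : imD β u = -reD β (Complex.I • u) := rfl

theorem coe_reD {β : ℝ} (u : deltaDomain β) : (reD β u : L2) = reL2 u := rfl

theorem coe_imD {β : ℝ} (u : deltaDomain β) : (imD β u : L2) = imL2 u := rfl

theorem reD_add_I_smul_imD {β : ℝ} (u : deltaDomain β) : reD β u + Complex.I • imD β u = u :=
  Subtype.ext (reL2_add_I_smul_imL2 u)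

variable (P : Params)

/-- The operator `L_β^±` for `κ = p` and `κ = 1`, as a linear map on `D_β`. -/
def schrD (κ : ℝ) : deltaDomain P.β →ₗ[ℂ] L2 := (schrodinger P.β (boundedPart P κ)).toFun

theorem schrD_apply (κ : ℝ) (u : deltaDomain P.β) : schrD P κ u = -secondDeriv P.β u
    + (((P.m ^ 2 - P.ω ^ 2 : ℝ) : ℂ) • (u : L2) - (κ : ℂ) • mulPotential P u) := rfl

/-- All coefficients are real, so L_β^± commute with taking real parts. -/
theorem schrD_reD (κ : ℝ) (u : deltaDomain P.β) :
    schrD P κ (reD P.β u) = reL2 (schrD P κ u) := by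
  rw [schrD_apply, schrD_apply, map_add, map_neg, map_sub, reL2_real_smul, reL2_real_smul,
    reL2_mulPotential, ← secondDeriv_reL2]
  rfl

theorem schrD_imD (κ : ℝ) (u : deltaDomain P.β) :
    schrD P κ (imD P.β u) = imL2 (schrD P κ u) := by
  rw [imD_apply, map_neg, schrD_reD, map_smul, imL2_apply]

theorem reL2_schrD_sub (κ s : ℝ) (u : deltaDomain P.β) :
    reL2 (schrD P κ u - (s : ℂ) • (u : L2))
      = schrD P κ (reD P.β u) - (s : ℂ) • (reD P.β u : L2) := by
  rw [map_sub, reL2_real_smul, schrD_reD]; rfl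

theorem imL2_schrD_sub (κ s : ℝ) (u : deltaDomain P.β) :
    imL2 (schrD P κ u - (s : ℂ) • (u : L2))
      = schrD P κ (imD P.β u) - (s : ℂ) • (imD P.β u : L2) := by
  rw [map_sub, imL2_real_smul, schrD_imD]; rfl

theorem isResolvent_schrodinger_iff {κ : ℝ} {z : ℂ} {R : L2 →L[ℂ] L2} :
    IsResolvent (schrodinger P.β (boundedPart P κ)) z R ↔
      (∀ u : deltaDomain P.β, R (schrD P κ u - z • (u : L2)) = u) ∧
      (∀ f : L2, ∃ u : deltaDomain P.β, R f = u ∧ schrD P κ u - z • (u : L2) = f) :=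
  and_congr Iff.rfl (forall_congr' fun f => ⟨fun ⟨h, e⟩ => ⟨⟨R f, h⟩, rfl, e⟩, by
    rintro ⟨u, h, e⟩
    have hu : (⟨R f, h ▸ u.2⟩ : deltaDomain P.β) = u := Subtype.ext h
    refine ⟨h ▸ u.2, ?_⟩
    change schrD P κ ⟨R f, h ▸ u.2⟩ - z • R f = f
    rw [hu, h]; exact e⟩)

/-- The `ℝ`-linear operator `u ↦ L_β^- u - (p-1) φ_β^{p-1} Re u` on `D_β`. -/
def reducedD : deltaDomain P.β →ₗ[ℝ] L2 :=
  (schrD P 1).restrictScalars ℝ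
    - ((((P.p - 1 : ℝ) : ℂ) • mulPotential P).restrictScalars ℝ : L2 →ₗ[ℝ] L2) ∘ₗ
    (reL2 : L2 →ₗ[ℝ] L2) ∘ₗ (deltaDomain P.β).subtype.restrictScalars ℝ

theorem reducedD_apply (u : deltaDomain P.β) : reducedD P u
    = schrD P 1 u - ((P.p - 1 : ℝ) : ℂ) • mulPotential P (reL2 u) := rfl

/-- L_β^+ and L_β^- differ by (p - 1)φ_β^{p-1}, which the reduced operator applies to the real part
only. It is thus block diagonal for the splitting into real and imaginary parts. -/
theorem reducedD_eq (u : deltaDomain P.β) :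
    reducedD P u = schrD P P.p (reD P.β u) + Complex.I • schrD P 1 (imD P.β u) := by
  have h : schrD P 1 u = schrD P 1 (reD P.β u) + Complex.I • schrD P 1 (imD P.β u) := by
    nth_rewrite 1 [← reD_add_I_smul_imD u]
    rw [map_add, map_smul]
  rw [reducedD_apply, h, schrD_apply P 1 (reD P.β u), schrD_apply P P.p, coe_reD]
  push_cast
  module

theorem reL2_reducedD_sub (s : ℝ) (u : deltaDomain P.β) :
    reL2 (reducedD P u - (s : ℂ) • (u : L2))
      = schrD P P.p (reD P.β u) - (s : ℂ) • (reD P.β u : L2) := by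
  rw [map_sub, reducedD_eq, map_add, reL2_real_smul, reL2_I_smul, ← schrD_imD P 1, schrD_reD,
    reL2_reL2]
  have : imD P.β (imD P.β u) = 0 := Subtype.ext (imL2_imL2 u)
  rw [this, map_zero, neg_zero, add_zero]
  rfl

theorem imL2_reducedD_sub (s : ℝ) (u : deltaDomain P.β) :
    imL2 (reducedD P u - (s : ℂ) • (u : L2))
      = schrD P 1 (imD P.β u) - (s : ℂ) • (imD P.β u : L2) := by
  rw [map_sub, reducedD_eq, map_add, imL2_real_smul, imL2_I_smul, schrD_imD, schrD_reD,
    imL2_reL2, reL2_imL2, zero_add]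
  rfl

theorem reducedD_of_im_eq_zero {u : deltaDomain P.β} (h : imL2 (u : L2) = 0) :
    reducedD P u = schrD P P.p u := by
  have h1 : imD P.β u = 0 := Subtype.ext h
  have h2 := reD_add_I_smul_imD u
  rw [h1, smul_zero, add_zero] at h2
  rw [reducedD_eq, h1, h2, map_zero, smul_zero, add_zero]

theorem reducedD_of_re_eq_zero {u : deltaDomain P.β} (h : reL2 (u : L2) = 0) :
    reducedD P u = schrD P 1 u := by
  rw [reducedD_apply, h, map_zero, smul_zero, sub_zero]

/-- `S` is the inverse of the `ℝ`-linear operator `reducedD - s`. -/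
def IsReducedResolvent (s : ℝ) (S : L2 →L[ℝ] L2) : Prop :=
  (∀ u : deltaDomain P.β, S (reducedD P u - (s : ℂ) • (u : L2)) = u) ∧
  (∀ f : L2, ∃ u : deltaDomain P.β, S f = u ∧ reducedD P u - (s : ℂ) • (u : L2) = f)

/-- By block diagonality the inverse is f ↦ R⁺ Re f + i R⁻ Im f, where R^± are the resolvents of
L_β^±. -/
theorem exists_reducedResolvent {s : ℝ}
    (hp : (s : ℂ) ∈ opResolventSet (schrodinger P.β (boundedPart P P.p)))
    (hm : (s : ℂ) ∈ opResolventSet (schrodinger P.β (boundedPart P 1))) :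
    ∃ S, IsReducedResolvent P s S := by
  obtain ⟨Rp, hRp⟩ := hp
  obtain ⟨Rm, hRm⟩ := hm
  obtain ⟨hp1, hp2⟩ := (isResolvent_schrodinger_iff P).1 hRp
  obtain ⟨hm1, hm2⟩ := (isResolvent_schrodinger_iff P).1 hRm
  refine ⟨Rp.restrictScalars ℝ ∘L reL2
    + (Complex.I • Rm).restrictScalars ℝ ∘L imL2, fun u => ?_, fun f => ?_⟩
  · change Rp (reL2 (_ - _)) + Complex.I • Rm (imL2 (_ - _)) = _
    rw [reL2_reducedD_sub, imL2_reducedD_sub, hp1, hm1]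
    exact reL2_add_I_smul_imL2 _
  · obtain ⟨u, hu, hu'⟩ := hp2 (reL2 f)
    obtain ⟨v, hv, hv'⟩ := hm2 (imL2 f)
    -- With real data the imaginary part of the solution solves the homogeneous equation, so it
    -- vanishes.
    have hur : imL2 (u : L2) = 0 := by
      have h1 := hp1 (imD P.β u)
      have h2 := congrArg imL2 hu'
      rw [imL2_schrD_sub, imL2_reL2] at h2
      rw [h2, map_zero] at h1
      exact h1.symm
    have hvr : imL2 (v : L2) = 0 := by
      have h1 := hm1 (imD P.β v)
      have h2 := congrArg imL2 hv'
      rw [imL2_schrD_sub, imL2_imL2] at h2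
      rw [h2, map_zero] at h1
      exact h1.symm
    have hIv : reL2 ((Complex.I • v : deltaDomain P.β) : L2) = 0 := by
      rw [Submodule.coe_smul, reL2_I_smul, hvr, neg_zero]
    refine ⟨u + Complex.I • v, ?_, ?_⟩
    · change Rp (reL2 f) + Complex.I • Rm (imL2 f) = _
      rw [hu, hv]; rfl
    · rw [map_add, reducedD_of_im_eq_zero P hur, reducedD_of_re_eq_zero P hIv, map_smul,
        Submodule.coe_add, Submodule.coe_smul, smul_add, smul_comm (s : ℂ), add_sub_add_comm,
        ← smul_sub, hu', hv', reL2_add_I_smul_imL2]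

/-- The `ℂ`-linear extension of the restriction of `S` to real functions. -/
theorem exists_complexification (S : L2 →L[ℝ] L2) :
    ∃ R : L2 →L[ℂ] L2, ∀ f, R f = S (reL2 f) + Complex.I • S (imL2 f) := by
  set T : L2 →L[ℝ] L2 := S ∘L reL2 + (Complex.I • ContinuousLinearMap.id ℂ L2).restrictScalars ℝ ∘L
    S ∘L imL2 with hT
  have hTap : ∀ f, T f = S (reL2 f) + Complex.I • S (imL2 f) := fun f => rfl
  have hI : ∀ f, T (Complex.I • f) = Complex.I • T f := fun f => by
    rw [hTap, hTap, reL2_I_smul, imL2_I_smul, map_neg, smul_add, smul_smul, Complex.I_mul_I,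
      neg_one_smul, add_comm]
  refine ⟨{ toFun := T, map_add' := map_add T, map_smul' := fun c f => ?_, cont := T.continuous },
    hTap⟩
  have hc : ∀ g : L2, c • g = c.re • g + c.im • (Complex.I • g) := fun g => by
    rw [real_smul_eq, real_smul_eq, smul_smul, ← add_smul, Complex.re_add_im]
  rw [hc, map_add, map_smul, map_smul, hI, RingHom.id_apply, hc]

/-- L_β^± are complexifications of operators on real functions; it suffices to invert them there,
and the inverse extends ℂ-linearly. -/
theorem mem_opResolventSet_of_real {κ s : ℝ} (S : L2 →L[ℝ] L2)
    (h1 : ∀ u : deltaDomain P.β, imL2 (u : L2) = 0 → S (schrD P κ u - (s : ℂ) • (u : L2)) = u)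
    (h2 : ∀ f : L2, imL2 f = 0 → ∃ u : deltaDomain P.β, S f = u ∧
      schrD P κ u - (s : ℂ) • (u : L2) = f) :
    (s : ℂ) ∈ opResolventSet (schrodinger P.β (boundedPart P κ)) := by
  obtain ⟨R, hR⟩ := exists_complexification S
  refine IsResolvent.mem (R := R) ((isResolvent_schrodinger_iff P).2 ⟨fun u => ?_, fun f => ?_⟩)
  · have e1 := h1 (reD P.β u) (imL2_reL2 (u : L2))
    have e2 := h1 (imD P.β u) (imL2_imL2 (u : L2))
    rw [hR, reL2_schrD_sub, imL2_schrD_sub, e1, e2]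
    exact reL2_add_I_smul_imL2 _
  · obtain ⟨u, hu, hu'⟩ := h2 _ (imL2_reL2 f)
    obtain ⟨v, hv, hv'⟩ := h2 _ (imL2_imL2 f)
    refine ⟨u + Complex.I • v, ?_, ?_⟩
    · rw [hR, hu, hv]; rfl
    · rw [map_add, map_smul, Submodule.coe_add, Submodule.coe_smul, smul_add,
        smul_comm (s : ℂ), add_sub_add_comm, ← smul_sub, hu', hv', reL2_add_I_smul_imL2]

/-- S inverts L_β^+ - s on real functions. On purely imaginary functions it inverts L_β^- - s, so -i
S i does this on real ones. -/
theorem IsReducedResolvent.mem {s : ℝ} {S : L2 →L[ℝ] L2} (h : IsReducedResolvent P s S) :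
    (s : ℂ) ∈ opResolventSet (schrodinger P.β (boundedPart P P.p)) ∧
      (s : ℂ) ∈ opResolventSet (schrodinger P.β (boundedPart P 1)) := by
  obtain ⟨h1, h2⟩ := h
  constructor
  · refine mem_opResolventSet_of_real P S (fun u hu => ?_) fun f hf => ?_
    · rw [← reducedD_of_im_eq_zero P hu, h1]
    · obtain ⟨u, hu, hu'⟩ := h2 f
      have hre : reL2 ((Complex.I • imD P.β u : deltaDomain P.β) : L2) = 0 := by
        rw [Submodule.coe_smul, reL2_I_smul, coe_imD, imL2_imL2, neg_zero]
      -- Real data force a real solution: i Im u solves the homogeneous equation and S is a left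
      -- inverse.
      have h3 := h1 (Complex.I • imD P.β u)
      rw [reducedD_of_re_eq_zero P hre, map_smul, Submodule.coe_smul, smul_comm (s : ℂ),
        ← smul_sub, ← imL2_reducedD_sub, hu', hf, smul_zero, map_zero, eq_comm, smul_eq_zero] at h3
      have him : imL2 (u : L2) = 0 := h3.resolve_left Complex.I_ne_zero
      exact ⟨u, hu, by rw [← reducedD_of_im_eq_zero P him, hu']⟩
  · have hIS : ∀ f, (((-Complex.I) • ContinuousLinearMap.id ℂ L2).restrictScalars ℝ ∘L S ∘L
      (Complex.I • ContinuousLinearMap.id ℂ L2).restrictScalars ℝ) f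
        = -Complex.I • S (Complex.I • f) := fun f => rfl
    refine mem_opResolventSet_of_real P
      (((-Complex.I) • ContinuousLinearMap.id ℂ L2).restrictScalars ℝ ∘L S ∘L
        (Complex.I • ContinuousLinearMap.id ℂ L2).restrictScalars ℝ) (fun u hu => ?_) fun f hf => ?_
    · have hre : reL2 ((Complex.I • u : deltaDomain P.β) : L2) = 0 := by
        rw [Submodule.coe_smul, reL2_I_smul, hu, neg_zero]
      have h3 := h1 (Complex.I • u)
      rw [reducedD_of_re_eq_zero P hre, map_smul, Submodule.coe_smul, smul_comm (s : ℂ),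
        ← smul_sub] at h3
      rw [hIS, h3, smul_smul]
      simp
    · obtain ⟨u, hu, hu'⟩ := h2 (Complex.I • f)
      have him : imL2 (reD P.β u : L2) = 0 := imL2_reL2 _
      have h3 := h1 (reD P.β u)
      rw [reducedD_of_im_eq_zero P him, ← reL2_reducedD_sub, hu', reL2_I_smul, hf, neg_zero,
        map_zero] at h3
      have hre : reL2 (u : L2) = 0 := h3.symm
      refine ⟨-Complex.I • u, by rw [hIS, hu]; rfl, ?_⟩
      rw [map_smul, Submodule.coe_smul, smul_comm (s : ℂ), ← smul_sub,
        ← reducedD_of_re_eq_zero P hre, hu', smul_smul]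
      simp

end

section
variable (P : Params)

/-! ### Reduction of the matrix operator -/

theorem matrixOp_sub_apply (t : ℝ) (U : (matrixOp P).domain) :
    (matrixOp P U - t • (U : WithLp 2 (L2 × L2))).fst
      = reducedD P ⟨U.1.fst, U.2⟩ + ((P.ω : ℂ) ^ 2 - t) • U.1.fst + (Complex.I * P.ω) • U.1.snd ∧
    (matrixOp P U - t • (U : WithLp 2 (L2 × L2))).snd
      = (1 - t : ℂ) • U.1.snd - (Complex.I * P.ω) • U.1.fst := by
  constructor
  · rw [WithLp.sub_fst, WithLp.smul_fst, matrixOp_apply, reducedD_apply, schrD_apply, real_smul_eq]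
    change -secondDeriv P.β ⟨U.1.fst, U.2⟩ + ((P.m ^ 2 : ℝ) : ℂ) • U.1.fst
      - mulPotential P U.1.fst - ((P.p - 1 : ℝ) : ℂ) • mulPotential P (reL2 U.1.fst)
      + (Complex.I * P.ω) • U.1.snd - (t : ℂ) • U.1.fst
      = -secondDeriv P.β ⟨U.1.fst, U.2⟩ + (((P.m ^ 2 - P.ω ^ 2 : ℝ) : ℂ) • U.1.fst
      - ((1 : ℝ) : ℂ) • mulPotential P U.1.fst)
      - ((P.p - 1 : ℝ) : ℂ) • mulPotential P (reL2 U.1.fst) + _ + _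
    push_cast
    module
  · rw [WithLp.sub_snd, WithLp.smul_snd, matrixOp_apply, real_smul_eq]
    change U.1.snd - (Complex.I * P.ω) • U.1.fst - (t : ℂ) • U.1.snd = _
    module

/-- The resolvent equation of the matrix operator, with the second component eliminated. -/
theorem matrixOp_sub_eq_iff {t : ℝ} (ht : t ≠ 1) (U : (matrixOp P).domain)
    (F : WithLp 2 (L2 × L2)) :
    matrixOp P U - t • (U : WithLp 2 (L2 × L2)) = F ↔
      reducedD P ⟨U.1.fst, U.2⟩ - ((bigLambda P t : ℝ) : ℂ) • U.1.fst
          = F.fst - (Complex.I * P.ω / (1 - t)) • F.snd ∧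
        U.1.snd = (1 / (1 - t) : ℂ) • F.snd + (Complex.I * P.ω / (1 - t)) • U.1.fst := by
  -- The elimination rests on ω² - t + (iω)²/(1 - t) = -Λ(t); the ω² is the difference between m²
  -- and the constant m² - ω² in L_β^±.
  obtain ⟨e1, e2⟩ := matrixOp_sub_apply P t U
  have ht' : (1 - t : ℂ) ≠ 0 := by
    rw [sub_ne_zero]; exact_mod_cast ht.symm
  have hI : Complex.I ^ 2 = -1 := Complex.I_sq
  set N := reducedD P ⟨U.1.fst, U.2⟩
  have hL : ((bigLambda P t : ℝ) : ℂ) = t + t * P.ω ^ 2 / (1 - t) := by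
    simp [bigLambda]
  constructor
  · rintro rfl
    rw [e1, e2, hL]
    constructor
    · match_scalars
      · ring
      · field_simp
        linear_combination -(P.ω : ℂ) ^ 2 * hI
      · field_simp
        ring
    · match_scalars
      · field_simp
      · field_simp
        ring
  · rintro ⟨h1, h2⟩
    have h1' := sub_eq_iff_eq_add.1 h1
    refine WithLp.ofLp_injective 2 (Prod.ext ?_ ?_)
    · refine e1.trans ?_
      rw [h1', h2, hL]
      change _ = F.fst
      match_scalars
      · ring
      · field_simp
        ring
      · field_simp
        linear_combination (P.ω : ℂ) ^ 2 * hI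
    · refine e2.trans ?_
      rw [h2]
      change _ = F.snd
      match_scalars
      · field_simp
      · field_simp
        ring

/-- The element `(u, v)` of the domain of the matrix operator. -/
def pairMk (u : deltaDomain P.β) (v : L2) : (matrixOp P).domain := ⟨WithLp.toLp 2 ((u : L2), v), u.2⟩

/-- One direction compresses the resolvent of the matrix operator to data (f, 0) and the first
component; the other rebuilds it from S by the elimination formulas. -/
theorem mem_opResolventSet_matrixOp_iff {t : ℝ} (ht : t ≠ 1) :
    t ∈ opResolventSet (matrixOp P) ↔ ∃ S, IsReducedResolvent P (bigLambda P t) S := by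
  constructor
  · rintro ⟨T, h1, h2⟩
    refine ⟨WithLp.fstL 2 ℝ L2 L2 ∘L T ∘L (WithLp.prodContinuousLinearEquiv 2 ℝ L2 L2).symm ∘L
      ContinuousLinearMap.inl ℝ L2 L2, fun u => ?_, fun f => ?_⟩
    · have h3 : matrixOp P (pairMk P u ((Complex.I * P.ω / (1 - t) : ℂ) • (u : L2)))
          - t • (pairMk P u ((Complex.I * P.ω / (1 - t) : ℂ) • (u : L2)) : WithLp 2 (L2 × L2))
          = WithLp.toLp 2 (reducedD P u - ((bigLambda P t : ℝ) : ℂ) • (u : L2), 0) := by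
        rw [matrixOp_sub_eq_iff P ht]
        refine ⟨?_, ?_⟩
        · change _ = _ - _ • (0 : L2)
          rw [smul_zero, sub_zero]; rfl
        · change _ = _ • (0 : L2) + _
          rw [smul_zero, zero_add]; rfl
      have h4 := h1 (pairMk P u ((Complex.I * P.ω / (1 - t) : ℂ) • (u : L2)))
      rw [h3] at h4
      exact congrArg WithLp.fst h4
    · obtain ⟨h, e⟩ := h2 (WithLp.toLp 2 (f, 0))
      have := ((matrixOp_sub_eq_iff P ht ⟨_, h⟩ _).1 e).1
      refine ⟨⟨_, h⟩, rfl, this.trans ?_⟩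
      change f - _ • (0 : L2) = f
      rw [smul_zero, sub_zero]
  · rintro ⟨S, h1, h2⟩
    set c : ℂ := Complex.I * P.ω / (1 - t) with hc
    set A : WithLp 2 (L2 × L2) →L[ℝ] L2 := S ∘L (WithLp.fstL 2 ℝ L2 L2
      - (c • ContinuousLinearMap.id ℂ L2).restrictScalars ℝ ∘L WithLp.sndL 2 ℝ L2 L2) with hA
    set B : WithLp 2 (L2 × L2) →L[ℝ] L2 :=
      ((1 / (1 - t) : ℂ) • ContinuousLinearMap.id ℂ L2).restrictScalars ℝ ∘L WithLp.sndL 2 ℝ L2 L2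
      + (c • ContinuousLinearMap.id ℂ L2).restrictScalars ℝ ∘L A with hB
    have hAap : ∀ F, A F = S (F.fst - c • F.snd) := fun F => rfl
    have hBap : ∀ F, B F = (1 / (1 - t) : ℂ) • F.snd + c • A F := fun F => rfl
    refine ⟨(WithLp.prodContinuousLinearEquiv 2 ℝ L2 L2).symm ∘L A.prod B, fun U => ?_, fun F => ?_⟩
    · obtain ⟨e1, e2⟩ := (matrixOp_sub_eq_iff P ht U _).1 rfl
      have h3 : A (matrixOp P U - t • (U : WithLp 2 (L2 × L2))) = U.1.fst := by
        rw [hAap, ← e1]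
        exact h1 ⟨U.1.fst, U.2⟩
      refine WithLp.ofLp_injective 2 (Prod.ext h3 ?_)
      refine Eq.trans (hBap _) ?_
      rw [h3]
      exact e2.symm
    · obtain ⟨u, hu, hu'⟩ := h2 (F.fst - c • F.snd)
      have h3 : A F = u := hu
      have hmem : A F ∈ deltaDomain P.β := h3 ▸ u.2
      have h4 : (⟨A F, hmem⟩ : deltaDomain P.β) = u := Subtype.ext h3
      refine ⟨hmem, ?_⟩
      rw [matrixOp_sub_eq_iff P ht]
      refine ⟨?_, hBap F⟩
      change reducedD P ⟨A F, hmem⟩ - ((bigLambda P t : ℝ) : ℂ) • A F = _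
      rw [h4, h3, hu']

/-- The spectrum of the matrix operator is the preimage under `Λ` of those of `L_β^±`. -/
theorem mem_opSpectrum_matrixOp_iff {t : ℝ} (ht : t ≠ 1) : t ∈ opSpectrum (matrixOp P) ↔
    ((bigLambda P t : ℝ) : ℂ) ∈ opSpectrum (schrodinger P.β (boundedPart P P.p)) ∪
      opSpectrum (schrodinger P.β (boundedPart P 1)) := by
  have h : t ∈ opResolventSet (matrixOp P) ↔
      ((bigLambda P t : ℝ) : ℂ) ∈ opResolventSet (schrodinger P.β (boundedPart P P.p)) ∧
      ((bigLambda P t : ℝ) : ℂ) ∈ opResolventSet (schrodinger P.β (boundedPart P 1)) :=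
    (mem_opResolventSet_matrixOp_iff P ht).trans
      ⟨fun ⟨S, hS⟩ => hS.mem P, fun h => exists_reducedResolvent P h.1 h.2⟩
  simp only [opSpectrum, Set.mem_union, Set.mem_compl_iff, h]
  tauto

/-- The kernel of `reducedD - s`. -/
def reducedKer (s : ℝ) : Submodule ℝ (deltaDomain P.β) :=
  LinearMap.ker (reducedD P - ((s : ℂ) • (deltaDomain P.β).subtype).restrictScalars ℝ)

theorem mem_reducedKer {s : ℝ} {u : deltaDomain P.β} :
    u ∈ reducedKer P s ↔ reducedD P u - (s : ℂ) • (u : L2) = 0 := Iff.rfl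

/-- The first component, on the domain of the matrix operator. -/
def matrixFst : (matrixOp P).domain →ₗ[ℝ] deltaDomain P.β := pairDomain.fst P.β

/-- The kernel of the matrix operator is isomorphic to that of the reduced one. -/
def opKerMatrixEquiv {t : ℝ} (ht : t ≠ 1) :
    opKer (matrixOp P) t ≃ₗ[ℝ] reducedKer P (bigLambda P t) :=
  LinearEquiv.ofBijective
    ((matrixFst P).restrict (p := opKer (matrixOp P) t) (q := reducedKer P (bigLambda P t))
      (fun U hU => by
        have h := ((matrixOp_sub_eq_iff P ht U 0).1 hU).1
        rw [mem_reducedKer]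
        refine h.trans ?_
        simp))
    ⟨by
      intro U V h
      have h1 := ((matrixOp_sub_eq_iff P ht U.1 0).1 U.2).2
      have h2 := ((matrixOp_sub_eq_iff P ht V.1 0).1 V.2).2
      have h3 : U.1.1.fst = V.1.1.fst := congrArg (fun x => (x.1 : L2)) h
      refine Subtype.ext (Subtype.ext (WithLp.ofLp_injective 2 (Prod.ext h3 ?_)))
      refine h1.trans (Eq.trans ?_ h2.symm)
      rw [h3], by
      intro u
      refine ⟨⟨pairMk P u.1 ((Complex.I * P.ω / (1 - t) : ℂ) • (u.1 : L2)), ?_⟩, rfl⟩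
      refine (matrixOp_sub_eq_iff P ht _ 0).2 ⟨?_, ?_⟩
      · have := (mem_reducedKer P).1 u.2
        refine Eq.trans this ?_
        simp
      · change _ = _ • (0 : L2) + _
        rw [smul_zero, zero_add]; rfl⟩

/-- The kernel of `L_β^± - s` for `κ = p` and `κ = 1`, in `D_β`. -/
def schrKer (κ s : ℝ) : Submodule ℂ (deltaDomain P.β) :=
  opKer (schrodinger P.β (boundedPart P κ)) (s : ℂ)

theorem mem_schrKer {κ s : ℝ} {u : deltaDomain P.β} :
    u ∈ schrKer P κ s ↔
      schrD P κ u - (s : ℂ) • (u : L2) = 0 := Iff.rfl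

theorem reD_mem_opKer {κ s : ℝ} {u : deltaDomain P.β}
    (hu : u ∈ schrKer P κ s) :
    reD P.β u ∈ schrKer P κ s := by
  rw [mem_schrKer] at hu ⊢
  rw [← reL2_schrD_sub, hu, map_zero]

theorem imD_mem_opKer {κ s : ℝ} {u : deltaDomain P.β}
    (hu : u ∈ schrKer P κ s) :
    imD P.β u ∈ schrKer P κ s := by
  rw [mem_schrKer] at hu ⊢
  rw [← imL2_schrD_sub, hu, map_zero]

theorem mem_reducedKer_iff {s : ℝ} {u : deltaDomain P.β} : u ∈ reducedKer P s ↔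
    reD P.β u ∈ schrKer P P.p s ∧
      imD P.β u ∈ schrKer P 1 s := by
  rw [mem_reducedKer, mem_schrKer, mem_schrKer, ← reL2_reducedD_sub,
    ← imL2_reducedD_sub]
  refine ⟨fun h => by rw [h, map_zero, map_zero]; exact ⟨rfl, rfl⟩, fun ⟨h1, h2⟩ => ?_⟩
  rw [← reL2_add_I_smul_imL2 (reducedD P u - _), h1, h2, smul_zero, add_zero]

theorem reD_reD_add_I_smul {β : ℝ} (u v : deltaDomain β) :
    reD β (reD β u + Complex.I • reD β v) = reD β u := by
  refine Subtype.ext ?_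
  change reL2 (reL2 u + Complex.I • reL2 v) = reL2 u
  rw [map_add, reL2_I_smul, imL2_reL2, neg_zero, add_zero, reL2_reL2]

theorem imD_reD_add_I_smul {β : ℝ} (u v : deltaDomain β) :
    imD β (reD β u + Complex.I • reD β v) = reD β v := by
  refine Subtype.ext ?_
  change imL2 (reL2 u + Complex.I • reL2 v) = reL2 v
  rw [map_add, imL2_I_smul, imL2_reL2, zero_add, reL2_reL2]

theorem reD_imD {β : ℝ} (u : deltaDomain β) : reD β (imD β u) = imD β u :=
  Subtype.ext (reL2_imL2 (u : L2))

/-- Two copies of the kernel of the reduced operator are the kernels of `L_β^±`. -/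
def reducedKerProdEquiv (s : ℝ) : (reducedKer P s × reducedKer P s) ≃ₗ[ℝ]
    (schrKer P P.p s ×
      schrKer P 1 s) where
  -- One copy of the reduced kernel carries only the real functions of ker(L_β^± - s), those for
  -- L_β^- multiplied by i. The second copy supplies their imaginary parts.
  toFun x := (⟨reD P.β x.1 + Complex.I • reD P.β x.2,
      add_mem ((mem_reducedKer_iff P).1 x.1.2).1
        (Submodule.smul_mem _ _ ((mem_reducedKer_iff P).1 x.2.2).1)⟩,
    ⟨imD P.β x.1 + Complex.I • imD P.β x.2,
      add_mem ((mem_reducedKer_iff P).1 x.1.2).2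
        (Submodule.smul_mem _ _ ((mem_reducedKer_iff P).1 x.2.2).2)⟩)
  invFun y := (⟨reD P.β y.1 + Complex.I • reD P.β y.2, (mem_reducedKer_iff P).2 (by
      rw [reD_reD_add_I_smul, imD_reD_add_I_smul]
      exact ⟨reD_mem_opKer P y.1.2, reD_mem_opKer P y.2.2⟩)⟩,
    ⟨imD P.β y.1 + Complex.I • imD P.β y.2, (mem_reducedKer_iff P).2 (by
      rw [← reD_imD (y.1 : deltaDomain P.β), ← reD_imD (y.2 : deltaDomain P.β),
        reD_reD_add_I_smul, imD_reD_add_I_smul, reD_imD, reD_imD]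
      exact ⟨imD_mem_opKer P y.1.2, imD_mem_opKer P y.2.2⟩)⟩)
  map_add' x y := by
    refine Prod.ext (Subtype.ext ?_) (Subtype.ext ?_)
    · change reD P.β (x.1.1 + y.1.1) + Complex.I • reD P.β (x.2.1 + y.2.1)
        = (reD P.β x.1.1 + Complex.I • reD P.β x.2.1) + (reD P.β y.1.1 + Complex.I • reD P.β y.2.1)
      rw [map_add, map_add]; module
    · change imD P.β (x.1.1 + y.1.1) + Complex.I • imD P.β (x.2.1 + y.2.1)
        = (imD P.β x.1.1 + Complex.I • imD P.β x.2.1) + (imD P.β y.1.1 + Complex.I • imD P.β y.2.1)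
      rw [map_add, map_add]; module
  map_smul' c x := by
    refine Prod.ext (Subtype.ext ?_) (Subtype.ext ?_)
    · change reD P.β (c • x.1.1) + Complex.I • reD P.β (c • x.2.1)
        = c • (reD P.β x.1.1 + Complex.I • reD P.β x.2.1)
      rw [map_smul, map_smul, smul_comm Complex.I c, smul_add]
    · change imD P.β (c • x.1.1) + Complex.I • imD P.β (c • x.2.1)
        = c • (imD P.β x.1.1 + Complex.I • imD P.β x.2.1)
      rw [map_smul, map_smul, smul_comm Complex.I c, smul_add]
  left_inv x := by
    refine Prod.ext (Subtype.ext ?_) (Subtype.ext ?_)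
    · change reD P.β (reD P.β x.1.1 + Complex.I • reD P.β x.2.1)
        + Complex.I • reD P.β (imD P.β x.1.1 + Complex.I • imD P.β x.2.1) = x.1.1
      rw [reD_reD_add_I_smul, ← reD_imD x.1.1, ← reD_imD x.2.1, reD_reD_add_I_smul, reD_imD,
        reD_add_I_smul_imD]
    · change imD P.β (reD P.β x.1.1 + Complex.I • reD P.β x.2.1)
        + Complex.I • imD P.β (imD P.β x.1.1 + Complex.I • imD P.β x.2.1) = x.2.1
      rw [imD_reD_add_I_smul, ← reD_imD x.1.1, ← reD_imD x.2.1, imD_reD_add_I_smul, reD_imD,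
        reD_add_I_smul_imD]
  right_inv x := by
    refine Prod.ext (Subtype.ext ?_) (Subtype.ext ?_)
    · change reD P.β (reD P.β x.1.1 + Complex.I • reD P.β x.2.1)
        + Complex.I • reD P.β (imD P.β x.1.1 + Complex.I • imD P.β x.2.1) = x.1.1
      rw [reD_reD_add_I_smul, ← reD_imD x.1.1, ← reD_imD x.2.1, reD_reD_add_I_smul, reD_imD,
        reD_add_I_smul_imD]
    · change imD P.β (reD P.β x.1.1 + Complex.I • reD P.β x.2.1)
        + Complex.I • imD P.β (imD P.β x.1.1 + Complex.I • imD P.β x.2.1) = x.2.1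
      rw [imD_reD_add_I_smul, ← reD_imD x.1.1, ← reD_imD x.2.1, imD_reD_add_I_smul, reD_imD,
        reD_add_I_smul_imD]

/-- Infinite cardinals satisfy 2c = c. The infinite case is needed because multiplicities are not
known to be finite when the kernels are compared. -/
theorem cardinal_two_mul_cancel {a b : Cardinal} (h : 2 * a = 2 * b) : a = b := by
  have key : ∀ c : Cardinal, Cardinal.aleph0 ≤ c → 2 * c = c := fun c hc =>
    Cardinal.mul_eq_right hc ((Cardinal.natCast_lt_aleph0 (n := 2)).le.trans hc) two_ne_zero
  have fin : ∀ c : Cardinal, c < Cardinal.aleph0 → 2 * c < Cardinal.aleph0 := fun c hc =>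
    Cardinal.mul_lt_aleph0 (Cardinal.natCast_lt_aleph0 (n := 2)) hc
  rcases lt_or_ge a Cardinal.aleph0 with ha | ha <;> rcases lt_or_ge b Cardinal.aleph0 with hb | hb
  · obtain ⟨m, rfl⟩ := Cardinal.lt_aleph0.1 ha
    obtain ⟨n, rfl⟩ := Cardinal.lt_aleph0.1 hb
    norm_cast at h ⊢
    omega
  · exact absurd (fin a ha) (not_lt.2 (by rw [h, key b hb]; exact hb))
  · exact absurd (fin b hb) (not_lt.2 (by rw [← h, key a ha]; exact ha))
  · rwa [key a ha, key b hb] at h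

/-- Multiplicities for the matrix operator are the sums of those for `L_β^±`. -/
theorem rank_opKer_matrixOp {t : ℝ} (ht : t ≠ 1) :
    Module.rank ℝ (opKer (matrixOp P) t) =
      Module.rank ℂ (opKer (schrodinger P.β (boundedPart P P.p)) ((bigLambda P t : ℝ) : ℂ)) +
      Module.rank ℂ (opKer (schrodinger P.β (boundedPart P 1)) ((bigLambda P t : ℝ) : ℂ)) := by
  rw [(opKerMatrixEquiv P ht).rank_eq]
  have h := (reducedKerProdEquiv P (bigLambda P t)).rank_eq
  -- Real dimension is twice the complex one, which matches the two copies of the reduced kernel;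
  -- the factor 2 then cancels.
  have e : ∀ κ : ℝ, Module.rank ℝ (schrKer P κ (bigLambda P t))
      = 2 * Module.rank ℂ (schrKer P κ (bigLambda P t)) := fun κ => by
    rw [← Complex.rank_real_complex, rank_mul_rank]
  rw [rank_prod', rank_prod', e, e, ← mul_add, ← two_mul] at h
  exact cardinal_two_mul_cancel h

end

/-! ### Essential spectrum -/

section
-- Once isolated spectral points are eigenvalues, the essential spectrum is described by two
-- conditions, and each passes through Λ separately.
theorem mem_opEssentialSpectrum_iff {𝕜 E : Type*} [RCLike 𝕜] [NormedAddCommGroup E]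
    [NormedSpace 𝕜 E] [CompleteSpace E] {A : E →ₗ.[𝕜] E} {z : 𝕜}
    (h : z ∈ opSpectrum A → ¬ AccPt z (𝓟 (opSpectrum A)) → opKer A z ≠ ⊥) :
    z ∈ opEssentialSpectrum A ↔
      AccPt z (𝓟 (opSpectrum A)) ∨ Cardinal.aleph0 ≤ Module.rank 𝕜 (opKer A z) := by
  have hfin : FiniteDimensional 𝕜 (opKer A z) ↔ Module.rank 𝕜 (opKer A z) < Cardinal.aleph0 :=
    Module.rank_lt_aleph0_iff.symm
  have hbot : Cardinal.aleph0 ≤ Module.rank 𝕜 (opKer A z) → opKer A z ≠ ⊥ := by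
    intro h1 h2
    rw [h2, rank_bot] at h1
    exact absurd h1 (not_le.2 Cardinal.aleph0_pos)
  rw [opEssentialSpectrum, opDiscreteSpectrum, Set.mem_sdiff, Set.mem_ofPred_eq, hfin, ← not_le]
  constructor
  · rintro ⟨h1, h2⟩
    by_contra! h3
    exact h2 ⟨h1, h3.1, h h1 h3.1, not_le.2 h3.2⟩
  · rintro (h1 | h1)
    · exact ⟨mem_opSpectrum_of_accPt h1, fun h2 => h2.2.1 h1⟩
    · exact ⟨mem_opSpectrum_of_opKer_ne_bot (hbot h1), fun h2 => h2.2.2.2 h1⟩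

variable (P : Params)

theorem hasStrictDerivAt_bigLambda {t : ℝ} (ht : t ≠ 1) :
    HasStrictDerivAt (bigLambda P) (1 + P.ω ^ 2 / (1 - t) ^ 2) t := by
  have ht' : 1 - t ≠ 0 := sub_ne_zero.2 ht.symm
  have h2 := (hasStrictDerivAt_id t).add (((hasStrictDerivAt_id t).mul_const (P.ω ^ 2)).div
    ((hasStrictDerivAt_id t).const_sub 1) ht')
  refine HasStrictDerivAt.congr_deriv (f' := _) h2 ?_
  simp only [id]
  field_simp
  ring

theorem bigLambda_deriv_pos (t : ℝ) : 0 < 1 + P.ω ^ 2 / (1 - t) ^ 2 := by positivity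

/-- Λ has nonvanishing strict derivative, so it is locally injective and maps neighbourhoods of t
onto neighbourhoods of Λ(t). -/
theorem accPt_matrixOp_iff {t : ℝ} (ht : t ≠ 1) :
    AccPt t (𝓟 (opSpectrum (matrixOp P))) ↔
      AccPt ((bigLambda P t : ℝ) : ℂ) (𝓟 (opSpectrum (schrodinger P.β (boundedPart P P.p)))) ∨
      AccPt ((bigLambda P t : ℝ) : ℂ) (𝓟 (opSpectrum (schrodinger P.β (boundedPart P 1)))) := by
  rw [← accPt_sup, sup_principal, accPt_iff_frequently, accPt_iff_frequently]
  set S := opSpectrum (schrodinger P.β (boundedPart P P.p)) ∪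
    opSpectrum (schrodinger P.β (boundedPart P 1)) with hS
  have hd := hasStrictDerivAt_bigLambda P ht
  have hd0 := (bigLambda_deriv_pos P t).ne'
  have hne1 : ∀ᶠ y in 𝓝 t, y ≠ 1 := isOpen_ne.mem_nhds ht
  constructor
  · intro h
    have hne : ∀ᶠ y in 𝓝 t, y ≠ t → bigLambda P y ≠ bigLambda P t :=
      eventually_nhdsWithin_iff.1 (hd.hasDerivAt.eventually_ne hd0)
    have hc : Tendsto (fun y => ((bigLambda P y : ℝ) : ℂ)) (𝓝 t) (𝓝 ((bigLambda P t : ℝ) : ℂ)) :=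
      (Complex.continuous_ofReal.tendsto _).comp hd.hasDerivAt.continuousAt
    refine hc.frequently ((h.and_eventually (hne.and hne1)).mono ?_)
    rintro y ⟨⟨h1, h2⟩, h3, h4⟩
    exact ⟨fun h => h3 h1 (Complex.ofReal_injective h), (mem_opSpectrum_matrixOp_iff P h4).1 h2⟩
  · intro h
    -- Accumulation takes place in ℂ, but the spectra of L_β^± are real, so it already happens along
    -- ℝ, where Λ can be inverted.
    have hre : ∃ᶠ s in 𝓝 (bigLambda P t), s ≠ bigLambda P t ∧ (s : ℂ) ∈ S := by
      have hc : Tendsto Complex.re (𝓝 ((bigLambda P t : ℝ) : ℂ)) (𝓝 (bigLambda P t)) :=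
        Complex.continuous_re.tendsto' _ _ (Complex.ofReal_re _)
      refine hc.frequently (h.mono ?_)
      rintro z ⟨h1, h2⟩
      have him : z.im = 0 := by
        rcases h2 with h2 | h2
        · exact im_eq_zero_of_mem_opSpectrum_schrodinger P _ h2
        · exact im_eq_zero_of_mem_opSpectrum_schrodinger P _ h2
      have hz : ((z.re : ℝ) : ℂ) = z := Complex.ext rfl (by simp [him])
      refine ⟨fun h => h1 ?_, hz.symm ▸ h2⟩
      rw [← hz, h]
    rw [← hd.map_nhds_eq hd0, frequently_map] at hre
    refine (hre.and_eventually hne1).mono ?_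
    rintro y ⟨⟨h1, h2⟩, h3⟩
    exact ⟨fun h => h1 (by rw [h]), (mem_opSpectrum_matrixOp_iff P h3).2 h2⟩

/-- The essential spectrum of the matrix operator is the preimage of those of `L_β^±`. -/
theorem mem_opEssentialSpectrum_matrixOp_iff {t : ℝ} (ht : t ≠ 1) :
    t ∈ opEssentialSpectrum (matrixOp P) ↔ ((bigLambda P t : ℝ) : ℂ) ∈
      opEssentialSpectrum (schrodinger P.β (boundedPart P P.p)) ∪
        opEssentialSpectrum (schrodinger P.β (boundedPart P 1)) := by
  have hrank := rank_opKer_matrixOp P ht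
  have hbot : ∀ κ, opKer (schrodinger P.β (boundedPart P κ)) ((bigLambda P t : ℝ) : ℂ) ≠ ⊥ →
      Module.rank ℂ (opKer (schrodinger P.β (boundedPart P κ)) ((bigLambda P t : ℝ) : ℂ)) ≠ 0 :=
    fun κ h h' => h (Submodule.rank_eq_zero.1 h')
  -- That isolated spectral points of the matrix operator are eigenvalues is imported from L_β^±: if
  -- t is isolated, so is Λ(t) in the spectrum containing it, and the rank formula pulls its
  -- eigenvector back.
  have hker : t ∈ opSpectrum (matrixOp P) → ¬ AccPt t (𝓟 (opSpectrum (matrixOp P))) →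
      opKer (matrixOp P) t ≠ ⊥ := by
    intro h1 h2 h3
    rw [h3, rank_bot] at hrank
    obtain ⟨r1, r2⟩ := add_eq_zero.1 hrank.symm
    rw [accPt_matrixOp_iff P ht, not_or] at h2
    rcases (mem_opSpectrum_matrixOp_iff P ht).1 h1 with h4 | h4
    · exact hbot _ (opKer_schrodinger_ne_bot P _ h4 h2.1) r1
    · exact hbot _ (opKer_schrodinger_ne_bot P _ h4 h2.2) r2
  rw [mem_opEssentialSpectrum_iff hker, Set.mem_union,
    mem_opEssentialSpectrum_iff (opKer_schrodinger_ne_bot P _),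
    mem_opEssentialSpectrum_iff (opKer_schrodinger_ne_bot P _), accPt_matrixOp_iff P ht, hrank,
    Cardinal.aleph0_le_add_iff]
  tauto

/-! ### The map `Λ` on the negative half line -/

theorem bigLambda_neg {t : ℝ} (ht : t < 0) : bigLambda P t < 0 := by
  have h1 : t * P.ω ^ 2 / (1 - t) ≤ 0 :=
    div_nonpos_of_nonpos_of_nonneg (mul_nonpos_of_nonpos_of_nonneg ht.le (sq_nonneg _))
      (by linarith)
  unfold bigLambda
  linarith

theorem bigLambda_injOn : Set.InjOn (bigLambda P) (Set.Iio 0) := by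
  intro a ha b hb h
  have ha' : (a : ℝ) < 0 := ha
  have hb' : (b : ℝ) < 0 := hb
  have h1 : 0 < (1 - a) * (1 - b) := mul_pos (by linarith) (by linarith)
  have ea : 1 - a ≠ 0 := by linarith
  have eb : 1 - b ≠ 0 := by linarith
  -- Clearing denominators in Λ(a) = Λ(b); the second factor is positive for negative a and b.
  have h2 : (a - b) * ((1 - a) * (1 - b) + P.ω ^ 2) = 0 := by
    unfold bigLambda at h
    field_simp at h
    linear_combination h
  rcases mul_eq_zero.1 h2 with h3 | h3
  · linarith
  · nlinarith [sq_nonneg P.ω]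

theorem exists_bigLambda_eq {s : ℝ} (hs : s < 0) : ∃ t < 0, bigLambda P t = s := by
  -- Λ(t) = s amounts to t² - (1 + ω² + s)t + s = 0. The product of the roots is s < 0, so exactly
  -- one root is negative.
  set b := 1 + P.ω ^ 2 + s with hb
  have hD : 0 < b ^ 2 - 4 * s := by nlinarith [sq_nonneg b]
  have hr := Real.sq_sqrt hD.le
  have hr0 := Real.sqrt_nonneg (b ^ 2 - 4 * s)
  set r := √(b ^ 2 - 4 * s) with hrdef
  have ht : (b - r) / 2 < 0 := by
    have : b < r := by
      by_contra! h
      nlinarith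
    linarith
  refine ⟨(b - r) / 2, ht, ?_⟩
  have h1 : 1 - (b - r) / 2 ≠ 0 := by linarith
  unfold bigLambda
  rw [← sub_eq_zero]
  set t := (b - r) / 2 with htdef
  have hq : t ^ 2 - b * t + s = 0 := by
    have : r = b - 2 * t := by rw [htdef]; ring
    rw [this] at hr
    linarith
  field_simp
  rw [hb] at hq
  linear_combination -hq

/-- The bijection of the negative half line given by `Λ`. -/
def bigLambdaEquiv : Set.Iio (0 : ℝ) ≃ Set.Iio (0 : ℝ) :=
  Equiv.ofBijective (fun t => ⟨bigLambda P t, bigLambda_neg P t.2⟩)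
    ⟨fun a b h => Subtype.ext (bigLambda_injOn P a.2 b.2 (congrArg Subtype.val h)),
      fun s => by
        obtain ⟨t, ht, e⟩ := exists_bigLambda_eq P s.2
        exact ⟨⟨t, ht⟩, Subtype.ext e⟩⟩

theorem cardinal_sum_comp_equiv {ι ι' : Type} (e : ι ≃ ι') (f : ι' → Cardinal) :
    Cardinal.sum (fun i => f (e i)) = Cardinal.sum f :=
  Cardinal.mk_congr (Equiv.sigmaCongrLeft (β := fun i => (f i).out) e)

/-- Sum the rank formula over t < 0 and reindex by the bijection Λ of the negative half line. -/
theorem negEigenvalueCount_matrixOp : negEigenvalueCount (matrixOp P)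
    = negEigenvalueCount (schrodinger P.β (boundedPart P P.p)) +
      negEigenvalueCount (schrodinger P.β (boundedPart P 1)) := by
  unfold negEigenvalueCount
  rw [← Cardinal.sum_add_distrib']
  refine Eq.trans ?_ (cardinal_sum_comp_equiv (bigLambdaEquiv P) _)
  congr 1
  funext t
  have ht : (t : ℝ) < 0 := t.2
  exact rank_opKer_matrixOp P (ht.trans one_pos).ne

end

section
variable (P : Params)

/-! ### The quadratic form of the Hessian -/

theorem inner_real_mulPotential (u v : L2) :
    inner ℝ (mulPotential P u) v = inner ℝ u (mulPotential P v) := by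
  rw [inner_real_eq_re, inner_real_eq_re, inner_mulPotential]

theorem inner_reL2 (u v : L2) : inner ℝ (reL2 u) v = inner ℝ u (reL2 v) := by
  rw [inner_real_eq, inner_real_eq]
  refine integral_congr_ae ?_
  filter_upwards [reL2_ae u, reL2_ae v] with x h1 h2
  rw [h1, h2, Complex.inner, Complex.inner]
  simp

theorem inner_mulIω (u v : L2) : inner ℝ (mulIω P u) v = -inner ℝ u (mulIω P v) := by
  change inner ℝ ((Complex.I * P.ω) • u) v = -inner ℝ u ((Complex.I * P.ω) • v)
  rw [inner_real_eq_re, inner_real_eq_re, inner_smul_left, inner_smul_right, map_mul,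
    Complex.conj_I, Complex.conj_ofReal, neg_mul, neg_mul, Complex.neg_re]

theorem norm_mulIω (u : L2) : ‖mulIω P u‖ = |P.ω| * ‖u‖ := by
  change ‖(Complex.I * P.ω) • u‖ = _
  rw [norm_smul, norm_mul, Complex.norm_I, one_mul, Complex.norm_real, Real.norm_eq_abs]

/-- The map `u ↦ m² u - φ_β^{p-1} u - (p-1) φ_β^{p-1} Re u` on `L²`. -/
def zerothOrder : L2 →L[ℝ] L2 :=
  (((P.m ^ 2 : ℝ) : ℂ) • ContinuousLinearMap.id ℂ L2 - mulPotential P).restrictScalars ℝ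
    - ((((P.p - 1 : ℝ) : ℂ) • mulPotential P).restrictScalars ℝ).comp reL2

theorem zerothOrder_apply (u : L2) : zerothOrder P u = P.m ^ 2 • u - mulPotential P u
    - (P.p - 1) • mulPotential P (reL2 u) := by
  rw [real_smul_eq, real_smul_eq]; rfl

theorem inner_zerothOrder (u v : L2) :
    inner ℝ (zerothOrder P u) v = inner ℝ u (zerothOrder P v) := by
  rw [zerothOrder_apply, zerothOrder_apply, inner_sub_left, inner_sub_left, inner_sub_right,
    inner_sub_right, real_inner_smul_left, real_inner_smul_left, real_inner_smul_right,
    real_inner_smul_right, inner_real_mulPotential, inner_real_mulPotential P (reL2 u), inner_reL2,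
    reL2_mulPotential]

theorem hessian_eq (U W : EnergySpace) : hessian P U W
    = inner ℝ (H1.deriv U.fst) (H1.deriv W.fst) + P.β * inner ℝ (H1.rep U.fst 0) (H1.rep W.fst 0)
      + inner ℝ (zerothOrder P (H1.toL2 U.fst) + mulIω P U.snd) (H1.toL2 W.fst)
      + inner ℝ (U.snd - mulIω P (H1.toL2 U.fst)) W.snd := by
  have h : hessian P U W = inner ℝ (H1.deriv U.fst) (H1.deriv W.fst)
      + inner ℝ (zerothOrder P (H1.toL2 U.fst) + mulIω P U.snd) (H1.toL2 W.fst)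
      + P.β * inner ℝ (H1.rep U.fst 0) (H1.rep W.fst 0)
      + inner ℝ (U.snd - mulIω P (H1.toL2 U.fst)) W.snd := rfl
  rw [h]; ring

/-- Multiplication by iω is skew, so the off-diagonal entries iω and -iω are adjoint to each other.
-/
theorem hessian_comm (U W : EnergySpace) : hessian P U W = hessian P W U := by
  rw [hessian_eq, hessian_eq, inner_add_left, inner_add_left, inner_sub_left, inner_sub_left,
    inner_zerothOrder, real_inner_comm (H1.deriv U.fst), real_inner_comm (H1.rep U.fst 0),
    real_inner_comm (H1.toL2 U.fst) (zerothOrder P _), inner_mulIω, inner_mulIω P (H1.toL2 U.fst),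
    real_inner_comm U.snd W.snd, real_inner_comm U.snd (mulIω P _),
    real_inner_comm (H1.toL2 U.fst) (mulIω P _)]
  ring

theorem inner_hessianOp_comm (U W : EnergySpace) :
    inner ℝ (hessianOp P U) W = inner ℝ U (hessianOp P W) := by
  rw [inner_hessianOp, hessian_comm, ← inner_hessianOp, real_inner_comm]

/-- Completing the square in v costs ω²‖u‖², which turns the mass m² into m² - ω². -/
theorem hessian_self (U : EnergySpace) : hessian P U U
    = ‖H1.deriv U.fst‖ ^ 2 + P.β * ‖H1.rep U.fst 0‖ ^ 2
      + (inner ℝ (zerothOrder P (H1.toL2 U.fst)) (H1.toL2 U.fst)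
        - P.ω ^ 2 * ‖H1.toL2 U.fst‖ ^ 2) + ‖U.snd - mulIω P (H1.toL2 U.fst)‖ ^ 2 := by
  rw [hessian_eq, real_inner_self_eq_norm_sq, real_inner_self_eq_norm_sq, inner_add_left,
    inner_sub_left, inner_mulIω, real_inner_self_eq_norm_sq, @norm_sub_sq_real, norm_mulIω, mul_pow,
    sq_abs, real_inner_comm U.snd (mulIω P _)]
  ring

/-- The embedding of the energy space into `L² × L²`. -/
def energyIncl : EnergySpace →L[ℝ] WithLp 2 (L2 × L2) :=
  (WithLp.prodContinuousLinearEquiv 2 ℝ L2 L2).symm ∘L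
    (H1.toL2 ∘L WithLp.fstL 2 ℝ H1 L2).prod (WithLp.sndL 2 ℝ H1 L2)

theorem energyIncl_apply (U : EnergySpace) :
    energyIncl U = WithLp.toLp 2 (H1.toL2 U.fst, U.snd) := rfl

theorem energyIncl_injective : Function.Injective energyIncl := by
  intro U V h
  have h1 : (energyIncl U).fst = (energyIncl V).fst := by rw [h]
  have h2 : (energyIncl U).snd = (energyIncl V).snd := by rw [h]
  exact WithLp.ofLp_injective 2 (Prod.ext (H1.toL2_injective h1) h2)

theorem norm_sq_energyIncl (U : EnergySpace) :
    ‖energyIncl U‖ ^ 2 = ‖H1.toL2 U.fst‖ ^ 2 + ‖U.snd‖ ^ 2 := by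
  rw [WithLp.prod_norm_sq_eq_of_L2]; rfl

theorem norm_sq_energyIncl_le (U : EnergySpace) : ‖energyIncl U‖ ^ 2 ≤ ‖U‖ ^ 2 := by
  have h : ‖U‖ ^ 2 = ‖U.fst‖ ^ 2 + ‖U.snd‖ ^ 2 := WithLp.prod_norm_sq_eq_of_L2 _
  rw [norm_sq_energyIncl, h, H1.norm_sq_eq]
  nlinarith [sq_nonneg ‖H1.deriv U.fst‖]

/-- A Gårding inequality relative to the L² × L² norm. The constant contains ω² twice: once from the
completed square, once from estimating ‖v - iωu‖² below by ‖v‖²/2. -/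
theorem exists_hessian_coercive : ∃ c : ℝ, 0 ≤ c ∧ ∀ U : EnergySpace,
    1 / 2 * ‖U‖ ^ 2 ≤ hessian P U U + c * ‖energyIncl U‖ ^ 2 := by
  obtain ⟨k, hk⟩ := exists_lower_bound P.β (zerothOrder P)
  refine ⟨|k| + 2 * P.ω ^ 2, by positivity, fun U => ?_⟩
  have h1 := hk U.fst
  have h2 : ‖U.snd - mulIω P (H1.toL2 U.fst)‖ ^ 2
      ≥ 1 / 2 * ‖U.snd‖ ^ 2 - P.ω ^ 2 * ‖H1.toL2 U.fst‖ ^ 2 := by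
    have h3 := norm_sub_norm_le U.snd (mulIω P (H1.toL2 U.fst))
    have h4 := norm_mulIω P (H1.toL2 U.fst)
    have h5 : P.ω ^ 2 * ‖H1.toL2 U.fst‖ ^ 2 = ‖mulIω P (H1.toL2 U.fst)‖ ^ 2 := by
      rw [h4, mul_pow, sq_abs]
    have h6 : ‖U.snd‖ ≤ ‖U.snd - mulIω P (H1.toL2 U.fst)‖ + ‖mulIω P (H1.toL2 U.fst)‖ := by linarith
    have h7 := pow_le_pow_left₀ (norm_nonneg _) h6 2
    rw [h5]
    nlinarith [sq_nonneg (‖U.snd - mulIω P (H1.toL2 U.fst)‖ - ‖mulIω P (H1.toL2 U.fst)‖)]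
  have h8 : ‖U‖ ^ 2 = ‖U.fst‖ ^ 2 + ‖U.snd‖ ^ 2 := WithLp.prod_norm_sq_eq_of_L2 _
  rw [hessian_self, norm_sq_energyIncl, h8]
  have h9 := le_abs_self k
  have h10 := mul_le_mul_of_nonneg_right h9 (sq_nonneg ‖H1.toL2 U.fst‖)
  have h11 : 0 ≤ (|k| + 2 * P.ω ^ 2) * ‖U.snd‖ ^ 2 := by positivity
  linarith

/-! ### The Hessian and the matrix operator -/

theorem matrixOp_apply_energyIncl {U : EnergySpace} (h : H1.toL2 U.fst ∈ deltaDomain P.β) :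
    matrixOp P ⟨energyIncl U, h⟩ = WithLp.toLp 2
      (-secondDeriv P.β ⟨H1.toL2 U.fst, h⟩ + (zerothOrder P (H1.toL2 U.fst) + mulIω P U.snd),
        U.snd - mulIω P (H1.toL2 U.fst)) := by
  rw [matrixOp_apply, zerothOrder_apply, real_smul_eq, real_smul_eq]
  refine congrArg (WithLp.toLp 2) (Prod.ext ?_ rfl)
  change -secondDeriv P.β ⟨H1.toL2 U.fst, h⟩ + ((P.m ^ 2 : ℝ) : ℂ) • H1.toL2 U.fst
      - mulPotential P (H1.toL2 U.fst) - ((P.p - 1 : ℝ) : ℂ) • mulPotential P (reL2 (H1.toL2 U.fst))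
      + mulIω P U.snd = -secondDeriv P.β ⟨H1.toL2 U.fst, h⟩ + (_ + mulIω P U.snd)
  abel

/-- The Hessian represents the matrix operator. -/
theorem hessian_eq_inner_iff (U : EnergySpace) (F : WithLp 2 (L2 × L2)) :
    (∀ W, hessian P U W = inner ℝ F (energyIncl W)) ↔
      ∃ h : energyIncl U ∈ (matrixOp P).domain, matrixOp P ⟨energyIncl U, h⟩ = F := by
  constructor
  · intro h
    obtain ⟨hu, e⟩ := mem_deltaDomain_of_form (β := P.β) (u := U.fst)
      (f := F.fst - (zerothOrder P (H1.toL2 U.fst) + mulIω P U.snd)) (fun w => by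
        have h1 := h (WithLp.toLp 2 (w, 0))
        rw [hessian_eq, energyIncl_apply, WithLp.prod_inner_apply] at h1
        change inner ℝ (H1.deriv U.fst) (H1.deriv w) + P.β * inner ℝ (H1.rep U.fst 0) (H1.rep w 0)
          + inner ℝ (zerothOrder P (H1.toL2 U.fst) + mulIω P U.snd) (H1.toL2 w)
          + inner ℝ (U.snd - mulIω P (H1.toL2 U.fst)) (0 : L2)
          = inner ℝ F.fst (H1.toL2 w) + inner ℝ F.snd (0 : L2) at h1
        rw [inner_zero_right, inner_zero_right] at h1
        rw [inner_sub_left]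
        linarith)
    refine ⟨hu, ?_⟩
    rw [matrixOp_apply_energyIncl P hu, e]
    refine WithLp.ofLp_injective 2 (Prod.ext ?_ ?_)
    · change - -(F.fst - _) + _ = F.fst
      rw [neg_neg, sub_add_cancel]
    · refine ext_inner_right ℝ fun z => ?_
      have h1 := h (WithLp.toLp 2 (0, z))
      rw [hessian_eq, energyIncl_apply, WithLp.prod_inner_apply] at h1
      change inner ℝ (H1.deriv U.fst) (H1.deriv 0)
        + P.β * inner ℝ (H1.rep U.fst 0) (H1.evalZero 0)
        + inner ℝ (zerothOrder P (H1.toL2 U.fst) + mulIω P U.snd) (H1.toL2 0)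
        + inner ℝ (U.snd - mulIω P (H1.toL2 U.fst)) z
        = inner ℝ F.fst (H1.toL2 0) + inner ℝ F.snd z at h1
      rw [map_zero, map_zero, map_zero, inner_zero_right, inner_zero_right, inner_zero_right,
        inner_zero_right, mul_zero, zero_add, zero_add, zero_add, zero_add] at h1
      exact h1
  · rintro ⟨h', rfl⟩ W
    have h : H1.toL2 U.fst ∈ deltaDomain P.β := h'
    obtain ⟨V, hV, e⟩ := exists_H1_of_mem_deltaDomain (⟨H1.toL2 U.fst, h⟩ : deltaDomain P.β)
    obtain rfl : V = U.fst := H1.toL2_injective hV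
    rw [matrixOp_apply_energyIncl P h, energyIncl_apply W, WithLp.prod_inner_apply, hessian_eq, e]
    change _ = inner ℝ (-secondDeriv P.β ⟨H1.toL2 U.fst, h⟩
      + (zerothOrder P (H1.toL2 U.fst) + mulIω P U.snd)) (H1.toL2 W.fst)
      + inner ℝ (U.snd - mulIω P (H1.toL2 U.fst)) W.snd
    rw [← inner_neg_left, ← inner_add_left]

/-- The Gram operator of the inner product of `L² × L²` on the energy space. -/
def energyGram : EnergySpace →L[ℝ] EnergySpace := energyIncl.adjoint ∘L energyIncl

theorem inner_energyGram (U W : EnergySpace) :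
    inner ℝ (energyGram U) W = inner ℝ (energyIncl U) (energyIncl W) :=
  ContinuousLinearMap.adjoint_inner_left energyIncl W (energyIncl U)

theorem mem_ker_hessianOp_sub_iff {K : EnergySpace →L[ℝ] EnergySpace} {t : ℝ} {U : EnergySpace} :
    U ∈ LinearMap.ker ((hessianOp P - t • K : EnergySpace →L[ℝ] EnergySpace) :
      EnergySpace →ₗ[ℝ] EnergySpace) ↔ hessianOp P U = t • K U := by
  exact Iff.trans Iff.rfl sub_eq_zero

/-- Eigenvectors of 𝓛_β are those of the pencil of the Hessian against the L² × L² Gram operator,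
whereas L̃_β'' is the pencil against the identity of 𝓗. -/
theorem mem_ker_energyGram_iff {t : ℝ} {U : EnergySpace} :
    U ∈ LinearMap.ker ((hessianOp P - t • energyGram : EnergySpace →L[ℝ] EnergySpace) :
      EnergySpace →ₗ[ℝ] EnergySpace) ↔
    ∃ h : energyIncl U ∈ (matrixOp P).domain,
      (⟨energyIncl U, h⟩ : (matrixOp P).domain) ∈ opKer (matrixOp P) t := by
  rw [mem_ker_hessianOp_sub_iff]
  simp only [mem_opKer]
  refine Iff.trans ?_ (hessian_eq_inner_iff P U (t • energyIncl U))
  constructor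
  · intro h W
    rw [← inner_hessianOp, h, real_inner_smul_left (F := EnergySpace),
      real_inner_smul_left, inner_energyGram]
  · intro h
    refine ext_inner_right ℝ fun W => ?_
    rw [inner_hessianOp, h, real_inner_smul_left,
      real_inner_smul_left (F := EnergySpace), inner_energyGram]

theorem exists_energyIncl_eq {F : WithLp 2 (L2 × L2)} (hF : F ∈ (matrixOp P).domain) :
    ∃ U, energyIncl U = F := by
  obtain ⟨U, hU, -⟩ := exists_H1_of_mem_deltaDomain (⟨F.fst, hF⟩ : deltaDomain P.β)
  exact ⟨WithLp.toLp 2 (U, F.snd), WithLp.ofLp_injective 2 (Prod.ext hU rfl)⟩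

/-- The embedding of the energy space maps the kernel of the pencil of the Hessian into that of the
matrix operator. -/
def kerEnergyGramMap (t : ℝ) :
    LinearMap.ker ((hessianOp P - t • energyGram : EnergySpace →L[ℝ] EnergySpace) :
      EnergySpace →ₗ[ℝ] EnergySpace) →ₗ[ℝ] opKer (matrixOp P) t where
  toFun U := ⟨⟨energyIncl U.1, ((mem_ker_energyGram_iff P).1 U.2).1⟩,
    ((mem_ker_energyGram_iff P).1 U.2).2⟩
  map_add' U V := Subtype.ext (Subtype.ext (map_add energyIncl U.1 V.1))
  map_smul' c U := Subtype.ext (Subtype.ext (map_smul energyIncl c U.1))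

theorem kerEnergyGramMap_bijective (t : ℝ) : Function.Bijective (kerEnergyGramMap P t) := by
  constructor
  · intro U V h
    have h1 : (kerEnergyGramMap P t U).1.1 = (kerEnergyGramMap P t V).1.1 := by rw [h]
    exact Subtype.ext (energyIncl_injective h1)
  · rintro ⟨⟨F, hF⟩, hV⟩
    obtain ⟨U, rfl⟩ := exists_energyIncl_eq P hF
    exact ⟨⟨U, (mem_ker_energyGram_iff P).2 ⟨hF, hV⟩⟩, rfl⟩

/-- The kernel of `L̃_β'' - t`. -/
def kerIdEquiv (t : ℝ) :
    LinearMap.ker ((hessianOp P - t • ContinuousLinearMap.id ℝ EnergySpace :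
      EnergySpace →L[ℝ] EnergySpace) : EnergySpace →ₗ[ℝ] EnergySpace)
      ≃ₗ[ℝ] opKer (hessianPMap P) t :=
  LinearEquiv.ofBijective
    { toFun := fun U => ⟨⟨U.1, trivial⟩, U.2⟩
      map_add' := fun _ _ => rfl
      map_smul' := fun _ _ => rfl }
    ⟨fun _ _ h => Subtype.ext (congrArg (fun x : opKer (hessianPMap P) t => (x.1.1 : EnergySpace)) h), fun V => ⟨⟨V.1.1, V.2⟩, rfl⟩⟩

end

section
/-! ### Nonnegativity of the Hessian on a subspace of finite codimension -/

theorem H1.rep_add (u v : H1) : H1.rep (u + v) = H1.rep u + H1.rep v := by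
  have h : H1.rep u + H1.rep v =ᵐ[volume] H1.toL2 (u + v) := by
    rw [map_add]
    exact ((H1.rep_ae_eq u).add (H1.rep_ae_eq v)).trans (Lp.coeFn_add _ _).symm
  exact H1.rep_unique (u + v) ((H1.rep_continuous u).add (H1.rep_continuous v)) h

theorem H1.rep_smul (c : ℝ) (u : H1) : H1.rep (c • u) = c • H1.rep u := by
  have h : c • H1.rep u =ᵐ[volume] H1.toL2 (c • u) := by
    rw [map_smul]
    exact ((H1.rep_ae_eq u).const_smul c).trans (Lp.coeFn_smul c (H1.toL2 u)).symm
  exact H1.rep_unique (c • u) ((H1.rep_continuous u).const_smul c) h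

theorem H1.norm_rep_le (u : H1) (x : ℝ) : ‖H1.rep u x‖ ≤ (2 + √(2 * |x|)) * ‖u‖ := by
  have h1 := H1.norm_rep_zero_le u
  have h2 := H1.norm_rep_sub_sq_le u (a := -|x|) (b := |x|) (x := x) (y := 0)
    ⟨neg_abs_le x, le_abs_self x⟩ ⟨by simp, by simp⟩
  have h3 := H1.intervalIntegral_deriv_sq_le u (a := -|x|) (b := |x|)
    (by linarith [abs_nonneg x])
  have h4 : ‖H1.deriv u‖ ^ 2 ≤ ‖u‖ ^ 2 := by
    rw [H1.norm_sq_eq]; nlinarith [sq_nonneg ‖H1.toL2 u‖]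
  have h5 : ‖H1.rep u x - H1.rep u 0‖ ≤ √(2 * |x|) * ‖u‖ := by
    refine le_of_sq_le_sq ?_ (by positivity)
    rw [mul_pow, Real.sq_sqrt (by positivity)]
    refine h2.trans ?_
    rw [sub_neg_eq_add, ← two_mul]
    exact mul_le_mul_of_nonneg_left (h3.trans h4) (by positivity)
  have h6 := norm_le_norm_add_norm_sub (H1.rep u 0) (H1.rep u x)
  rw [norm_sub_rev] at h6
  linarith

/-- The bounded functional `u ↦ u(x)` on `H¹(ℝ)`. -/
def H1.eval (x : ℝ) : H1 →L[ℝ] ℂ :=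
  LinearMap.mkContinuous
    { toFun := fun u => H1.rep u x
      map_add' := fun u v => congrFun (H1.rep_add u v) x
      map_smul' := fun c u => congrFun (H1.rep_smul c u) x }
    (2 + √(2 * |x|)) (fun u => H1.norm_rep_le u x)

/-- A bounded operator of finite rank vanishes on the orthogonal complement of a finite dimensional
subspace. -/
theorem exists_finiteDimensional_forall_orthogonal {H F : Type*} [NormedAddCommGroup H]
    [InnerProductSpace ℝ H] [CompleteSpace H] [NormedAddCommGroup F] [InnerProductSpace ℝ F]
    [FiniteDimensional ℝ F] (E : H →L[ℝ] F) :
    ∃ G : Submodule ℝ H, FiniteDimensional ℝ G ∧ ∀ x ∈ Gᗮ, E x = 0 := by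
  have := FiniteDimensional.complete ℝ F
  -- The kernel of E is the orthogonal complement of the range of its adjoint, which is finite
  -- dimensional.
  refine ⟨LinearMap.range (E.adjoint : F →ₗ[ℝ] H), inferInstance, fun x hx => ?_⟩
  have h := (Submodule.mem_orthogonal _ x).1 hx (E.adjoint (E x)) ⟨E x, rfl⟩
  rw [ContinuousLinearMap.adjoint_inner_left] at h
  exact inner_self_eq_zero.1 h

/-- Poincaré's inequality for functions vanishing on a mesh. -/
theorem H1.integral_rep_sq_le_of_mesh (u : H1) {a h : ℝ} (hh : 0 ≤ h) {n : ℕ}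
    (h0 : ∀ j < n, H1.rep u (a + j * h) = 0) :
    ∫ x in a..(a + n * h), ‖H1.rep u x‖ ^ 2 ≤ h ^ 2 * ‖H1.deriv u‖ ^ 2 := by
  have hd : ∀ b c : ℝ, IntervalIntegrable (fun x => ‖H1.deriv u x‖ ^ 2) volume b c := fun b c =>
    (integrable_norm_sq (H1.deriv u)).intervalIntegrable
  have e1 := intervalIntegral.sum_integral_adjacent_intervals (μ := volume)
    (f := fun x => ‖H1.rep u x‖ ^ 2) (a := fun j : ℕ => a + j * h) (n := n)
    fun k _ => H1.intervalIntegrable_rep_sq u _ _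
  have e2 := intervalIntegral.sum_integral_adjacent_intervals (μ := volume)
    (f := fun x => ‖H1.deriv u x‖ ^ 2) (a := fun j : ℕ => a + j * h) (n := n)
    fun k _ => hd _ _
  simp only [Nat.cast_zero, zero_mul, add_zero] at e1 e2
  rw [← e1]
  have h1 : 0 ≤ (n : ℝ) * h := by positivity
  refine le_trans ?_ (mul_le_mul_of_nonneg_left
    (H1.intervalIntegral_deriv_sq_le u (a := a) (b := a + n * h) (by linarith)) (sq_nonneg h))
  rw [← e2, Finset.mul_sum]
  refine Finset.sum_le_sum fun j hj => ?_
  have h2 := H1.integral_rep_sq_le u (a := a + j * h) (b := a + (j + 1 : ℕ) * h)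
    (by push_cast; nlinarith) (h0 j (Finset.mem_range.1 hj))
  refine h2.trans_eq ?_
  push_cast
  ring

variable (P : Params)

/-- The bound `(p+1)(m²-ω²)/2` of the potential. -/
theorem profile_rpow_le (x : ℝ) :
    profile P x ^ (P.p - 1) ≤ (P.p + 1) * (P.m ^ 2 - P.ω ^ 2) / 2 := by
  have h1 := sq_sub_sq_pos P
  have h2 := P.one_lt_p
  rw [profile_rpow]
  refine mul_le_of_le_one_right (by positivity) (pow_le_one₀ ?_ ?_)
  · have := Real.cosh_pos ((P.p - 1) * √(P.m ^ 2 - P.ω ^ 2) / 2 * |x| +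
      Real.artanh (-P.β / (2 * √(P.m ^ 2 - P.ω ^ 2))))
    positivity
  · rw [div_le_one (Real.cosh_pos _)]
    exact Real.one_le_cosh _

theorem profile_rpow_nonneg (x : ℝ) : 0 ≤ profile P x ^ (P.p - 1) := by
  have h1 := sq_sub_sq_pos P
  have h2 := P.one_lt_p
  rw [profile_rpow]
  positivity

/-- The potential is small at infinity. -/
theorem exists_potential_le : ∃ R : ℝ, 0 < R ∧ ∀ x : ℝ, R ≤ |x| →
    P.p * profile P x ^ (P.p - 1) ≤ P.m ^ 2 - P.ω ^ 2 := by
  have h1 := sq_sub_sq_pos P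
  have h2 := P.one_lt_p
  set c := (P.p - 1) * √(P.m ^ 2 - P.ω ^ 2) / 2 with hc
  set d := Real.artanh (-P.β / (2 * √(P.m ^ 2 - P.ω ^ 2))) with hd
  have hc0 : 0 < c := by
    have := Real.sqrt_pos.2 h1
    have := sub_pos.2 h2
    positivity
  set M := P.p * (P.p + 1) / 2 with hM
  have hM1 : 1 ≤ M := by rw [hM]; nlinarith
  -- With M = p(p+1)/2 the claim is cosh² ≥ M. As M ≥ 1, cosh ≥ M suffices, and cosh y ≥ (y + 1)/2
  -- gives this once y = c|x| + d ≥ 2M.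
  refine ⟨(2 * M + |d|) / c, by positivity, fun x hx => ?_⟩
  rw [div_le_iff₀ hc0] at hx
  have h3 : 2 * M ≤ c * |x| + d := by
    have := neg_abs_le d
    linarith
  have h4 : M ≤ Real.cosh (c * |x| + d) := by
    rw [Real.cosh_eq]
    have h5 := Real.add_one_le_exp (c * |x| + d)
    have h6 := Real.exp_pos (-(c * |x| + d))
    linarith
  rw [profile_rpow, ← hc, ← hd]
  have h7 : M * (1 / Real.cosh (c * |x| + d)) ^ 2 ≤ 1 := by
    rw [div_pow, one_pow, mul_one_div, div_le_one (by positivity)]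
    nlinarith
  calc P.p * ((P.p + 1) * (P.m ^ 2 - P.ω ^ 2) / 2 * (1 / Real.cosh (c * |x| + d)) ^ 2)
      = (P.m ^ 2 - P.ω ^ 2) * (M * (1 / Real.cosh (c * |x| + d)) ^ 2) := by rw [hM]; ring
    _ ≤ P.m ^ 2 - P.ω ^ 2 := mul_le_of_le_one_right h1.le h7

/-- Pointwise the integrand is at least (m² - ω² - pφ_β^{p-1})|u|²: nonnegative outside [-R, R], and
bounded below by the maximum of the potential inside. -/
theorem zerothOrder_form_ge {R : ℝ} (hR : 0 < R)
    (hV : ∀ x : ℝ, R ≤ |x| → P.p * profile P x ^ (P.p - 1) ≤ P.m ^ 2 - P.ω ^ 2) (u : H1) :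
    -(P.p * ((P.p + 1) * (P.m ^ 2 - P.ω ^ 2) / 2) * ∫ x in (-R)..R, ‖H1.rep u x‖ ^ 2)
      ≤ inner ℝ (zerothOrder P (H1.toL2 u)) (H1.toL2 u) - P.ω ^ 2 * ‖H1.toL2 u‖ ^ 2 := by
  have hp := P.one_lt_p
  have ha := sq_sub_sq_pos P
  set C := P.p * ((P.p + 1) * (P.m ^ 2 - P.ω ^ 2) / 2) with hC
  set v := H1.toL2 u with hv
  have e : inner ℝ (zerothOrder P v) v - P.ω ^ 2 * ‖v‖ ^ 2
      = inner ℝ (zerothOrder P v - P.ω ^ 2 • v) v := by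
    rw [inner_sub_left, real_inner_smul_left, real_inner_self_eq_norm_sq]
  have e2 : zerothOrder P v - P.ω ^ 2 • v = ((P.m ^ 2 - P.ω ^ 2 : ℝ) : ℂ) • v - mulPotential P v
      - ((P.p - 1 : ℝ) : ℂ) • mulPotential P (reL2 v) := by
    rw [zerothOrder_apply, ← real_smul_eq, ← real_smul_eq]
    module
  have e3 : -(C * ∫ x in (-R)..R, ‖H1.rep u x‖ ^ 2)
      = ∫ x, (Set.Ioc (-R) R).indicator (fun x => -(C * ‖H1.rep u x‖ ^ 2)) x := by
    rw [integral_indicator measurableSet_Ioc, intervalIntegral.integral_of_le (by linarith),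
      integral_neg, integral_const_mul]
  rw [e, e2, inner_real_eq, e3]
  refine integral_mono_ae
    (((H1.integrable_rep_sq u).const_mul C).neg.indicator measurableSet_Ioc)
    (integrable_inner_real _ _) ?_
  filter_upwards [H1.rep_ae_eq u, Lp.coeFn_sub (((P.m ^ 2 - P.ω ^ 2 : ℝ) : ℂ) • v
      - mulPotential P v) (((P.p - 1 : ℝ) : ℂ) • mulPotential P (reL2 v)),
    Lp.coeFn_sub (((P.m ^ 2 - P.ω ^ 2 : ℝ) : ℂ) • v) (mulPotential P v),
    Lp.coeFn_smul ((P.m ^ 2 - P.ω ^ 2 : ℝ) : ℂ) v,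
    Lp.coeFn_smul ((P.p - 1 : ℝ) : ℂ) (mulPotential P (reL2 v)), mulPotential_ae P v,
    mulPotential_ae P (reL2 v), reL2_ae v] with x h1 h2 h3 h4 h5 h6 h7 h8
  have e4 : inner ℝ ((((P.m ^ 2 - P.ω ^ 2 : ℝ) : ℂ) • v - mulPotential P v
      - ((P.p - 1 : ℝ) : ℂ) • mulPotential P (reL2 v) : L2) x) (v x)
      = (P.m ^ 2 - P.ω ^ 2 - profile P x ^ (P.p - 1)) * ((v x).re ^ 2 + (v x).im ^ 2)
        - (P.p - 1) * profile P x ^ (P.p - 1) * (v x).re ^ 2 := by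
    rw [h2, Pi.sub_apply, h3, Pi.sub_apply, h4, h5, Pi.smul_apply, Pi.smul_apply, h6, h7, h8,
      inner_eq_re_add_im]
    simp only [smul_eq_mul, Complex.sub_re, Complex.sub_im, Complex.re_ofReal_mul,
      Complex.im_ofReal_mul, Complex.ofReal_re, Complex.ofReal_im]
    ring
  have e5 : ‖H1.rep u x‖ ^ 2 = (v x).re ^ 2 + (v x).im ^ 2 := by
    rw [h1, Complex.sq_norm, Complex.normSq_apply]; ring
  have hV0 := profile_rpow_nonneg P x
  have hV1 := profile_rpow_le P x
  set V := profile P x ^ (P.p - 1) with hVdef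
  have key : (P.m ^ 2 - P.ω ^ 2 - P.p * V) * ((v x).re ^ 2 + (v x).im ^ 2)
      ≤ (P.m ^ 2 - P.ω ^ 2 - V) * ((v x).re ^ 2 + (v x).im ^ 2)
        - (P.p - 1) * V * (v x).re ^ 2 := by
    have : 0 ≤ (P.p - 1) * V * (v x).im ^ 2 :=
      mul_nonneg (mul_nonneg (by linarith) hV0) (sq_nonneg _)
    linarith
  rw [e4]
  refine le_trans ?_ key
  have hsq : 0 ≤ (v x).re ^ 2 + (v x).im ^ 2 := by positivity
  by_cases hx : x ∈ Set.Ioc (-R) R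
  · rw [Set.indicator_of_mem hx, e5, ← neg_mul]
    refine mul_le_mul_of_nonneg_right ?_ hsq
    have := mul_le_mul_of_nonneg_left hV1 (by linarith : (0 : ℝ) ≤ P.p)
    rw [hC]
    linarith
  · rw [Set.indicator_of_notMem hx]
    refine mul_nonneg ?_ hsq
    have hx' : R ≤ |x| := by
      rw [Set.mem_Ioc, not_and_or, not_lt, not_le] at hx
      rcases hx with hx | hx
      · rw [le_abs]; right; linarith
      · rw [le_abs]; left; linarith
    linarith [hV x hx']

/-- Vanishing at 0 removes the delta term. Vanishing on a fine mesh of [-R, R] makes the Dirichlet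
form dominate the potential by Poincaré's inequality. These are finitely many bounded conditions on
u. -/
theorem exists_hessian_nonneg : ∃ G : Submodule ℝ EnergySpace, FiniteDimensional ℝ G ∧
    ∀ U ∈ Gᗮ, 0 ≤ hessian P U U := by
  obtain ⟨R, hR, hV⟩ := exists_potential_le P
  have hp := P.one_lt_p
  have ha := sq_sub_sq_pos P
  set C := P.p * ((P.p + 1) * (P.m ^ 2 - P.ω ^ 2) / 2) with hC
  have hC0 : 0 < C := by positivity
  -- The number of mesh points is chosen so that the step h = 2R/n satisfies h(C + 1) ≤ 1, whence
  -- Ch² ≤ 1.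
  obtain ⟨n, hn⟩ := exists_nat_gt (2 * R * (C + 1))
  have hn0 : (0 : ℝ) < n := lt_trans (by positivity) hn
  set h : ℝ := 2 * R / n with hh
  have hh0 : 0 < h := by positivity
  have hnh : -R + n * h = R := by rw [hh]; field_simp; ring
  have hCh : C * h ^ 2 ≤ 1 := by
    have h1 : h * (C + 1) ≤ 1 := by
      rw [hh, div_mul_eq_mul_div, div_le_one hn0]; exact hn.le
    have h2 : h ≤ 1 := by nlinarith
    nlinarith
  -- The index `none` stands for the origin and `some j` for the left endpoint of the j-th mesh
  -- interval; right endpoints are not needed.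
  let E : EnergySpace →L[ℝ] PiLp 2 (fun _ : Option (Fin n) => ℂ) :=
    (PiLp.continuousLinearEquiv 2 ℝ (fun _ : Option (Fin n) => ℂ)).symm ∘L
      (ContinuousLinearMap.pi fun o : Option (Fin n) =>
        H1.eval (o.elim 0 fun j => -R + (j : ℕ) * h)) ∘L WithLp.fstL 2 ℝ H1 L2
  have hE : ∀ U o, E U o = H1.rep U.fst (o.elim 0 fun j => -R + (j : ℕ) * h) := fun U o => rfl
  obtain ⟨G, hG, hG'⟩ := exists_finiteDimensional_forall_orthogonal E
  refine ⟨G, hG, fun U hU => ?_⟩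
  have hz : ∀ o : Option (Fin n), H1.rep U.fst (o.elim 0 fun j => -R + (j : ℕ) * h) = 0 := by
    intro o
    rw [← hE, hG' U hU]; rfl
  have h0 : H1.rep U.fst 0 = 0 := hz none
  have h1 := H1.integral_rep_sq_le_of_mesh U.fst (a := -R) hh0.le (n := n)
    fun j hj => hz (some ⟨j, hj⟩)
  rw [hnh] at h1
  have h2 := zerothOrder_form_ge P hR hV U.fst
  have h3 : C * ∫ x in (-R)..R, ‖H1.rep U.fst x‖ ^ 2 ≤ ‖H1.deriv U.fst‖ ^ 2 := by
    refine (mul_le_mul_of_nonneg_left h1 hC0.le).trans ?_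
    rw [← mul_assoc]
    exact mul_le_of_le_one_left (sq_nonneg _) hCh
  rw [hessian_self, h0, norm_zero]
  have h4 := sq_nonneg ‖U.snd - mulIω P (H1.toL2 U.fst)‖
  rw [← hC] at h2
  linarith

/-! ### The number of negative eigenvalues -/

theorem inner_energyGram_comm (U W : EnergySpace) :
    inner ℝ (energyGram U) W = inner ℝ U (energyGram W) := by
  rw [inner_energyGram, real_inner_comm, ← inner_energyGram, real_inner_comm]

theorem inner_energyGram_self_pos {U : EnergySpace} (hU : U ≠ 0) :
    0 < inner ℝ (energyGram U) U := by
  rw [inner_energyGram]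
  refine real_inner_self_pos.2 fun h => hU (energyIncl_injective ?_)
  rw [h, map_zero]

/-- One form, two Gram operators: maximal families for the L² × L² Gram operator and for the
identity have the same size by inertia, and these sizes are the two counts. -/
theorem exists_negEigenvalueCount_eq : ∃ n : ℕ, negEigenvalueCount (matrixOp P) = n ∧
    negEigenvalueCount (hessianPMap P) = n := by
  have hB := inner_hessianOp_comm P
  have hK : ∀ U W : EnergySpace, inner ℝ (ContinuousLinearMap.id ℝ EnergySpace U) W
      = inner ℝ U (ContinuousLinearMap.id ℝ EnergySpace W) := fun U W => rfl
  have hKpos : ∀ U : EnergySpace, U ≠ 0 →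
      0 < inner ℝ (ContinuousLinearMap.id ℝ EnergySpace U) U := fun U hU =>
    real_inner_self_pos.2 hU
  obtain ⟨G, hG, hG'⟩ := exists_hessian_nonneg P
  have hG'' : ∀ U ∈ Gᗮ, 0 ≤ inner ℝ (hessianOp P U) U := fun U hU => by
    rw [inner_hessianOp]; exact hG' U hU
  obtain ⟨c, hc0, hc⟩ := exists_hessian_coercive P
  obtain ⟨n, F, hF⟩ := exists_maximal_negEigenFamily hB inner_energyGram_comm
    (fun U hU => inner_energyGram_self_pos hU) (c := c) (δ := 1 / 2) (by norm_num)
    (fun U => by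
      rw [inner_hessianOp, inner_energyGram, real_inner_self_eq_norm_sq]
      exact hc U) hG''
  obtain ⟨n', F', hF'⟩ := exists_maximal_negEigenFamily hB hK hKpos (c := c) (δ := 1 / 2)
    (by norm_num)
    (fun U => by
      refine (hc U).trans ?_
      rw [inner_hessianOp]
      have h1 := mul_le_mul_of_nonneg_left (norm_sq_energyIncl_le U) hc0
      have h2 : inner ℝ (ContinuousLinearMap.id ℝ EnergySpace U) U = ‖U‖ ^ 2 :=
        real_inner_self_eq_norm_sq U
      rw [h2]
      linarith) hG''
  have h1 := hF.sum_rank_ker hB inner_energyGram_comm fun U hU => inner_energyGram_self_pos hU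
  have h2 := hF'.sum_rank_ker hB hK hKpos
  obtain rfl := hF.card_eq hF'
  refine ⟨n, ?_, ?_⟩
  · rw [← h1]
    refine congrArg Cardinal.sum (funext fun t => ?_)
    exact (LinearEquiv.ofBijective _ (kerEnergyGramMap_bijective P t)).rank_eq.symm
  · rw [← h2]
    refine congrArg Cardinal.sum (funext fun t => ?_)
    exact (kerIdEquiv P t).rank_eq.symm

theorem negEigenvalueCount_hessianPMap : negEigenvalueCount (hessianPMap P)
    = negEigenvalueCount (schrodinger P.β (boundedPart P P.p)) +
      negEigenvalueCount (schrodinger P.β (boundedPart P 1)) := by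
  obtain ⟨n, h1, h2⟩ := exists_negEigenvalueCount_eq P
  rw [h2, ← h1, negEigenvalueCount_matrixOp]

theorem negEigenvalueCount_lt_aleph0 :
    negEigenvalueCount (schrodinger P.β (boundedPart P P.p)) < Cardinal.aleph0 ∧
      negEigenvalueCount (schrodinger P.β (boundedPart P 1)) < Cardinal.aleph0 := by
  obtain ⟨n, h1, h2⟩ := exists_negEigenvalueCount_eq P
  rw [← Cardinal.add_lt_aleph0_iff, ← negEigenvalueCount_matrixOp, h1]
  exact Cardinal.natCast_lt_aleph0

end

end DeltaKG

end

theorem proposition4p5 (P : DeltaKG.Params) :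
    (IsSelfAdjoint (DeltaKG.Lplus P) ∧ DeltaKG.IsBoundedFromBelow (DeltaKG.Lplus P)) ∧
    (IsSelfAdjoint (DeltaKG.Lminus P) ∧ DeltaKG.IsBoundedFromBelow (DeltaKG.Lminus P)) ∧
    (∀ t : ℝ, t ≠ 1 →
      (t ∈ DeltaKG.opSpectrum (DeltaKG.matrixOp P) ↔
        ((DeltaKG.bigLambda P t : ℝ) : ℂ) ∈
          DeltaKG.opSpectrum (DeltaKG.Lplus P) ∪ DeltaKG.opSpectrum (DeltaKG.Lminus P)) ∧
      (Module.rank ℝ (DeltaKG.opKer (DeltaKG.matrixOp P) t) =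
        Module.rank ℂ (DeltaKG.opKer (DeltaKG.Lplus P) ((DeltaKG.bigLambda P t : ℝ) : ℂ)) +
        Module.rank ℂ (DeltaKG.opKer (DeltaKG.Lminus P) ((DeltaKG.bigLambda P t : ℝ) : ℂ))) ∧
      (t ∈ DeltaKG.opEssentialSpectrum (DeltaKG.matrixOp P) ↔
        ((DeltaKG.bigLambda P t : ℝ) : ℂ) ∈
          DeltaKG.opEssentialSpectrum (DeltaKG.Lplus P) ∪
            DeltaKG.opEssentialSpectrum (DeltaKG.Lminus P))) ∧
    (DeltaKG.negEigenvalueCount (DeltaKG.Lplus P) < Cardinal.aleph0 ∧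
      DeltaKG.negEigenvalueCount (DeltaKG.Lminus P) < Cardinal.aleph0 ∧
      DeltaKG.negEigenvalueCount (DeltaKG.hessianPMap P) =
        DeltaKG.negEigenvalueCount (DeltaKG.Lplus P) +
        DeltaKG.negEigenvalueCount (DeltaKG.Lminus P)) := by
  rw [DeltaKG.Lplus_eq, DeltaKG.Lminus_eq]
  exact ⟨DeltaKG.isSelfAdjoint_schrodinger P P.p, DeltaKG.isSelfAdjoint_schrodinger P 1,
    fun t ht => ⟨DeltaKG.mem_opSpectrum_matrixOp_iff P ht, DeltaKG.rank_opKer_matrixOp P ht,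
      DeltaKG.mem_opEssentialSpectrum_matrixOp_iff P ht⟩,
    (DeltaKG.negEigenvalueCount_lt_aleph0 P).1, (DeltaKG.negEigenvalueCount_lt_aleph0 P).2,
    DeltaKG.negEigenvalueCount_hessianPMap P⟩
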